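/- Let $d$ be an even natural number, $\tilde\Omega>0$, and let $\Theta\in M_d(\mathbb R)$ be skew-symmetric and invertible. Let $\mathcal H=L^2(\mathbb R^d)\otimes\bigwedge(\mathbb C^d)$. On $\mathcal S(\mathbb R^d)\otimes\bigwedge(\mathbb C^d)$ put $a_\mu=\partial_\mu+\tilde\Omega x_\mu$ and $a_\mu^*=-\partial_\mu+\tilde\Omega x_\mu$ for $\mu=1,\dots,d$; let $b_\mu^*=e_\mu\wedge\cdot$ be the fermionic creation operators on $\bigwedge(\mathbb C^d)$ and $b_\mu$ their adjoints. Set $Q_1=\sum_\mu a_\mu\otimes b_\mu^*$, $Q_1^*=\sum_\mu a_\mu^*\otimes b_\mu$, $Q_2=\sum_\mu a_\mu\otimes b_\mu$, $Q_2^*=\sum_\mu a_\mu^*\otimes b_\mu^*$, and let $\mathcal D_1$ and $\mathcal D_2$ be the closures in $\mathcal H$ of $Q_1+Q_1^*$ and of $iQ_2-iQ_2^*$, defined on $\mathcal S(\mathbb R^d)\otimes\bigwedge(\mathbb C^d)$. For $f\in\mathcal A_\star=\mathcal S(\mathbb R^d)$ (complex-valued Schwartz functions) let $L_\star(f)$ be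 the bounded operator $\psi\mapsto f\star\psi$ on $\mathcal H$ of componentwise left Moyal multiplication, where $$f\star g(x)=(2\pi)^{-d}\int_{\mathbb R^d}dy\int_{\mathbb R^d}dk\; f\big(x+\tfrac12\Theta k\big)\,g(x+y)\,e^{i\langle k,y\rangle}.$$ Then $\mathcal D_1$ and $\mathcal D_2$ are self-adjoint, and for every $f\in\mathcal A_\star$ there is a finite constant $C(f)$ (which may depend also on $d,\tilde\Omega,\Theta$) such that for $\bullet=1,2$ and all $t>0$ the operator $L_\star(f)e^{-t\mathcal D_\bullet^2}$ is of trace class, and its trace norm satisfies $$\big\|L_\star(f)\,e^{-t\mathcal D_\bullet^2}\big\|_1\le C(f)\,\max\big(t^{-d/2},t^{d/2}\big).$$ -/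

import Mathlib

open MeasureTheory SchwartzMap
open scoped ENNReal InnerProductSpace LineDeriv

noncomputable section

namespace MoyalOscillator

/-! ### Generalities on operators in a complex Hilbert space -/

section Hilbert

variable {H : Type*} [NormedAddCommGroup H] [InnerProductSpace ℂ H] [CompleteSpace H]

/-- The trace norm `‖T‖₁ = Tr |T|`, with values in `[0, ∞]`, where `|T| = (T* T)^{1/2}`. The trace of
the positive operator `|T|` is `∑ᵢ ⟨eᵢ, |T| eᵢ⟩` in any orthonormal basis `(eᵢ)`; the value does not
depend on the basis, and the supremum is taken over all of them. `T` is of trace class if and only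
if this number is finite. -/
def traceNorm (T : H →L[ℂ] H) : ℝ≥0∞ :=
  ⨆ (w : Set H) (e : HilbertBasis w ℂ H),
    ∑' i, ENNReal.ofReal (RCLike.re ⟪e i, CFC.abs T (e i)⟫_ℂ)

/-- `R = (1 + D²)⁻¹` for an unbounded operator `D`: one has `R x = y` if and only if `y` lies in the
domain of `D² = D ∘ D` and `D² y + y = x`. -/
def IsResolventSq (D : H →ₗ.[ℂ] H) (R : H →L[ℂ] H) : Prop :=
  ∀ x y : H, R x = y ↔
    ∃ (hy : y ∈ D.domain) (hDy : D ⟨y, hy⟩ ∈ D.domain), D ⟨D ⟨y, hy⟩, hDy⟩ + y = x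

theorem inner_symm_of_isSelfAdjoint {D : H →ₗ.[ℂ] H} (hD : IsSelfAdjoint D) (x y : D.domain) :
    ⟪D x, (y : H)⟫_ℂ = ⟪(x : H), D y⟫_ℂ := by
  have h := LinearPMap.adjoint_isFormalAdjoint (T := D) hD.dense_domain
  rw [LinearPMap.isSelfAdjoint_def.1 hD] at h
  exact h x y

theorem norm_sq_shift {D : H →ₗ.[ℂ] H} (hD : IsSelfAdjoint D) (c : ℝ) (x : D.domain) :
    ‖D x + (Complex.I * c) • (x : H)‖ ^ 2 = ‖D x‖ ^ 2 + c ^ 2 * ‖(x : H)‖ ^ 2 := by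
  have h1 : (⟪D x, (x : H)⟫_ℂ).im = 0 := by
    have h2 := inner_conj_symm (𝕜 := ℂ) (D x) (x : H)
    rw [← inner_symm_of_isSelfAdjoint hD] at h2
    exact Complex.conj_eq_iff_im.1 h2
  rw [@norm_add_sq ℂ, inner_smul_right, norm_smul, mul_pow]
  simp [h1]

theorem surj_shift {D : H →ₗ.[ℂ] H} (hD : IsSelfAdjoint D) (c : ℝ) (hc : c ^ 2 = 1) (z : H) :
    ∃ x : D.domain, D x + (Complex.I * c) • (x : H) = z := by
  let S : D.domain →ₗ[ℂ] H := D.toFun + (Complex.I * c) • D.domain.subtype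
  have hS : ∀ x, S x = D x + (Complex.I * c) • (x : H) := fun x => rfl
  have hnorm : ∀ x, ‖S x‖ ^ 2 = ‖D x‖ ^ 2 + ‖(x : H)‖ ^ 2 := fun x => by
    rw [hS, norm_sq_shift hD, hc, one_mul]
  have hle : ∀ x : D.domain, ‖x‖ ≤ ‖S x‖ := fun x => by
    have h := hnorm x
    refine le_of_sq_le_sq ?_ (norm_nonneg _)
    rw [h, Submodule.coe_norm]
    nlinarith [sq_nonneg ‖D x‖]
  have hclosed : IsClosed (LinearMap.range S : Set H) := by
    refine isClosed_of_closure_subset fun w hw => ?_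
    obtain ⟨u, hu, hlim⟩ := mem_closure_iff_seq_limit.1 hw
    choose v hv using hu
    have hcau : CauchySeq (fun n => (v n : H)) := by
      have h1 : CauchySeq (fun n => S (v n)) := by
        simp only [hv]; exact hlim.cauchySeq
      rw [Metric.cauchySeq_iff'] at h1 ⊢
      intro ε hε
      obtain ⟨N, hN⟩ := h1 ε hε
      refine ⟨N, fun n hn => lt_of_le_of_lt ?_ (hN n hn)⟩
      rw [dist_eq_norm, dist_eq_norm, ← map_sub]
      exact hle (v n - v N)
    obtain ⟨a, ha⟩ := cauchySeq_tendsto_of_complete hcau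
    have hDv : Filter.Tendsto (fun n => D (v n)) Filter.atTop (nhds (w - (Complex.I * c) • a)) := by
      have : (fun n => D (v n)) = fun n => u n - (Complex.I * c) • (v n : H) := by
        funext n; rw [← hv n, hS]; simp
      rw [this]
      exact hlim.sub (ha.const_smul _)
    have hg : (a, w - (Complex.I * c) • a) ∈ D.graph :=
      hD.isClosed.mem_of_tendsto (ha.prodMk_nhds hDv)
        (Filter.Eventually.of_forall fun n => D.mem_graph (v n))
    obtain ⟨b, hb1, hb2⟩ := (LinearPMap.mem_graph_iff D).1 hg
    refine ⟨b, ?_⟩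
    rw [hS, hb2]
    simp only at hb1 ⊢
    rw [hb1]; simp
  have hperp : (LinearMap.range S)ᗮ = ⊥ := by
    rw [Submodule.eq_bot_iff]
    intro y hy
    have hy' : ∀ x : D.domain, ⟪y, S x⟫_ℂ = 0 := fun x =>
      (Submodule.mem_orthogonal' _ _).1 hy _ ⟨x, rfl⟩
    have hmem : y ∈ D.domain := by
      have : y ∈ (LinearPMap.adjoint D).domain := by
        refine LinearPMap.mem_adjoint_domain_of_exists _
          ⟨(Complex.I * c) • y, fun x => ?_⟩
        have := hy' x
        rw [hS, inner_add_right, inner_smul_right] at this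
        rw [inner_smul_left]
        simp only [map_mul, Complex.conj_I, Complex.conj_ofReal]
        linear_combination -this
      rwa [LinearPMap.isSelfAdjoint_def.1 hD] at this
    have h0 := hy' ⟨y, hmem⟩
    have h1 : (⟪y, D ⟨y, hmem⟩⟫_ℂ).im = 0 := by
      have h2 := inner_conj_symm (𝕜 := ℂ) y (D ⟨y, hmem⟩)
      have h3 := inner_symm_of_isSelfAdjoint hD ⟨y, hmem⟩ ⟨y, hmem⟩
      simp only at h3
      rw [h3] at h2
      exact Complex.conj_eq_iff_im.1 h2
    rw [hS, inner_add_right, inner_smul_right, inner_self_eq_norm_sq_to_K] at h0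
    have h4 := congrArg Complex.im h0
    simp only [Complex.add_im, h1] at h4
    have h5 : c * ‖y‖ ^ 2 = 0 := by
      have : ((Complex.I * (c : ℂ)) * ((‖y‖ : ℂ)) ^ 2).im = c * ‖y‖ ^ 2 := by
        rw [mul_assoc, Complex.I_mul_im]; norm_cast
      rw [← this]; simpa using h4
    have hc0 : c ≠ 0 := by rintro rfl; norm_num at hc
    simpa [hc0] using h5
  have htop : LinearMap.range S = ⊤ := by
    have : CompleteSpace (LinearMap.range S) := hclosed.completeSpace_coe
    exact (Submodule.orthogonal_eq_bot_iff).1 hperp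
  obtain ⟨x, hx⟩ := LinearMap.range_eq_top.1 htop z
  exact ⟨x, hx⟩

/-- The operator `(1 + D²)⁻¹` exists for every self-adjoint `D`. -/
theorem exists_isResolventSq {D : H →ₗ.[ℂ] H} (hD : IsSelfAdjoint D) :
    ∃ R : H →L[ℂ] H, IsResolventSq D R := by
  let P : H → H → Prop := fun x y =>
    ∃ (hy : y ∈ D.domain) (hDy : D ⟨y, hy⟩ ∈ D.domain), D ⟨D ⟨y, hy⟩, hDy⟩ + y = x
  have hadd : ∀ (a : ℂ) (x y x' y' : H), P x y → P x' y' → P (x + a • x') (y + a • y') := by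
    rintro a x y x' y' ⟨h1, h2, h3⟩ ⟨h1', h2', h3'⟩
    have e1 : D ⟨y + a • y', D.domain.add_mem h1 (D.domain.smul_mem a h1')⟩ =
        D ⟨y, h1⟩ + a • D ⟨y', h1'⟩ := by
      rw [← LinearPMap.map_smul, ← LinearPMap.map_add]; rfl
    have m2 : D ⟨y, h1⟩ + a • D ⟨y', h1'⟩ ∈ D.domain :=
      D.domain.add_mem h2 (D.domain.smul_mem a h2')
    have e2 : D ⟨D ⟨y, h1⟩ + a • D ⟨y', h1'⟩, m2⟩ =
        D ⟨_, h2⟩ + a • D ⟨_, h2'⟩ := by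
      have h := D.map_add ⟨_, h2⟩ (a • ⟨_, h2'⟩)
      rw [LinearPMap.map_smul] at h
      exact h
    refine ⟨D.domain.add_mem h1 (D.domain.smul_mem a h1'), by rw [e1]; exact m2, ?_⟩
    simp only [e1]
    rw [e2, ← h3, ← h3', smul_add]
    abel
  have hbd : ∀ x y, P x y → ‖y‖ ≤ ‖x‖ := by
    rintro x y ⟨h1, h2, h3⟩
    have h4 : ⟪y, x⟫_ℂ = ((‖D ⟨y, h1⟩‖ ^ 2 + ‖y‖ ^ 2 : ℝ) : ℂ) := by
      rw [← h3, inner_add_right]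
      have h5 := inner_symm_of_isSelfAdjoint hD ⟨y, h1⟩ ⟨_, h2⟩
      simp only at h5
      rw [← h5, inner_self_eq_norm_sq_to_K, inner_self_eq_norm_sq_to_K]
      push_cast; rfl
    have h5 := norm_inner_le_norm (𝕜 := ℂ) y x
    rw [h4, Complex.norm_real, Real.norm_of_nonneg (by positivity)] at h5
    by_cases hy : ‖y‖ = 0
    · rw [hy]; exact norm_nonneg _
    · have : 0 < ‖y‖ := lt_of_le_of_ne (norm_nonneg _) (Ne.symm hy)
      nlinarith [sq_nonneg ‖D ⟨y, h1⟩‖]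
  have hex : ∀ x, ∃ y, P x y := by
    intro x
    obtain ⟨v, hv⟩ := surj_shift hD (-1) (by norm_num) x
    obtain ⟨u, hu⟩ := surj_shift hD 1 (by norm_num) (v : H)
    have hDu : D u = v - Complex.I • (u : H) := by
      rw [← hu]; simp
    have hm : D u ∈ D.domain := by
      rw [hDu]; exact D.domain.sub_mem v.2 (D.domain.smul_mem _ u.2)
    refine ⟨u, u.2, hm, ?_⟩
    have : (⟨D u, hm⟩ : D.domain) = v - Complex.I • u := Subtype.ext hDu
    rw [show D ⟨D ⟨(u : H), u.2⟩, hm⟩ = D (v - Complex.I • u) from congrArg D this,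
      LinearPMap.map_sub, LinearPMap.map_smul, hDu, ← hv, smul_sub, smul_smul, Complex.I_mul_I]
    simp
    abel
  have huniq : ∀ x y y', P x y → P x y' → y = y' := by
    intro x y y' h h'
    have h1 := hbd _ _ (hadd (-1) _ _ _ _ h h')
    have h2 : ‖y + (-1 : ℂ) • y'‖ ≤ 0 := by simpa using h1
    have h3 := norm_le_zero_iff.1 h2
    rw [neg_one_smul] at h3
    exact add_neg_eq_zero.1 h3
  choose r hr using hex
  have hzero : P 0 0 := ⟨D.domain.zero_mem, by
    rw [show D ⟨0, D.domain.zero_mem⟩ = 0 from D.map_zero]; exact D.domain.zero_mem, by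
    have e : (⟨D ⟨0, D.domain.zero_mem⟩, by
      rw [show D ⟨0, D.domain.zero_mem⟩ = 0 from D.map_zero]; exact D.domain.zero_mem⟩ :
        D.domain) = 0 := Subtype.ext D.map_zero
    rw [e, D.map_zero, add_zero]⟩
  let L : H →ₗ[ℂ] H :=
    { toFun := r
      map_add' := fun x x' => by
        have := hadd 1 _ _ _ _ (hr x) (hr x')
        rw [one_smul, one_smul] at this
        exact huniq _ _ _ (hr _) this
      map_smul' := fun a x => by
        have := hadd a _ _ _ _ hzero (hr x)
        rw [zero_add, zero_add] at this
        exact huniq _ _ _ (hr _) this }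
  refine ⟨L.mkContinuous 1 fun x => by rw [one_mul]; exact hbd _ _ (hr x), fun x y => ?_⟩
  constructor
  · rintro rfl; exact hr x
  · intro h; exact huniq _ _ _ (hr x) h

open scoped Classical in
/-- The bounded operator `(1 + D²)⁻¹`. It exists for every self-adjoint `D`, see
`exists_isResolventSq`; the other branch is a default value. -/
def resolventSq (D : H →ₗ.[ℂ] H) : H →L[ℂ] H :=
  if h : ∃ R : H →L[ℂ] H, IsResolventSq D R then h.choose else 0

/-- The function `r ↦ exp (-t (1/r - 1))` on `(0, ∞)`, extended by `0`. It is continuous on `ℝ` for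
`t > 0`, and maps `1 / (1 + s)` to `exp (-t s)` for `s ≥ 0`. -/
def heatFun (t r : ℝ) : ℝ := if 0 < r then Real.exp (-t * (1 / r - 1)) else 0

/-- The heat operator `exp (-t D²)`, `t > 0`, of a self-adjoint operator `D`, by functional calculus:
`exp (-t D²) = φ ((1 + D²)⁻¹)` with `φ (1 / (1 + s)) = exp (-t s)`. -/
def heat (D : H →ₗ.[ℂ] H) (t : ℝ) : H →L[ℂ] H := cfc (heatFun t) (resolventSq D)

end Hilbert

/-! ### The Hilbert space and the Dirac operators -/

/-- `ℝ^d` with its Euclidean structure. -/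
abbrev Space (d : ℕ) : Type := EuclideanSpace ℝ (Fin d)

/-- The exterior algebra of `ℂ^d` as a Hilbert space: `S = {μ₁ < ⋯ < μₖ}` labels the element
`e_{μ₁} ∧ ⋯ ∧ e_{μₖ}` of its standard orthonormal basis, so the dimension is `2^d`. -/
abbrev Fock (d : ℕ) : Type := EuclideanSpace ℂ (Finset (Fin d))

/-- `L²(ℝ^d) ⊗ Λ(ℂ^d)`, as the space of square integrable functions with values in `Λ(ℂ^d)`. -/
abbrev Hilb (d : ℕ) : Type := Lp (Fock d) 2 (volume : Measure (Space d))

/-- The fermionic creation operator `b_μ*`, that is `e_μ ∧ ·`: it maps `e_T` to `0` if `μ ∈ T`, and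
to `± e_{T ∪ {μ}}` otherwise, the sign being the parity of the number of `ν ∈ T` with `ν < μ`. -/
def bStar {d : ℕ} (μ : Fin d) : Fock d →L[ℂ] Fock d :=
  Matrix.toEuclideanCLM (𝕜 := ℂ) (Matrix.of fun S T : Finset (Fin d) =>
    if μ ∉ T ∧ S = insert μ T then (-1 : ℂ) ^ (T.filter (· < μ)).card else 0)

/-- The fermionic annihilation operator `b_μ`, the adjoint of `b_μ*`. -/
def bAnn {d : ℕ} (μ : Fin d) : Fock d →L[ℂ] Fock d := ContinuousLinearMap.adjoint (bStar μ)

/-- The operator of multiplication by `Ω x_μ` on Schwartz functions. -/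
def mulCoord {d : ℕ} (Ω : ℝ) (μ : Fin d) : 𝓢(Space d, Fock d) →L[ℂ] 𝓢(Space d, Fock d) :=
  smulLeftCLM (Fock d) (fun x : Space d => ((Ω * x μ : ℝ) : ℂ))

theorem mulCoord_apply {d : ℕ} (Ω : ℝ) (μ : Fin d) (ψ : 𝓢(Space d, Fock d)) (x : Space d) :
    mulCoord Ω μ ψ x = ((Ω * x μ : ℝ) : ℂ) • ψ x := by
  have h : (fun x : Space d => ((Ω * x μ : ℝ) : ℂ)).HasTemperateGrowth := by
    have := (Complex.ofRealCLM ∘L (Ω • EuclideanSpace.proj (𝕜 := ℝ) μ :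
      Space d →L[ℝ] ℝ)).hasTemperateGrowth
    exact this
  exact smulLeftCLM_apply_apply h ψ x

/-- The bosonic annihilation operator `a_μ = ∂_μ + Ω x_μ` on `𝓢(ℝ^d) ⊗ Λ(ℂ^d)`. -/
def aAnn {d : ℕ} (Ω : ℝ) (μ : Fin d) : 𝓢(Space d, Fock d) →L[ℂ] 𝓢(Space d, Fock d) :=
  LineDeriv.lineDerivOpCLM ℂ 𝓢(Space d, Fock d) (EuclideanSpace.single μ (1 : ℝ)) + mulCoord Ω μ

/-- The bosonic creation operator `a_μ* = -∂_μ + Ω x_μ` on `𝓢(ℝ^d) ⊗ Λ(ℂ^d)`. -/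
def aStar {d : ℕ} (Ω : ℝ) (μ : Fin d) : 𝓢(Space d, Fock d) →L[ℂ] 𝓢(Space d, Fock d) :=
  -LineDeriv.lineDerivOpCLM ℂ 𝓢(Space d, Fock d) (EuclideanSpace.single μ (1 : ℝ)) + mulCoord Ω μ

/-- The operator `1 ⊗ b` on `𝓢(ℝ^d) ⊗ Λ(ℂ^d)`. -/
def onFock {d : ℕ} (b : Fock d →L[ℂ] Fock d) : 𝓢(Space d, Fock d) →L[ℂ] 𝓢(Space d, Fock d) :=
  postcompCLM b

/-- The supercharge `Q₁ = ∑_μ a_μ ⊗ b_μ*`. -/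
def charge₁ (d : ℕ) (Ω : ℝ) : 𝓢(Space d, Fock d) →L[ℂ] 𝓢(Space d, Fock d) :=
  ∑ μ, aAnn Ω μ ∘L onFock (bStar μ)

/-- The formal adjoint `Q₁* = ∑_μ a_μ* ⊗ b_μ`. -/
def chargeStar₁ (d : ℕ) (Ω : ℝ) : 𝓢(Space d, Fock d) →L[ℂ] 𝓢(Space d, Fock d) :=
  ∑ μ, aStar Ω μ ∘L onFock (bAnn μ)

/-- The supercharge `Q₂ = ∑_μ a_μ ⊗ b_μ`. -/
def charge₂ (d : ℕ) (Ω : ℝ) : 𝓢(Space d, Fock d) →L[ℂ] 𝓢(Space d, Fock d) :=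
  ∑ μ, aAnn Ω μ ∘L onFock (bAnn μ)

/-- The formal adjoint `Q₂* = ∑_μ a_μ* ⊗ b_μ*`. -/
def chargeStar₂ (d : ℕ) (Ω : ℝ) : 𝓢(Space d, Fock d) →L[ℂ] 𝓢(Space d, Fock d) :=
  ∑ μ, aStar Ω μ ∘L onFock (bStar μ)

/-- The two Dirac operators on Schwartz functions: `Q₁ + Q₁*` and `i Q₂ - i Q₂*` (the values at `0`
and at `1`). -/
def diracSchwartz (d : ℕ) (Ω : ℝ) : Fin 2 → (𝓢(Space d, Fock d) →L[ℂ] 𝓢(Space d, Fock d)) :=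
  ![charge₁ d Ω + chargeStar₁ d Ω, Complex.I • charge₂ d Ω - Complex.I • chargeStar₂ d Ω]

/-- The embedding of the Schwartz functions into `L²(ℝ^d) ⊗ Λ(ℂ^d)`. -/
def embed (d : ℕ) : 𝓢(Space d, Fock d) →ₗ[ℂ] Hilb d :=
  (toLpCLM ℂ (Fock d) 2 (volume : Measure (Space d))).toLinearMap

theorem embed_injective (d : ℕ) : Function.Injective (embed d) :=
  injective_toLp 2 (volume : Measure (Space d))

/-- The Dirac operators as unbounded operators in `L²(ℝ^d) ⊗ Λ(ℂ^d)` with domain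
`𝓢(ℝ^d) ⊗ Λ(ℂ^d)`. -/
def diracCore (d : ℕ) (Ω : ℝ) (j : Fin 2) : Hilb d →ₗ.[ℂ] Hilb d where
  domain := LinearMap.range (embed d)
  toFun := embed d ∘ₗ (diracSchwartz d Ω j).toLinearMap ∘ₗ
    (LinearEquiv.ofInjective (embed d) (embed_injective d)).symm.toLinearMap

/-- The Dirac operators `D₁` (for `j = 0`) and `D₂` (for `j = 1`): the closures of the operators on
Schwartz functions. -/
def dirac (d : ℕ) (Ω : ℝ) (j : Fin 2) : Hilb d →ₗ.[ℂ] Hilb d := (diracCore d Ω j).closure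

/-! ### The Moyal product -/

/-- The Moyal product
`f ⋆ g (x) = (2π)^{-d} ∫ dy ∫ dk f (x + ½ Θ k) g (x + y) exp (i ⟨k, y⟩)`. -/
def moyal {d : ℕ} {F : Type*} [NormedAddCommGroup F] [NormedSpace ℂ F]
    (Θ : Matrix (Fin d) (Fin d) ℝ) (f : Space d → ℂ) (g : Space d → F) (x : Space d) : F :=
  ((2 * Real.pi : ℂ) ^ d)⁻¹ • ∫ y : Space d, ∫ k : Space d,
    (f (x + (1 / 2 : ℝ) • Matrix.toEuclideanLin Θ k) * Complex.exp (Complex.I * (⟪k, y⟫_ℝ : ℝ))) •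
      g (x + y)

/-- `T` is the bounded operator `ψ ↦ f ⋆ ψ` on `L²(ℝ^d) ⊗ Λ(ℂ^d)`. -/
def IsLeftMoyal {d : ℕ} (Θ : Matrix (Fin d) (Fin d) ℝ) (f : 𝓢(Space d, ℂ))
    (T : Hilb d →L[ℂ] Hilb d) : Prop :=
  ∀ ψ : Hilb d, T ψ =ᵐ[volume] moyal Θ f ψ

theorem moyal_eq {d : ℕ} {Θ : Matrix (Fin d) (Fin d) ℝ} (hΘ : IsUnit Θ.det) (f : 𝓢(Space d, ℂ)) :
    ∃ (G : 𝓢(Space d, ℂ)) (B : Space d →L[ℝ] Space d), ∀ (ψ : Space d → Fock d) (x : Space d),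
      moyal Θ f ψ x =
        ∫ y, (Complex.exp (-(Complex.I * (⟪B x, y⟫_ℝ : ℝ))) * G y) • ψ (x + y) := by
  have hc : (2 * Real.pi)⁻¹ ≠ 0 := by positivity
  let A₀ : Space d ≃ₗ[ℝ] Space d := LinearEquiv.ofLinearMap
    ((1 / 2 : ℝ) • Matrix.toEuclideanLin Θ) ((2 : ℝ) • Matrix.toEuclideanLin Θ⁻¹)
    (by ext x i
        simp [Matrix.toLpLin_apply, Matrix.mulVec_mulVec,
          Matrix.mul_nonsing_inv _ hΘ])
    (by ext x i
        simp [Matrix.toLpLin_apply, Matrix.mulVec_mulVec,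
          Matrix.nonsing_inv_mul _ hΘ])
  let A : Space d ≃L[ℝ] Space d := A₀.toContinuousLinearEquiv
  have hA : ∀ k, (1 / 2 : ℝ) • Matrix.toEuclideanLin Θ k = A k := fun k => rfl
  let fA : 𝓢(Space d, ℂ) := compCLMOfContinuousLinearEquiv ℂ A f
  let sc : Space d ≃L[ℝ] Space d :=
    ContinuousLinearEquiv.smulLeft (Units.mk0 ((2 * Real.pi)⁻¹ : ℝ) hc)
  let G₀ : 𝓢(Space d, ℂ) := compCLMOfContinuousLinearEquiv ℂ sc (FourierTransformInv.fourierInv fA)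
  refine ⟨((2 * Real.pi : ℂ) ^ d)⁻¹ • G₀, (A.symm : Space d →L[ℝ] Space d), fun ψ x => ?_⟩
  rw [moyal, ← integral_smul]
  congr 1
  funext y
  rw [integral_smul_const, smul_smul]
  congr 1
  have h1 : G₀ y = ∫ k : Space d, f (A k) * Complex.exp (Complex.I * (⟪k, y⟫_ℝ : ℝ)) := by
    have : G₀ y = FourierTransformInv.fourierInv (fA : Space d → ℂ) ((2 * Real.pi)⁻¹ • y) := by
      rw [← fourierInv_coe]; rfl
    rw [this, Real.fourierInv_eq']
    congr 1
    funext k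
    have e : 2 * Real.pi * ⟪k, (2 * Real.pi)⁻¹ • y⟫_ℝ = ⟪k, y⟫_ℝ := by
      rw [inner_smul_right]; field_simp
    rw [e, smul_eq_mul, mul_comm, mul_comm Complex.I]
    rfl
  have h2 : (∫ k : Space d, f (x + (1 / 2 : ℝ) • Matrix.toEuclideanLin Θ k) *
        Complex.exp (Complex.I * (⟪k, y⟫_ℝ : ℝ))) =
      Complex.exp (-(Complex.I * (⟪A.symm x, y⟫_ℝ : ℝ))) * G₀ y := by
    rw [h1, ← integral_const_mul,
      ← integral_add_right_eq_self (μ := (volume : Measure (Space d))) (fun k =>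
        Complex.exp (-(Complex.I * (⟪A.symm x, y⟫_ℝ : ℝ))) *
          (f (A k) * Complex.exp (Complex.I * (⟪k, y⟫_ℝ : ℝ)))) (A.symm x)]
    congr 1
    funext k
    rw [hA, map_add A, A.apply_symm_apply, add_comm (A k) x, inner_add_left, Complex.ofReal_add,
      mul_add, Complex.exp_add, Complex.exp_neg]
    field_simp
  rw [h2]
  change _ = Complex.exp (-(Complex.I * (⟪A.symm x, y⟫_ℝ : ℝ))) *
    (((2 * Real.pi : ℂ) ^ d)⁻¹ * G₀ y)
  ring

theorem lintegral_sq_le {α : Type*} [MeasurableSpace α] (μ : Measure α) {u v : α → ℝ≥0∞}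
    (hu : Measurable u) (hv : Measurable v) :
    (∫⁻ y, u y * v y ∂μ) ^ (2 : ℝ) ≤ (∫⁻ y, u y ∂μ) * ∫⁻ y, u y * v y ^ (2 : ℝ) ∂μ := by
  have h := ENNReal.lintegral_mul_le_Lp_mul_Lq μ (p := 2) (q := 2) Real.HolderConjugate.two_two
    (f := fun y => u y ^ (1 / 2 : ℝ)) (g := fun y => u y ^ (1 / 2 : ℝ) * v y)
    (by fun_prop) (by fun_prop)
  have e1 : ∀ z : ℝ≥0∞, (z ^ (1 / 2 : ℝ)) ^ (2 : ℝ) = z := fun z => by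
    rw [← ENNReal.rpow_mul]; norm_num
  have e2 : ∀ z : ℝ≥0∞, z ^ (1 / 2 : ℝ) * z ^ (1 / 2 : ℝ) = z := fun z => by
    rw [← ENNReal.rpow_add_of_nonneg _ _ (by norm_num) (by norm_num)]; norm_num
  simp only [Pi.mul_apply, ← mul_assoc, e2, ENNReal.mul_rpow_of_nonneg _ _ (zero_le_two (α := ℝ)),
    e1] at h
  calc _ ≤ _ := ENNReal.rpow_le_rpow h (zero_le_two (α := ℝ))
    _ = _ := by rw [ENNReal.mul_rpow_of_nonneg _ _ (zero_le_two (α := ℝ)), e1, e1]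

theorem kernel_bound {d : ℕ} (G : 𝓢(Space d, ℂ)) (B : Space d →L[ℝ] Space d)
    {ψ : Space d → Fock d} (hψ : StronglyMeasurable ψ) :
    eLpNorm (fun x => ∫ y, (Complex.exp (-(Complex.I * (⟪B x, y⟫_ℝ : ℝ))) * G y) • ψ (x + y)) 2
      (volume : Measure (Space d)) ≤ (∫⁻ y, ‖G y‖ₑ) * eLpNorm ψ 2 (volume : Measure (Space d)) := by
  have hG : Measurable fun y => ‖G y‖ₑ := by fun_prop
  have hψm : Measurable fun y => ‖ψ y‖ₑ := hψ.enorm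
  have hF : Measurable (Function.uncurry fun x y : Space d => ‖G y‖ₑ * ‖ψ (x + y)‖ₑ ^ (2 : ℝ)) :=
    (hG.comp measurable_snd).mul
      ((hψm.comp (measurable_fst.add measurable_snd)).pow_const (2 : ℝ))
  have h1 : ∀ x, ‖∫ y, (Complex.exp (-(Complex.I * (⟪B x, y⟫_ℝ : ℝ))) * G y) • ψ (x + y)‖ₑ ≤
      ∫⁻ y, ‖G y‖ₑ * ‖ψ (x + y)‖ₑ := fun x => by
    refine (enorm_integral_le_lintegral_enorm _).trans (le_of_eq ?_)
    congr 1
    funext y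
    have : ‖Complex.exp (-(Complex.I * (⟪B x, y⟫_ℝ : ℝ)))‖ₑ = 1 := by
      rw [← ofReal_norm, Complex.norm_exp]; simp
    rw [enorm_smul, enorm_mul, this, one_mul]
  rw [eLpNorm_eq_lintegral_rpow_enorm_toReal (by norm_num) (by norm_num),
    eLpNorm_eq_lintegral_rpow_enorm_toReal (by norm_num) (by norm_num)]
  simp only [ENNReal.toReal_ofNat]
  set c := ∫⁻ y, ‖G y‖ₑ
  have h2 : ∫⁻ x : Space d, (∫⁻ y : Space d, ‖G y‖ₑ * ‖ψ (x + y)‖ₑ) ^ (2 : ℝ) ≤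
      c ^ (2 : ℝ) * ∫⁻ x, ‖ψ x‖ₑ ^ (2 : ℝ) := by
    calc _ ≤ ∫⁻ x : Space d, c * ∫⁻ y : Space d, ‖G y‖ₑ * ‖ψ (x + y)‖ₑ ^ (2 : ℝ) :=
          lintegral_mono fun x => lintegral_sq_le _ hG (by fun_prop)
      _ = c * ∫⁻ x : Space d, ∫⁻ y : Space d, ‖G y‖ₑ * ‖ψ (x + y)‖ₑ ^ (2 : ℝ) :=
          lintegral_const_mul _ (Measurable.lintegral_prod_right hF)
      _ = c * ∫⁻ y : Space d, ∫⁻ x : Space d, ‖G y‖ₑ * ‖ψ (x + y)‖ₑ ^ (2 : ℝ) := by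
          rw [lintegral_lintegral_swap]
          exact hF.aemeasurable
      _ = c * ∫⁻ y : Space d, ‖G y‖ₑ * ∫⁻ x : Space d, ‖ψ x‖ₑ ^ (2 : ℝ) := by
          congr 2
          funext y
          rw [lintegral_const_mul _ (by fun_prop),
            lintegral_add_right_eq_self (fun x => ‖ψ x‖ₑ ^ (2 : ℝ)) y]
      _ = _ := by
          rw [lintegral_mul_const _ hG, ← mul_assoc, ENNReal.rpow_two, sq]
  calc _ ≤ (∫⁻ x : Space d, (∫⁻ y : Space d, ‖G y‖ₑ * ‖ψ (x + y)‖ₑ) ^ (2 : ℝ)) ^ (1 / 2 : ℝ) := by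
        gcongr with x
        exact h1 x
    _ ≤ (c ^ (2 : ℝ) * ∫⁻ x, ‖ψ x‖ₑ ^ (2 : ℝ)) ^ (1 / 2 : ℝ) := by gcongr
    _ = _ := by
        rw [ENNReal.mul_rpow_of_nonneg _ _ (by norm_num), ← ENNReal.rpow_mul]; norm_num

/-- The bounded operator `L_⋆(f)` exists for invertible `Θ`. -/
theorem exists_isLeftMoyal {d : ℕ} {Θ : Matrix (Fin d) (Fin d) ℝ} (hΘ : IsUnit Θ.det)
    (f : 𝓢(Space d, ℂ)) : ∃ T : Hilb d →L[ℂ] Hilb d, IsLeftMoyal Θ f T := by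
  obtain ⟨G, B, hGB⟩ := moyal_eq hΘ f
  let m : Space d → Space d → ℂ := fun x y => Complex.exp (-(Complex.I * (⟪B x, y⟫_ℝ : ℝ))) * G y
  have hm : Continuous (Function.uncurry m) := by
    have : Continuous fun p : Space d × Space d => G p.2 := G.continuous.comp continuous_snd
    simp only [m, Function.uncurry_def]
    fun_prop
  have hmx : ∀ x, MemLp (m x) 2 (volume : Measure (Space d)) := fun x => by
    refine (G.memLp 2 volume).of_le
      (hm.comp (by fun_prop : Continuous fun y => (x, y))).aestronglyMeasurable
      (Filter.Eventually.of_forall fun y => ?_)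
    simp [m, Complex.norm_exp]
  have hG1 : ∫⁻ y, ‖G y‖ₑ ≠ ∞ := (G.integrable (μ := volume)).2.ne
  have hmeas : ∀ ψ : Hilb d, StronglyMeasurable (moyal Θ f ψ) := fun ψ => by
    have : (moyal Θ f ψ) = fun x => ∫ y, m x y • ψ (x + y) := funext fun x => hGB ψ x
    rw [this]
    refine StronglyMeasurable.integral_prod_right ?_
    exact hm.stronglyMeasurable.smul
      ((Lp.stronglyMeasurable ψ).comp_measurable (measurable_fst.add measurable_snd))
  have hbd : ∀ ψ : Hilb d, eLpNorm (moyal Θ f ψ) 2 (volume : Measure (Space d)) ≤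
      (∫⁻ y, ‖G y‖ₑ) * eLpNorm ψ 2 (volume : Measure (Space d)) := fun ψ => by
    rw [show (moyal Θ f ψ) = _ from funext fun x => hGB ψ x]
    exact kernel_bound G B (Lp.stronglyMeasurable ψ)
  have hmem : ∀ ψ : Hilb d, MemLp (moyal Θ f ψ) 2 (volume : Measure (Space d)) := fun ψ =>
    ⟨(hmeas ψ).aestronglyMeasurable,
      (hbd ψ).trans_lt (ENNReal.mul_lt_top hG1.lt_top (Lp.memLp ψ).2)⟩
  have hshift : ∀ (ψ φ : Space d → Fock d) (x : Space d), ψ =ᵐ[volume] φ →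
      (fun y => ψ (x + y)) =ᵐ[volume] fun y => φ (x + y) := fun ψ φ x h =>
    (measurePreserving_add_left (volume : Measure (Space d)) x).quasiMeasurePreserving.ae_eq_comp h
  have hint : ∀ (ψ : Hilb d) (x : Space d), Integrable fun y => m x y • ψ (x + y) := fun ψ x => by
    have := ((Lp.memLp ψ).comp_measurePreserving
      (measurePreserving_add_left (volume : Measure (Space d)) x)).smul (r := 1) (hmx x)
    exact memLp_one_iff_integrable.1 this
  let L : Hilb d →ₗ[ℂ] Hilb d :=
    { toFun := fun ψ => (hmem ψ).toLp
      map_add' := fun ψ φ => by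
        rw [← MemLp.toLp_add]
        congr 1
        funext x
        simp only [Pi.add_apply, hGB]
        rw [← integral_add (hint ψ x) (hint φ x)]
        refine integral_congr_ae ?_
        filter_upwards [hshift _ _ x (Lp.coeFn_add ψ φ)] with y hy
        simp only [Pi.add_apply] at hy
        rw [hy, smul_add]
      map_smul' := fun a ψ => by
        rw [RingHom.id_apply, ← MemLp.toLp_const_smul]
        congr 1
        funext x
        simp only [Pi.smul_apply, hGB]
        rw [← integral_smul]
        refine integral_congr_ae ?_
        filter_upwards [hshift _ _ x (Lp.coeFn_smul a ψ)] with y hy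
        simp only [Pi.smul_apply] at hy
        rw [hy, smul_comm] }
  refine ⟨L.mkContinuous (∫⁻ y, ‖G y‖ₑ).toReal fun ψ => ?_, fun ψ => (hmem ψ).coeFn_toLp⟩
  change ‖(hmem ψ).toLp‖ ≤ _
  rw [Lp.norm_toLp, Lp.norm_def, ← ENNReal.toReal_mul]
  exact ENNReal.toReal_mono (ENNReal.mul_ne_top hG1 (Lp.memLp ψ).2.ne) (hbd ψ)

open scoped Classical in
/-- The operator `L_⋆(f)` of left Moyal multiplication `ψ ↦ f ⋆ ψ` on `L²(ℝ^d) ⊗ Λ(ℂ^d)`. It exists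
for invertible `Θ`, see `exists_isLeftMoyal`; the other branch is a default value. -/
def leftMoyal {d : ℕ} (Θ : Matrix (Fin d) (Fin d) ℝ) (f : 𝓢(Space d, ℂ)) : Hilb d →L[ℂ] Hilb d :=
  if h : ∃ T : Hilb d →L[ℂ] Hilb d, IsLeftMoyal Θ f T then h.choose else 0

end MoyalOscillator

end

/-!
The Dirac operator `D` is symmetric on the Schwartz functions. The anticommutation relations
identify `D²` there with a harmonic oscillator plus a multiple of the fermion number, so the Hermite
functions are eigenvectors of `D²` with nonnegative eigenvalues. They are total, which makes `D`
essentially self-adjoint and determines `exp (-t D²)`.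

The heat operator rescales Gaussian coherent states, and comparing matrix elements between coherent
states gives `exp (-t D²) = ∑ S, c S • ∫ w z |S, z⟩⟨S, z| dz`, where `z = (q, p)` ranges over phase
space, `w` is a Gaussian weight and `0 ≤ c S ≤ 1`. Hence `‖T exp (-t D²)‖₁` is at most a constant
times `∫ w z sup_S ‖T |S, z⟩‖ dz`. For `t ≥ 1` the integral of `w` is bounded. For `t ≤ 1`, the norm
of `L⋆(f) |S, (q, p)⟩` is controlled by a windowed Fourier transform of a Schwartz function and
decays rapidly in `p - B q` for a linear map `B`: integrating over `p` first leaves the Gaussian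
integral over `q`, which is of order `t ^ (-d / 2)`.
-/

noncomputable section

namespace MoyalOscillator

/-! ### Essential self-adjointness -/

section FormalAdjoint

variable {𝕜 E F : Type*} [RCLike 𝕜] [NormedAddCommGroup E] [InnerProductSpace 𝕜 E]
  [NormedAddCommGroup F] [InnerProductSpace 𝕜 F]

theorem isFormalAdjoint_closure_right {T : E →ₗ.[𝕜] F} {S : F →ₗ.[𝕜] E}
    (h : T.IsFormalAdjoint S) (hS : S.IsClosable) : T.IsFormalAdjoint S.closure := by
  intro x y
  have hy : ((y : F), S.closure y) ∈ closure (S.graph : Set (F × E)) := by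
    rw [← Submodule.topologicalClosure_coe, hS.graph_closure_eq_closure_graph]
    exact S.closure.mem_graph y
  have hclosed : IsClosed {p : F × E | ⟪T x, p.1⟫_𝕜 = ⟪(x : E), p.2⟫_𝕜} :=
    isClosed_eq (by fun_prop) (by fun_prop)
  refine closure_minimal ?_ hclosed hy
  rintro ⟨_, _⟩ hp
  obtain ⟨z, rfl, rfl⟩ := (LinearPMap.mem_graph_iff S).1 hp
  exact h x z

theorem isFormalAdjoint_closure {A : E →ₗ.[𝕜] E} (hsymm : A.IsFormalAdjoint A)
    (hA : A.IsClosable) : A.closure.IsFormalAdjoint A.closure :=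
  isFormalAdjoint_closure_right (isFormalAdjoint_closure_right hsymm hA).symm hA

theorem isClosable_of_isFormalAdjoint [CompleteSpace E] {T : E →ₗ.[𝕜] F} {S : F →ₗ.[𝕜] E}
    (h : T.IsFormalAdjoint S) (hT : Dense (T.domain : Set E)) : S.IsClosable :=
  (LinearPMap.adjoint_isClosed hT).isClosable.leIsClosable (h.le_adjoint hT)

end FormalAdjoint

section EssentialSelfAdjointness

variable {H : Type*} [NormedAddCommGroup H] [InnerProductSpace ℂ H]

/-- The operator `A + c` on the domain of the unbounded operator `A`. -/
def shift (A : H →ₗ.[ℂ] H) (c : ℂ) : A.domain →ₗ[ℂ] H := A.toFun + c • A.domain.subtype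

theorem shift_apply (A : H →ₗ.[ℂ] H) (c : ℂ) (x : A.domain) :
    shift A c x = A x + c • (x : H) := rfl

/-- `v` is an eigenvector of `A²` with eigenvalue `l` (or zero). -/
def IsSqEigenvector (A : H →ₗ.[ℂ] H) (l : ℝ) (v : H) : Prop :=
  ∃ (hv : v ∈ A.domain) (hAv : A ⟨v, hv⟩ ∈ A.domain), A ⟨_, hAv⟩ = (l : ℂ) • v

theorem IsSqEigenvector.mono {A B : H →ₗ.[ℂ] H} (hAB : A ≤ B) {l : ℝ} {v : H}
    (h : IsSqEigenvector A l v) : IsSqEigenvector B l v := by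
  obtain ⟨hv, hAv, hl⟩ := h
  have hBv : B ⟨v, hAB.1 hv⟩ = A ⟨v, hv⟩ := (hAB.2 rfl).symm
  have hBAv : B ⟨A ⟨v, hv⟩, hAB.1 hAv⟩ = A ⟨_, hAv⟩ := (hAB.2 rfl).symm
  refine ⟨hAB.1 hv, hBv ▸ hAB.1 hAv, ?_⟩
  rw [← hl, ← hBAv]
  exact congrArg B (Subtype.ext hBv)

-- `(A + c) (A - c) v = (l - c²) v`
theorem IsSqEigenvector.mem_range_shift {A : H →ₗ.[ℂ] H} {l : ℝ} {v : H}
    (h : IsSqEigenvector A l v) {c : ℂ} (hc : (l : ℂ) - c ^ 2 ≠ 0) :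
    v ∈ LinearMap.range (shift A c) := by
  obtain ⟨hv, hAv, hl⟩ := h
  refine ⟨((l : ℂ) - c ^ 2)⁻¹ • (⟨_, hAv⟩ - c • ⟨v, hv⟩), ?_⟩
  rw [map_smul, inv_smul_eq_iff₀ hc, shift_apply, LinearPMap.map_sub, LinearPMap.map_smul, hl]
  simp only [Submodule.coe_sub, Submodule.coe_smul]
  module

theorem norm_sq_shift_I {A : H →ₗ.[ℂ] H} (hsymm : A.IsFormalAdjoint A) (x : A.domain) :
    ‖shift A Complex.I x‖ ^ 2 = ‖A x‖ ^ 2 + ‖(x : H)‖ ^ 2 := by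
  have hreal : (⟪A x, (x : H)⟫_ℂ).im = 0 := by
    rw [← Complex.conj_eq_iff_im, inner_conj_symm]
    exact (hsymm x x).symm
  rw [shift_apply, @norm_add_sq ℂ, inner_smul_right, norm_smul]
  simp [hreal]

theorem dense_range_shift_mono {A B : H →ₗ.[ℂ] H} (hAB : A ≤ B) {c : ℂ}
    (h : Dense (LinearMap.range (shift A c) : Set H)) :
    Dense (LinearMap.range (shift B c) : Set H) := by
  refine h.mono ?_
  rintro _ ⟨x, rfl⟩
  exact ⟨⟨x, hAB.1 x.2⟩, by rw [shift_apply, shift_apply, hAB.2 (y := ⟨x, hAB.1 x.2⟩) rfl]⟩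

variable [CompleteSpace H]

-- On the graph of `A`, which is complete, `(x, A x) ↦ A x + i x` does not decrease norms.
theorem isClosed_range_shift_I {A : H →ₗ.[ℂ] H} (hsymm : A.IsFormalAdjoint A)
    (hA : A.IsClosed) : IsClosed (LinearMap.range (shift A Complex.I) : Set H) := by
  let g : A.graph →L[ℂ] H := (.snd ℂ H H + Complex.I • .fst ℂ H H) ∘L A.graph.subtypeL
  have hg : ∀ (x : A.domain) (hx : ((x : H), A x) ∈ A.graph),
      g ⟨_, hx⟩ = shift A Complex.I x := fun _ _ => rfl
  have hbound : ∀ p, ‖p‖ ≤ (1 : NNReal) * ‖g p‖ := by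
    rintro ⟨⟨_, _⟩, hp⟩
    obtain ⟨x, rfl, rfl⟩ := (LinearPMap.mem_graph_iff A).1 hp
    have hnorm := norm_sq_shift_I hsymm x
    have hx : ‖(x : H)‖ ≤ ‖shift A Complex.I x‖ :=
      le_of_sq_le_sq (by nlinarith) (norm_nonneg _)
    have hAx : ‖A x‖ ≤ ‖shift A Complex.I x‖ :=
      le_of_sq_le_sq (by nlinarith) (norm_nonneg _)
    rw [hg, NNReal.coe_one, one_mul]
    exact max_le hx hAx
  have hrange : Set.range g = LinearMap.range (shift A Complex.I) := by
    ext z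
    constructor
    · rintro ⟨⟨⟨_, _⟩, hp⟩, rfl⟩
      obtain ⟨x, rfl, rfl⟩ := (LinearPMap.mem_graph_iff A).1 hp
      exact ⟨x, rfl⟩
    · rintro ⟨x, rfl⟩
      exact ⟨⟨_, A.mem_graph x⟩, rfl⟩
  have : CompleteSpace A.graph := hA.completeSpace_coe
  rw [← hrange]
  exact (g.antilipschitz_of_bound hbound).isClosed_range g.uniformContinuous

theorem isSelfAdjoint_of_dense_range_shift {A : H →ₗ.[ℂ] H} (hA : A.IsClosed)
    (hdense : Dense (A.domain : Set H)) (hsymm : A.IsFormalAdjoint A)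
    (hpos : Dense (LinearMap.range (shift A Complex.I) : Set H))
    (hneg : Dense (LinearMap.range (shift A (-Complex.I)) : Set H)) : IsSelfAdjoint A := by
  rw [LinearPMap.isSelfAdjoint_def]
  refine le_antisymm (LinearPMap.le_of_le_graph ?_) (hsymm.le_adjoint hdense)
  rintro ⟨_, _⟩ hp
  obtain ⟨y, rfl, rfl⟩ := (LinearPMap.mem_graph_iff _).1 hp
  obtain ⟨x, hx⟩ : A.adjoint y + Complex.I • (y : H) ∈ LinearMap.range (shift A Complex.I) := by
    rw [← SetLike.mem_coe, (isClosed_range_shift_I hsymm hA).closure_eq.symm, hpos.closure_eq]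
    trivial
  rw [shift_apply] at hx
  have hxy : (y : H) - x = 0 := by
    refine hneg.eq_zero_of_inner_left (𝕜 := ℂ) ?_
    rintro _ ⟨u, rfl⟩
    have hyu := LinearPMap.adjoint_isFormalAdjoint hdense y u
    have hxu := hsymm x u
    have hinner := congrArg (⟪·, (u : H)⟫_ℂ) hx
    simp only [inner_add_left, inner_smul_left] at hinner
    simp only [shift_apply, inner_add_right, inner_sub_left, inner_smul_right,
      Complex.conj_I] at hinner ⊢
    linear_combination -hyu + hxu - hinner
  rw [sub_eq_zero.1 hxy, add_left_inj] at hx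
  rw [sub_eq_zero.1 hxy, ← hx]
  exact A.mem_graph x

theorem isSelfAdjoint_closure_of_dense_sqEigenvectors {A : H →ₗ.[ℂ] H}
    (hsymm : A.IsFormalAdjoint A)
    (htotal : Dense (Submodule.span ℂ {v | ∃ l : ℝ, 0 ≤ l ∧ IsSqEigenvector A l v} : Set H)) :
    IsSelfAdjoint A.closure := by
  have hdense : Dense (A.domain : Set H) := by
    refine htotal.mono (Submodule.span_le.2 ?_)
    rintro v ⟨_, _, hv, _⟩
    exact hv
  have hrange : ∀ c : ℂ, c ^ 2 = -1 → Dense (LinearMap.range (shift A c) : Set H) := by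
    refine fun c hc => htotal.mono (Submodule.span_le.2 ?_)
    rintro v ⟨l, hl, hv⟩
    refine hv.mem_range_shift ?_
    rw [hc, sub_neg_eq_add]
    exact_mod_cast (by positivity : l + 1 ≠ 0)
  have hclosable := isClosable_of_isFormalAdjoint hsymm hdense
  exact isSelfAdjoint_of_dense_range_shift hclosable.closure_isClosed
    (hdense.mono A.le_closure.1) (isFormalAdjoint_closure hsymm hclosable)
    (dense_range_shift_mono A.le_closure (hrange _ Complex.I_sq))
    (dense_range_shift_mono A.le_closure (hrange _ (by rw [neg_sq, Complex.I_sq])))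

end EssentialSelfAdjointness

/-! ### Heat operators on eigenvectors -/

section Heat

theorem continuous_heatFun {t : ℝ} (ht : 0 < t) : Continuous (heatFun t) := by
  have hglue : heatFun t = fun r => Real.exp t * expNegInvGlue (r / t) := by
    funext r
    rw [heatFun, expNegInvGlue]
    rcases lt_or_ge 0 r with hr | hr
    · rw [if_pos hr, if_neg (not_le.2 (by positivity)), ← Real.exp_add]
      congr 1
      field_simp
      ring
    · rw [if_neg hr.not_gt, if_pos (div_nonpos_of_nonpos_of_nonneg hr ht.le), mul_zero]
  rw [hglue]
  exact continuous_const.mul ((expNegInvGlue.contDiff (n := 0)).continuous.comp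
    (continuous_id.div_const t))

theorem heatFun_inv_one_add (t : ℝ) {l : ℝ} (hl : 0 ≤ l) :
    heatFun t (1 + l)⁻¹ = Real.exp (-t * l) := by
  rw [heatFun, if_pos (by positivity), one_div, inv_inv, add_sub_cancel_left]

variable {H : Type*} [NormedAddCommGroup H] [InnerProductSpace ℂ H]

theorem mem_spectrum_of_apply_eq_smul {a : H →L[ℂ] H} {r : ℝ} {v : H} (hv0 : v ≠ 0)
    (hv : a v = (r : ℂ) • v) : r ∈ spectrum ℝ a := by
  intro hunit
  have hker : (algebraMap ℝ (H →L[ℂ] H) r - a) v = 0 := by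
    simp [Algebra.algebraMap_eq_smul_one, hv]
  obtain ⟨b, hb⟩ := hunit.exists_left_inv
  refine hv0 ?_
  simpa [hker] using (DFunLike.congr_fun hb v).symm

variable [CompleteSpace H]

theorem cfc_apply_of_apply_eq_smul {a : H →L[ℂ] H} (ha : IsSelfAdjoint a) {f : ℝ → ℝ}
    (hf : ContinuousOn f (spectrum ℝ a)) {r : ℝ} {v : H} (hv : a v = (r : ℂ) • v) :
    cfc f a v = (f r : ℂ) • v := by
  rcases eq_or_ne v 0 with rfl | hv0
  · simp
  let r' : spectrum ℝ a := ⟨r, mem_spectrum_of_apply_eq_smul hv0 hv⟩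
  have hcfcHom : ∀ g : C(spectrum ℝ a, ℝ), cfcHom ha g v = (g r' : ℂ) • v := by
    intro g
    have hid : cfcHom ha (.restrict (spectrum ℝ a) (.id ℝ)) v = (r : ℂ) • v := by
      rw [cfcHom_id ha, hv]
    induction g using ContinuousMap.induction_on_of_compact with
    | const c =>
      rw [show ContinuousMap.const _ c = algebraMap ℝ C(spectrum ℝ a, ℝ) c from rfl,
        AlgHomClass.commutes]
      simp [Algebra.algebraMap_eq_smul_one]
    | id => exact hid
    | star_id => exact hid
    | add g h hg hh => simp [hg, hh, add_smul]
    | mul g h hg hh =>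
      rw [map_mul, mul_apply_eq_comp, hh, map_smul, hg, smul_smul, mul_comm,
        ContinuousMap.mul_apply, Complex.ofReal_mul]
    | frequently g hg =>
      have hclosed : IsClosed {g : C(spectrum ℝ a, ℝ) | cfcHom ha g v = (g r' : ℂ) • v} :=
        isClosed_eq ((cfcHom_continuous ha).clm_apply continuous_const) (by fun_prop)
      exact hclosed.mem_of_frequently_of_tendsto hg Filter.tendsto_id
  rw [cfc_apply f a ha hf, hcfcHom]
  rfl

theorem isResolventSq_resolventSq {D : H →ₗ.[ℂ] H} (hD : IsSelfAdjoint D) :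
    IsResolventSq D (resolventSq D) := by
  rw [resolventSq, dif_pos (exists_isResolventSq hD)]
  exact (exists_isResolventSq hD).choose_spec

theorem isSelfAdjoint_resolventSq {D : H →ₗ.[ℂ] H} (hD : IsSelfAdjoint D) :
    IsSelfAdjoint (resolventSq D) := by
  rw [ContinuousLinearMap.isSelfAdjoint_iff_isSymmetric]
  intro x y
  obtain ⟨hx, hDx, hx_eq⟩ := (isResolventSq_resolventSq hD x _).1 rfl
  obtain ⟨hy, hDy, hy_eq⟩ := (isResolventSq_resolventSq hD y _).1 rfl
  change ⟪resolventSq D x, y⟫_ℂ = ⟪x, resolventSq D y⟫_ℂ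
  have hsymm₁ := inner_symm_of_isSelfAdjoint hD ⟨_, hDx⟩ ⟨_, hy⟩
  have hsymm₂ := inner_symm_of_isSelfAdjoint hD ⟨_, hx⟩ ⟨_, hDy⟩
  conv_lhs => rw [← hy_eq]
  conv_rhs => rw [← hx_eq]
  rw [inner_add_left, inner_add_right, hsymm₁, ← hsymm₂]

theorem IsSqEigenvector.resolventSq_apply {D : H →ₗ.[ℂ] H} (hD : IsSelfAdjoint D) {l : ℝ}
    (hl : 1 + l ≠ 0) {v : H} (h : IsSqEigenvector D l v) :
    resolventSq D v = ((1 + l)⁻¹ : ℝ) • v := by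
  obtain ⟨hv, hDv, hl_eq⟩ := h
  rw [eq_inv_smul_iff₀ hl, ← ContinuousLinearMap.map_smul_of_tower]
  refine (isResolventSq_resolventSq hD _ v).2 ⟨hv, hDv, ?_⟩
  rw [hl_eq, add_smul, one_smul, add_comm, Complex.coe_smul]

theorem heat_apply_of_isSqEigenvector {D : H →ₗ.[ℂ] H} (hD : IsSelfAdjoint D) {t : ℝ}
    (ht : 0 < t) {l : ℝ} (hl : 0 ≤ l) {v : H} (hv : IsSqEigenvector D l v) :
    heat D t v = (Real.exp (-t * l) : ℂ) • v := by
  have hR : resolventSq D v = (((1 + l)⁻¹ : ℝ) : ℂ) • v := by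
    rw [hv.resolventSq_apply hD (by positivity), Complex.coe_smul]
  rw [heat, cfc_apply_of_apply_eq_smul (isSelfAdjoint_resolventSq hD)
    (continuous_heatFun ht).continuousOn hR, heatFun_inv_one_add t hl, Complex.ofReal_exp]

theorem isSelfAdjoint_heat (D : H →ₗ.[ℂ] H) (t : ℝ) : IsSelfAdjoint (heat D t) :=
  cfc_predicate _ _

end Heat

/-! ### Trace norm bounds -/

section TraceNorm

theorem abs_sqrt_sub_div_sqrt_add_sq_le {x ε : ℝ} (hx : 0 ≤ x) (hε : 0 < ε) :
    |√x - (√(x + ε ^ 2))⁻¹ * x| ≤ ε := by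
  set r := √(x + ε ^ 2)
  have hr : 0 < r := Real.sqrt_pos.2 (by positivity)
  have hr_sq : r ^ 2 = x + ε ^ 2 := Real.sq_sqrt (by positivity)
  have hsqrt_sq : √x ^ 2 = x := Real.sq_sqrt hx
  have hsqrt := Real.sqrt_nonneg x
  have hle : √x ≤ r := Real.sqrt_le_sqrt (by nlinarith)
  have hεr : ε ≤ r := Real.le_sqrt_of_sq_le (by linarith)
  have hfactor : √x - r⁻¹ * x = √x * (r - √x) / r := by
    field_simp
    linear_combination hsqrt_sq
  rw [hfactor, abs_of_nonneg (div_nonneg (mul_nonneg hsqrt (by linarith)) hr.le), div_le_iff₀ hr]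
  nlinarith

variable {H : Type*} [NormedAddCommGroup H] [InnerProductSpace ℂ H]

/-- `|Tr (K T)| ≤ B` for all contractions `K`, which amounts to `‖T‖₁ ≤ B`. So that no trace has to
exist beforehand, the bound is imposed on the partial sums of the trace in orthonormal bases. -/
def HasTraceBound (T : H →L[ℂ] H) (B : ℝ) : Prop :=
  ∀ K : H →L[ℂ] H, ‖K‖ ≤ 1 → ∀ (w : Set H) (e : HilbertBasis w ℂ H) (s : Finset w),
    ‖∑ i ∈ s, ⟪e i, K (T (e i))⟫_ℂ‖ ≤ B

theorem HasTraceBound.sum {ι : Type*} (s : Finset ι) {T : ι → H →L[ℂ] H} {B : ι → ℝ}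
    (h : ∀ i ∈ s, HasTraceBound (T i) (B i)) : HasTraceBound (∑ i ∈ s, T i) (∑ i ∈ s, B i) := by
  intro K hK w e u
  simp only [_root_.sum_apply, map_sum, inner_sum]
  rw [Finset.sum_comm]
  exact norm_sum_le_of_le s fun j hj => h j hj K hK w e u

theorem HasTraceBound.smul {T : H →L[ℂ] H} {B : ℝ} (h : HasTraceBound T B) {c : ℂ} (hc : ‖c‖ ≤ 1) :
    HasTraceBound (c • T) B := by
  intro K hK w e s
  have hcK : ‖c • K‖ ≤ 1 := by
    rw [norm_smul]
    exact mul_le_one₀ hc (norm_nonneg K) hK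
  simpa only [_root_.smul_apply, map_smul] using h (c • K) hcK w e s

/-- The matrix element `⟨y, K A x⟩` of an operator `A`, as a functional of `A`. -/
def matrixElement (K : H →L[ℂ] H) (x y : H) : (H →L[ℂ] H) →L[ℂ] ℂ :=
  innerSL ℂ y ∘L K ∘L ContinuousLinearMap.apply ℂ H x

theorem matrixElement_rankOne (K : H →L[ℂ] H) (x y a b : H) :
    matrixElement K x y (InnerProductSpace.rankOne ℂ a b) = ⟪b, x⟫_ℂ * ⟪y, K a⟫_ℂ := by
  simp [matrixElement]

variable [CompleteSpace H]

/-- The regularization `(T* T + ε²)^{-1/2} T*` of the adjoint of the partial isometry in the polar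
decomposition of `T`. -/
def approxPolar (T : H →L[ℂ] H) (ε : ℝ) : H →L[ℂ] H :=
  cfc (fun x => (√(x + ε ^ 2))⁻¹) (star T * T) * star T

theorem continuousOn_inv_sqrt_add_sq_spectrum (T : H →L[ℂ] H) {ε : ℝ} (hε : 0 < ε) :
    ContinuousOn (fun x => (√(x + ε ^ 2))⁻¹) (spectrum ℝ (star T * T)) := by
  refine ContinuousOn.inv₀ (by fun_prop) fun x hx => (Real.sqrt_pos.2 ?_).ne'
  have := spectrum_nonneg_of_nonneg (star_mul_self_nonneg T) hx
  positivity

theorem norm_approxPolar_le_one (T : H →L[ℂ] H) {ε : ℝ} (hε : 0 < ε) :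
    ‖approxPolar T ε‖ ≤ 1 := by
  set a := star T * T with ha
  let g : ℝ → ℝ := fun x => (√(x + ε ^ 2))⁻¹
  have hg : ContinuousOn g (spectrum ℝ a) := continuousOn_inv_sqrt_add_sq_spectrum T hε
  have hsq : approxPolar T ε * star (approxPolar T ε) = cfc (fun x => g x * x * g x) a := by
    rw [approxPolar, star_mul, star_star, (cfc_predicate g a : IsSelfAdjoint _).star_eq,
      cfc_mul (fun x => g x * x) g a (hg.mul continuousOn_id) hg,
      cfc_mul g (fun x => x) a hg continuousOn_id, cfc_id' ℝ a]
    simp only [g, mul_assoc, ha]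
  have hnorm : ‖approxPolar T ε * star (approxPolar T ε)‖ ≤ 1 := by
    rw [hsq]
    refine norm_cfc_le zero_le_one fun x hx => ?_
    have hx0 : 0 ≤ x := spectrum_nonneg_of_nonneg (star_mul_self_nonneg T) hx
    have hgxg : g x * x * g x = x / (x + ε ^ 2) := by
      rw [mul_right_comm, ← mul_inv, Real.mul_self_sqrt (by positivity), div_eq_inv_mul]
    rw [hgxg, Real.norm_of_nonneg (by positivity)]
    exact div_le_one_of_le₀ (by nlinarith) (by positivity)
  rw [CStarRing.norm_self_mul_star] at hnorm
  nlinarith [norm_nonneg (approxPolar T ε)]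

theorem norm_abs_sub_approxPolar_mul_le (T : H →L[ℂ] H) {ε : ℝ} (hε : 0 < ε) :
    ‖CFC.abs T - approxPolar T ε * T‖ ≤ ε := by
  have hg := continuousOn_inv_sqrt_add_sq_spectrum T hε
  rw [approxPolar, mul_assoc, CFC.abs, CFC.sqrt_eq_real_sqrt _ (star_mul_self_nonneg T),
    cfcₙ_eq_cfc]
  have hmul : cfc (fun x => (√(x + ε ^ 2))⁻¹) (star T * T) * (star T * T) =
      cfc (fun x => (√(x + ε ^ 2))⁻¹ * x) (star T * T) := by
    rw [cfc_mul _ _ _ hg (continuousOn_id' _), cfc_id' ℝ (star T * T)]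
  rw [hmul, ← cfc_sub Real.sqrt (fun x => (√(x + ε ^ 2))⁻¹ * x) _ (by fun_prop)
    (hg.mul (continuousOn_id' _))]
  exact norm_cfc_le hε.le fun x hx => abs_sqrt_sub_div_sqrt_add_sq_le
    (spectrum_nonneg_of_nonneg (star_mul_self_nonneg T) hx) hε

theorem HasTraceBound.sum_re_inner_abs_le {T : H →L[ℂ] H} {B : ℝ} (h : HasTraceBound T B)
    {w : Set H} (e : HilbertBasis w ℂ H) (s : Finset w) :
    ∑ i ∈ s, RCLike.re ⟪e i, CFC.abs T (e i)⟫_ℂ ≤ B := by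
  have happrox : ∀ ε : ℝ, 0 < ε →
      ∑ i ∈ s, RCLike.re ⟪e i, CFC.abs T (e i)⟫_ℂ ≤ B + s.card * ε := by
    intro ε hε
    set K := approxPolar T ε
    have hterm : ∀ i, RCLike.re ⟪e i, (CFC.abs T - K * T) (e i)⟫_ℂ ≤ ε := fun i =>
      calc RCLike.re ⟪e i, (CFC.abs T - K * T) (e i)⟫_ℂ
          ≤ ‖e i‖ * ‖(CFC.abs T - K * T) (e i)‖ := re_inner_le_norm _ _
        _ ≤ ‖e i‖ * (‖CFC.abs T - K * T‖ * ‖e i‖) := by gcongr; apply ContinuousLinearMap.le_opNorm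
        _ ≤ ε := by
          rw [e.orthonormal.1 i, one_mul, mul_one]
          exact norm_abs_sub_approxPolar_mul_le T hε
    calc ∑ i ∈ s, RCLike.re ⟪e i, CFC.abs T (e i)⟫_ℂ
        = RCLike.re (∑ i ∈ s, ⟪e i, K (T (e i))⟫_ℂ) +
            ∑ i ∈ s, RCLike.re ⟪e i, (CFC.abs T - K * T) (e i)⟫_ℂ := by
          rw [map_sum, ← Finset.sum_add_distrib]
          simp
      _ ≤ B + s.card * ε := by
          refine add_le_add ((RCLike.re_le_norm _).trans
            (h K (norm_approxPolar_le_one T hε) w e s)) ?_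
          rw [← nsmul_eq_mul]
          exact Finset.sum_le_card_nsmul _ _ _ fun i _ => hterm i
  have hlim : Filter.Tendsto (fun ε : ℝ => B + s.card * ε) (nhdsWithin 0 (Set.Ioi 0)) (nhds B) := by
    refine Filter.Tendsto.mono_left ?_ nhdsWithin_le_nhds
    exact Continuous.tendsto' (by fun_prop) _ _ (by simp)
  exact ge_of_tendsto hlim (eventually_mem_nhdsWithin.mono happrox)

theorem HasTraceBound.traceNorm_le {T : H →L[ℂ] H} {B : ℝ} (h : HasTraceBound T B) :
    traceNorm T ≤ ENNReal.ofReal B := by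
  refine iSup₂_le fun w e => ?_
  rw [ENNReal.tsum_eq_iSup_sum]
  refine iSup_le fun s => ?_
  rw [← ENNReal.ofReal_sum_of_nonneg fun i _ => ?_]
  · exact ENNReal.ofReal_le_ofReal (h.sum_re_inner_abs_le e s)
  · exact ((ContinuousLinearMap.nonneg_iff_isPositive _).1
      (CFC.abs_nonneg T)).re_inner_nonneg_right _

theorem norm_sum_inner_mul_inner_le {𝕜 E ι : Type*} [RCLike 𝕜] [NormedAddCommGroup E]
    [InnerProductSpace 𝕜 E] {e : ι → E} (he : Orthonormal 𝕜 e) (s : Finset ι) (x y : E) :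
    ‖∑ i ∈ s, ⟪y, e i⟫_𝕜 * ⟪e i, x⟫_𝕜‖ ≤ ‖y‖ * ‖x‖ := by
  refine (norm_sum_le _ _).trans (le_of_sq_le_sq ?_ (by positivity))
  calc (∑ i ∈ s, ‖⟪y, e i⟫_𝕜 * ⟪e i, x⟫_𝕜‖) ^ 2
      = (∑ i ∈ s, ‖⟪e i, y⟫_𝕜‖ * ‖⟪e i, x⟫_𝕜‖) ^ 2 := by
        simp only [norm_mul, norm_inner_symm y]
    _ ≤ (∑ i ∈ s, ‖⟪e i, y⟫_𝕜‖ ^ 2) * ∑ i ∈ s, ‖⟪e i, x⟫_𝕜‖ ^ 2 :=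
        Finset.sum_mul_sq_le_sq_mul_sq _ _ _
    _ ≤ ‖y‖ ^ 2 * ‖x‖ ^ 2 := by
        gcongr <;> exact he.sum_inner_products_le _
    _ = (‖y‖ * ‖x‖) ^ 2 := by ring

section RankOne

variable {Z : Type*} [MeasurableSpace Z] {μ : Measure Z} {u v : Z → H}

theorem inner_integral_rankOne
    (hint : Integrable (fun z => InnerProductSpace.rankOne ℂ (u z) (v z)) μ)
    (K : H →L[ℂ] H) (x y : H) :
    ⟪y, K ((∫ z, InnerProductSpace.rankOne ℂ (u z) (v z) ∂μ) x)⟫_ℂ =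
      ∫ z, ⟪v z, x⟫_ℂ * ⟪y, K (u z)⟫_ℂ ∂μ := by
  simp only [← matrixElement_rankOne]
  exact ((matrixElement K x y).integral_comp_comm hint).symm

theorem integrable_inner_rankOne
    (hint : Integrable (fun z => InnerProductSpace.rankOne ℂ (u z) (v z)) μ)
    (K : H →L[ℂ] H) (x y : H) : Integrable (fun z => ⟪v z, x⟫_ℂ * ⟪y, K (u z)⟫_ℂ) μ := by
  simp only [← matrixElement_rankOne]
  exact (matrixElement K x y).integrable_comp hint

theorem hasTraceBound_comp_integral_rankOne
    (hint : Integrable (fun z => InnerProductSpace.rankOne ℂ (u z) (v z)) μ) (T : H →L[ℂ] H)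
    {g : Z → ℝ} (hg : Integrable g μ) (hgT : ∀ z, ‖v z‖ * ‖T (u z)‖ ≤ g z) :
    HasTraceBound (T ∘L ∫ z, InnerProductSpace.rankOne ℂ (u z) (v z) ∂μ) (∫ z, g z ∂μ) := by
  intro K hK w e s
  have hsum : ∑ i ∈ s, ⟪e i, K (T ((∫ z, InnerProductSpace.rankOne ℂ (u z) (v z) ∂μ) (e i)))⟫_ℂ =
      ∫ z, ∑ i ∈ s, ⟪v z, e i⟫_ℂ * ⟪e i, K (T (u z))⟫_ℂ ∂μ := by
    refine Eq.trans ?_ (integral_finsetSum _ fun i _ =>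
      integrable_inner_rankOne hint (K ∘L T) (e i) (e i)).symm
    exact Finset.sum_congr rfl fun i _ => inner_integral_rankOne hint (K ∘L T) (e i) (e i)
  simp only [ContinuousLinearMap.comp_apply, hsum]
  refine norm_integral_le_of_norm_le hg (Filter.Eventually.of_forall fun z => ?_)
  calc ‖∑ i ∈ s, ⟪v z, e i⟫_ℂ * ⟪e i, K (T (u z))⟫_ℂ‖
      ≤ ‖v z‖ * ‖K (T (u z))‖ := norm_sum_inner_mul_inner_le e.orthonormal s _ _
    _ ≤ ‖v z‖ * ‖T (u z)‖ := by
        gcongr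
        exact (K.le_opNorm _).trans (mul_le_of_le_one_left (norm_nonneg _) hK)
    _ ≤ g z := hgT z

end RankOne

end TraceNorm

/-! ### The canonical anticommutation relations -/

section Anticommutation

variable {d : ℕ}

/-- The sign `(-1)^#{ν ∈ S | ν < μ}` picked up when `e_μ` is moved to its place in the wedge product
labelled by `S` (the Jordan–Wigner string). -/
def jwSign (μ : Fin d) (S : Finset (Fin d)) : ℂ := (-1) ^ (S.filter (· < μ)).card

theorem jwSign_mul_self (μ : Fin d) (S : Finset (Fin d)) : jwSign μ S * jwSign μ S = 1 := by
  rw [jwSign, ← mul_pow]; simp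

theorem jwSign_insert_of_le {μ ν : Fin d} (S : Finset (Fin d)) (h : μ ≤ ν) :
    jwSign μ (insert ν S) = jwSign μ S := by
  rw [jwSign, Finset.filter_insert, if_neg (not_lt.2 h), jwSign]

theorem jwSign_insert_of_lt {μ ν : Fin d} {S : Finset (Fin d)} (h : ν < μ) (hν : ν ∉ S) :
    jwSign μ (insert ν S) = -jwSign μ S := by
  rw [jwSign, Finset.filter_insert, if_pos h, Finset.card_insert_of_notMem (by simp [hν]), pow_succ,
    jwSign, mul_neg_one]

theorem jwSign_erase_of_le {μ ν : Fin d} (S : Finset (Fin d)) (h : μ ≤ ν) :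
    jwSign μ (S.erase ν) = jwSign μ S := by
  by_cases hν : ν ∈ S
  · conv_rhs => rw [← Finset.insert_erase hν, jwSign_insert_of_le _ h]
  · rw [Finset.erase_eq_of_notMem hν]

theorem jwSign_erase_of_lt {μ ν : Fin d} {S : Finset (Fin d)} (h : ν < μ) (hν : ν ∈ S) :
    jwSign μ (S.erase ν) = -jwSign μ S := by
  conv_rhs => rw [← Finset.insert_erase hν, jwSign_insert_of_lt h (Finset.notMem_erase _ _)]
  rw [neg_neg]

theorem bStar_apply (μ : Fin d) (x : Fock d) (S : Finset (Fin d)) :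
    bStar μ x S = if μ ∈ S then jwSign μ S * x (S.erase μ) else 0 := by
  rw [bStar, Matrix.ofLp_toEuclideanCLM, Matrix.mulVec, dotProduct]
  simp only [Matrix.of_apply]
  split_ifs with h
  · rw [Finset.sum_eq_single (S.erase μ)]
    · rw [if_pos ⟨Finset.notMem_erase _ _, (Finset.insert_erase h).symm⟩, ← jwSign,
        jwSign_erase_of_le _ le_rfl]
    · intro T _ hT
      rw [if_neg, zero_mul]
      rintro ⟨hμT, rfl⟩
      exact hT (Finset.erase_insert hμT).symm
    · simp
  · refine Finset.sum_eq_zero fun T _ => ?_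
    rw [if_neg, zero_mul]
    rintro ⟨-, rfl⟩
    exact h (Finset.mem_insert_self _ _)

theorem bAnn_apply (μ : Fin d) (x : Fock d) (S : Finset (Fin d)) :
    bAnn μ x S = if μ ∈ S then 0 else jwSign μ S * x (insert μ S) := by
  rw [bAnn, ← ContinuousLinearMap.star_eq_adjoint, bStar, ← map_star, Matrix.ofLp_toEuclideanCLM,
    Matrix.mulVec, dotProduct]
  simp only [Matrix.star_apply, Matrix.of_apply]
  split_ifs with h
  · refine Finset.sum_eq_zero fun T _ => ?_
    rw [if_neg fun h' => h'.1 h, star_zero, zero_mul]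
  · rw [Finset.sum_eq_single (insert μ S)]
    · rw [if_pos ⟨h, rfl⟩, star_pow, star_neg, star_one, ← jwSign]
    · intro T _ hT
      rw [if_neg fun h' => hT h'.2, star_zero, zero_mul]
    · simp

theorem bStar_bStar_of_lt {μ ν : Fin d} (h : μ < ν) (x : Fock d) :
    bStar μ (bStar ν x) + bStar ν (bStar μ x) = 0 := by
  ext S
  simp only [PiLp.add_apply, bStar_apply, PiLp.zero_apply, Finset.mem_erase]
  by_cases hμ : μ ∈ S <;> by_cases hν : ν ∈ S <;>
    simp only [hμ, hν, h.ne, h.ne', ne_eq, not_false_eq_true, and_true, and_false, if_true,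
      if_false, mul_zero, add_zero]
  rw [jwSign_erase_of_lt h hμ, jwSign_erase_of_le _ h.le, Finset.erase_right_comm]
  ring

theorem bStar_bStar (μ ν : Fin d) (x : Fock d) :
    bStar μ (bStar ν x) + bStar ν (bStar μ x) = 0 := by
  rcases lt_trichotomy μ ν with h | rfl | h
  · exact bStar_bStar_of_lt h x
  · ext S
    simp [bStar_apply]
  · rw [add_comm]; exact bStar_bStar_of_lt h x

theorem bAnn_bAnn (μ ν : Fin d) (x : Fock d) :
    bAnn μ (bAnn ν x) + bAnn ν (bAnn μ x) = 0 := by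
  refine ext_inner_left ℂ fun y => ?_
  rw [inner_add_right, bAnn, bAnn, ContinuousLinearMap.adjoint_inner_right,
    ContinuousLinearMap.adjoint_inner_right, ContinuousLinearMap.adjoint_inner_right,
    ContinuousLinearMap.adjoint_inner_right, ← inner_add_left, bStar_bStar, inner_zero_left,
    inner_zero_right]

theorem bStar_bAnn_of_ne {μ ν : Fin d} (h : μ ≠ ν) (x : Fock d) :
    bStar μ (bAnn ν x) + bAnn ν (bStar μ x) = 0 := by
  ext S
  simp only [PiLp.add_apply, bStar_apply, bAnn_apply, PiLp.zero_apply, Finset.mem_erase,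
    Finset.mem_insert]
  by_cases hμ : μ ∈ S <;> by_cases hν : ν ∈ S <;>
    simp only [hμ, hν, h, h.symm, ne_eq, not_false_eq_true, and_true, and_false, if_true, if_false,
      mul_zero, add_zero, or_true, or_false]
  rw [Finset.erase_insert_of_ne h.symm]
  rcases lt_or_gt_of_ne h with h' | h'
  · rw [jwSign_erase_of_lt h' hμ, jwSign_insert_of_le _ h'.le]
    ring
  · rw [jwSign_erase_of_le _ h'.le, jwSign_insert_of_lt h' hν]
    ring

theorem bStar_bAnn_self (μ : Fin d) (x : Fock d) (S : Finset (Fin d)) :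
    bStar μ (bAnn μ x) S = if μ ∈ S then x S else 0 := by
  rw [bStar_apply]
  split_ifs with h
  · rw [bAnn_apply, if_neg (Finset.notMem_erase _ _), jwSign_erase_of_le _ le_rfl, ← mul_assoc,
      jwSign_mul_self, Finset.insert_erase h, one_mul]
  · rfl

theorem bAnn_bStar_self (μ : Fin d) (x : Fock d) (S : Finset (Fin d)) :
    bAnn μ (bStar μ x) S = if μ ∈ S then 0 else x S := by
  rw [bAnn_apply]
  split_ifs with h
  · rfl
  · rw [bStar_apply, if_pos (Finset.mem_insert_self _ _), jwSign_insert_of_le _ le_rfl, ← mul_assoc,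
      jwSign_mul_self, Finset.erase_insert h, one_mul]

theorem bStar_bAnn (μ ν : Fin d) (x : Fock d) :
    bStar μ (bAnn ν x) + bAnn ν (bStar μ x) = if μ = ν then x else 0 := by
  split_ifs with h
  · subst h
    ext S
    rw [PiLp.add_apply, bStar_bAnn_self, bAnn_bStar_self]
    split_ifs <;> simp
  · exact bStar_bAnn_of_ne h x

end Anticommutation

/-! ### Squares of supercharges -/

theorem sum_sum_eq_zero_of_eq_neg {ι M : Type*} [AddCommGroup M] [IsAddTorsionFree M]
    (s : Finset ι) {F : ι → ι → M} (h : ∀ i j, F i j = -F j i) :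
    ∑ i ∈ s, ∑ j ∈ s, F i j = 0 := by
  refine self_eq_neg.1 ?_
  conv_lhs => rw [Finset.sum_comm]
  simp only [← Finset.sum_neg_distrib]
  exact Finset.sum_congr rfl fun i _ => Finset.sum_congr rfl fun j _ => h j i

section Supercharge

variable {𝕜 ι R : Type*} [CommRing 𝕜] [Ring R] [Algebra 𝕜 R]

theorem sum_sum_mul_mul_mul_eq_zero [IsAddTorsionFree R] (s : Finset ι) {a x : ι → R}
    (hax : ∀ i j, Commute (a i) (x j)) (haa : ∀ i j, Commute (a i) (a j))
    (hxx : ∀ i j, x i * x j + x j * x i = 0) :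
    ∑ i ∈ s, ∑ j ∈ s, (a i * x i) * (a j * x j) = 0 := by
  refine sum_sum_eq_zero_of_eq_neg s fun i j => ?_
  rw [(hax j i).symm.mul_mul_mul_comm, (hax i j).symm.mul_mul_mul_comm,
    eq_neg_of_add_eq_zero_left (hxx i j), (haa i j).eq, mul_neg]

theorem supercharge_mul_self [Fintype ι] [DecidableEq ι] [IsAddTorsionFree R]
    {a s x y : ι → R} {c c' w : 𝕜} (hc : c * c' = 1)
    (hax : ∀ i j, Commute (a i) (x j)) (hay : ∀ i j, Commute (a i) (y j))
    (hsx : ∀ i j, Commute (s i) (x j)) (hsy : ∀ i j, Commute (s i) (y j))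
    (haa : ∀ i j, Commute (a i) (a j)) (hss : ∀ i j, Commute (s i) (s j))
    (has : ∀ i j, ⁅a i, s j⁆ = if i = j then algebraMap 𝕜 R w else 0)
    (hxx : ∀ i j, x i * x j + x j * x i = 0) (hyy : ∀ i j, y i * y j + y j * y i = 0)
    (hxy : ∀ i j, x i * y j + y j * x i = if i = j then 1 else 0) :
    (∑ i, (c • (a i * x i) + c' • (s i * y i))) * ∑ i, (c • (a i * x i) + c' • (s i * y i)) =
      ∑ i, s i * a i + w • ∑ i, x i * y i := by
  have hcross : ∀ i j, (a i * x i) * (s j * y j) + (s j * y j) * (a i * x i) =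
      if i = j then s i * a i + w • (x i * y i) else 0 := by
    intro i j
    have hsa : a i * s j = s j * a i + if i = j then algebraMap 𝕜 R w else 0 := by
      rw [← has, Ring.lie_def]
      abel
    rw [(hsx j i).symm.mul_mul_mul_comm, (hay i j).symm.mul_mul_mul_comm, hsa, add_mul,
      add_right_comm, ← mul_add, hxy]
    split_ifs with h
    · subst h
      rw [mul_one, Algebra.smul_def]
    · rw [mul_zero, zero_mul, zero_add]
  have hexpand :
      (∑ i, (c • (a i * x i) + c' • (s i * y i))) * ∑ i, (c • (a i * x i) + c' • (s i * y i)) =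
        (c * c) • ∑ i, ∑ j, (a i * x i) * (a j * x j) +
        (c' * c') • ∑ i, ∑ j, (s i * y i) * (s j * y j) +
        ∑ i, ∑ j, ((a i * x i) * (s j * y j) + (s j * y j) * (a i * x i)) := by
    simp only [Finset.sum_add_distrib, add_mul, mul_add, ← Finset.smul_sum, smul_mul_smul_comm, hc,
      mul_comm c' c, one_smul, Finset.sum_mul_sum]
    rw [Finset.sum_comm (f := fun i j => s j * y j * (a i * x i))]
    abel
  rw [hexpand, sum_sum_mul_mul_mul_eq_zero _ hax haa hxx, sum_sum_mul_mul_mul_eq_zero _ hsy hss hyy,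
    smul_zero, smul_zero, zero_add, zero_add]
  simp only [hcross, Finset.sum_ite_eq, Finset.mem_univ, if_true, Finset.sum_add_distrib,
    ← Finset.smul_sum]

end Supercharge

/-! ### Ladder operators on Schwartz functions -/

section Schwartz

variable {E F G : Type*} [NormedAddCommGroup E] [NormedSpace ℝ E]
  [NormedAddCommGroup F] [NormedSpace ℝ F] [NormedAddCommGroup G] [NormedSpace ℝ G]

theorem lineDerivOp_lineDerivOp_apply (v w : E) (f : 𝓢(E, F)) (x : E) :
    (∂_{v} (∂_{w} f)) x = fderiv ℝ (fderiv ℝ f) x v w := by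
  have hf' : HasFDerivAt (fderiv ℝ f) (fderiv ℝ (fderiv ℝ f) x) x :=
    (fderivCLM ℝ E F f).hasFDerivAt x
  change fderiv ℝ (fun y => fderiv ℝ f y w) x v = _
  rw [(hf'.clm_apply (hasFDerivAt_const w x)).fderiv]
  simp

theorem lineDerivOp_comm (v w : E) (f : 𝓢(E, F)) : ∂_{v} (∂_{w} f) = ∂_{w} (∂_{v} f) := by
  ext x
  rw [lineDerivOp_lineDerivOp_apply, lineDerivOp_lineDerivOp_apply]
  exact second_derivative_symmetric (f' := fderiv ℝ f) (fun y => f.hasFDerivAt y)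
    ((fderivCLM ℝ E F f).hasFDerivAt x) v w

theorem lineDerivOp_postcompCLM {𝕜 : Type*} [RCLike 𝕜] [NormedSpace 𝕜 F] [NormedSpace 𝕜 G]
    (b : F →L[𝕜] G) (v : E) (f : 𝓢(E, F)) :
    ∂_{v} (postcompCLM b f) = postcompCLM b (∂_{v} f) := by
  ext x
  have hb : HasFDerivAt (fun y => b (f y)) ((b.restrictScalars ℝ).comp (fderiv ℝ f x)) x :=
    ((b.restrictScalars ℝ).hasFDerivAt (x := f x)).comp x (f.hasFDerivAt x)
  change fderiv ℝ (fun y => b (f y)) x v = b (fderiv ℝ f x v)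
  rw [hb.fderiv]
  rfl

end Schwartz

section Ladder

attribute [local instance] LieRing.ofAssociativeRing

variable {d : ℕ}

theorem aAnn_apply (Ω : ℝ) (μ : Fin d) (ψ : 𝓢(Space d, Fock d)) (x : Space d) :
    aAnn Ω μ ψ x = fderiv ℝ ψ x (EuclideanSpace.single μ 1) + ((Ω * x μ : ℝ) : ℂ) • ψ x := by
  rw [← mulCoord_apply]
  rfl

theorem onFock_apply (b : Fock d →L[ℂ] Fock d) (ψ : 𝓢(Space d, Fock d)) (x : Space d) :
    onFock b ψ x = b (ψ x) := rfl

/-- The operator `∂_μ` on `𝓢(ℝ^d) ⊗ Λ(ℂ^d)`, so that `a_μ` and `a_μ*` are `±∂_μ + Ω x_μ` in the ring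
of continuous operators on this space. -/
def partialDeriv (μ : Fin d) : 𝓢(Space d, Fock d) →L[ℂ] 𝓢(Space d, Fock d) :=
  LineDeriv.lineDerivOpCLM ℂ 𝓢(Space d, Fock d) (EuclideanSpace.single μ (1 : ℝ))

theorem aAnn_eq (Ω : ℝ) (μ : Fin d) : aAnn Ω μ = partialDeriv μ + mulCoord Ω μ := rfl

theorem aStar_eq (Ω : ℝ) (μ : Fin d) : aStar Ω μ = -partialDeriv μ + mulCoord Ω μ := rfl

theorem commute_partialDeriv_onFock (μ : Fin d) (b : Fock d →L[ℂ] Fock d) :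
    Commute (partialDeriv μ) (onFock b) := by
  ext ψ : 1
  exact lineDerivOp_postcompCLM b _ ψ

theorem commute_mulCoord_onFock (Ω : ℝ) (μ : Fin d) (b : Fock d →L[ℂ] Fock d) :
    Commute (mulCoord Ω μ) (onFock b) := by
  ext ψ x : 2
  change mulCoord Ω μ (onFock b ψ) x = onFock b (mulCoord Ω μ ψ) x
  rw [onFock_apply, mulCoord_apply, mulCoord_apply, onFock_apply, map_smul]

theorem commute_aAnn_onFock (Ω : ℝ) (μ : Fin d) (b : Fock d →L[ℂ] Fock d) :
    Commute (aAnn Ω μ) (onFock b) :=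
  (commute_partialDeriv_onFock μ b).add_left (commute_mulCoord_onFock Ω μ b)

theorem commute_aStar_onFock (Ω : ℝ) (μ : Fin d) (b : Fock d →L[ℂ] Fock d) :
    Commute (aStar Ω μ) (onFock b) :=
  (commute_partialDeriv_onFock μ b).neg_left.add_left (commute_mulCoord_onFock Ω μ b)

theorem commute_partialDeriv (μ ν : Fin d) : Commute (partialDeriv μ) (partialDeriv ν) := by
  ext ψ : 1
  exact lineDerivOp_comm _ _ ψ

theorem commute_mulCoord (Ω : ℝ) (μ ν : Fin d) :
    Commute (mulCoord (d := d) Ω μ) (mulCoord Ω ν) := by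
  ext ψ x : 2
  change mulCoord Ω μ (mulCoord Ω ν ψ) x = mulCoord Ω ν (mulCoord Ω μ ψ) x
  simp only [mulCoord_apply]
  rw [smul_comm]

theorem hasFDerivAt_mulCoord (Ω : ℝ) (ν : Fin d) (ψ : 𝓢(Space d, Fock d)) (x : Space d) :
    HasFDerivAt (mulCoord Ω ν ψ) (((Ω * x ν : ℝ) : ℂ) • fderiv ℝ ψ x +
      (Complex.ofRealCLM ∘L (Ω • EuclideanSpace.proj (𝕜 := ℝ) ν : Space d →L[ℝ] ℝ)).smulRight
        (ψ x)) x := by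
  rw [show (mulCoord Ω ν ψ : Space d → Fock d) = fun y => ((Ω * y ν : ℝ) : ℂ) • ψ y from
    funext (mulCoord_apply Ω ν ψ)]
  exact (Complex.ofRealCLM ∘L (Ω • EuclideanSpace.proj (𝕜 := ℝ) ν :
    Space d →L[ℝ] ℝ)).hasFDerivAt.smul (ψ.hasFDerivAt x)

theorem lie_partialDeriv_mulCoord (Ω : ℝ) (μ ν : Fin d) :
    ⁅partialDeriv (d := d) μ, mulCoord Ω ν⁆ = if μ = ν then algebraMap ℂ _ (Ω : ℂ) else 0 := by
  rw [Ring.lie_def, sub_eq_iff_eq_add']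
  ext ψ x : 2
  change fderiv ℝ (mulCoord Ω ν ψ) x (EuclideanSpace.single μ 1) =
    mulCoord Ω ν (partialDeriv μ ψ) x + (if μ = ν then algebraMap ℂ _ (Ω : ℂ) else 0 :
      𝓢(Space d, Fock d) →L[ℂ] 𝓢(Space d, Fock d)) ψ x
  rw [(hasFDerivAt_mulCoord Ω ν ψ x).fderiv, mulCoord_apply]
  split_ifs with h
  · subst h
    simp [Algebra.algebraMap_eq_smul_one, partialDeriv, lineDerivOp_apply_eq_fderiv]
  · simp [Ne.symm h, partialDeriv, lineDerivOp_apply_eq_fderiv]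

theorem lie_mulCoord_partialDeriv (Ω : ℝ) (μ ν : Fin d) :
    ⁅mulCoord (d := d) Ω μ, partialDeriv ν⁆ = -if μ = ν then algebraMap ℂ _ (Ω : ℂ) else 0 := by
  rw [← lie_skew, lie_partialDeriv_mulCoord]
  simp only [eq_comm]

theorem commute_aAnn (Ω : ℝ) (μ ν : Fin d) : Commute (aAnn (d := d) Ω μ) (aAnn Ω ν) := by
  rw [commute_iff_lie_eq, aAnn_eq, aAnn_eq, add_lie, lie_add, lie_add, lie_partialDeriv_mulCoord,
    lie_mulCoord_partialDeriv, (commute_partialDeriv μ ν).lie_eq, (commute_mulCoord Ω μ ν).lie_eq]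
  abel

theorem commute_aStar (Ω : ℝ) (μ ν : Fin d) : Commute (aStar (d := d) Ω μ) (aStar Ω ν) := by
  rw [commute_iff_lie_eq, aStar_eq, aStar_eq, add_lie, lie_add, lie_add, neg_lie, neg_lie, lie_neg,
    lie_neg, lie_partialDeriv_mulCoord, lie_mulCoord_partialDeriv,
    (commute_partialDeriv μ ν).lie_eq, (commute_mulCoord Ω μ ν).lie_eq]
  abel

theorem lie_aAnn_aStar (Ω : ℝ) (μ ν : Fin d) :
    ⁅aAnn (d := d) Ω μ, aStar Ω ν⁆ = if μ = ν then algebraMap ℂ _ (2 * Ω : ℂ) else 0 := by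
  rw [aAnn_eq, aStar_eq, add_lie, lie_add, lie_add, lie_neg, lie_neg, lie_partialDeriv_mulCoord,
    lie_mulCoord_partialDeriv, (commute_partialDeriv μ ν).lie_eq, (commute_mulCoord Ω μ ν).lie_eq]
  split_ifs
  · rw [two_mul, map_add]
    abel
  · abel

end Ladder

/-! ### The squares of the Dirac operators -/

section Dirac

variable {d : ℕ}

/-- The fermionic operator that multiplies `a_μ` in the Dirac operators: `b_μ*` in `D₁` and `b_μ` in
`D₂`. -/
def raising (j : Fin 2) (μ : Fin d) : Fock d →L[ℂ] Fock d := if j = 0 then bStar μ else bAnn μ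

/-- The fermionic operator that multiplies `a_μ*` in the Dirac operators, the adjoint of
`raising j μ`. -/
def lowering (j : Fin 2) (μ : Fin d) : Fock d →L[ℂ] Fock d := if j = 0 then bAnn μ else bStar μ

/-- The coefficient of the supercharge in the Dirac operators: `1` in `D₁` and `i` in `D₂`. -/
def phase (j : Fin 2) : ℂ := if j = 0 then 1 else Complex.I

theorem phase_mul_conj (j : Fin 2) : phase j * (starRingEnd ℂ) (phase j) = 1 := by
  unfold phase
  split_ifs <;> simp

theorem adjoint_raising (j : Fin 2) (μ : Fin d) :
    ContinuousLinearMap.adjoint (raising j μ) = lowering j μ := by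
  unfold raising lowering bAnn
  split_ifs <;> simp

theorem adjoint_lowering (j : Fin 2) (μ : Fin d) :
    ContinuousLinearMap.adjoint (lowering j μ) = raising j μ := by
  rw [← adjoint_raising, ContinuousLinearMap.adjoint_adjoint]

theorem raising_raising (j : Fin 2) (μ ν : Fin d) (x : Fock d) :
    raising j μ (raising j ν x) + raising j ν (raising j μ x) = 0 := by
  unfold raising
  split_ifs
  · exact bStar_bStar μ ν x
  · exact bAnn_bAnn μ ν x

theorem lowering_lowering (j : Fin 2) (μ ν : Fin d) (x : Fock d) :
    lowering j μ (lowering j ν x) + lowering j ν (lowering j μ x) = 0 := by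
  unfold lowering
  split_ifs
  · exact bAnn_bAnn μ ν x
  · exact bStar_bStar μ ν x

theorem raising_lowering (j : Fin 2) (μ ν : Fin d) (x : Fock d) :
    raising j μ (lowering j ν x) + lowering j ν (raising j μ x) = if μ = ν then x else 0 := by
  unfold raising lowering
  rcases eq_or_ne j 0 with hj | hj
  · simp only [hj, if_true, bStar_bAnn]
  · simp only [hj, if_false, add_comm (bAnn μ _), bStar_bAnn, eq_comm]

theorem diracSchwartz_eq (Ω : ℝ) (j : Fin 2) :
    diracSchwartz d Ω j = ∑ μ, (phase j • (aAnn Ω μ * onFock (raising j μ)) +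
      (starRingEnd ℂ) (phase j) • (aStar Ω μ * onFock (lowering j μ))) := by
  fin_cases j
  · simp [diracSchwartz, raising, lowering, phase, charge₁, chargeStar₁, Finset.sum_add_distrib,
      ContinuousLinearMap.mul_def]
  · simp [diracSchwartz, raising, lowering, phase, charge₂, chargeStar₂, Finset.sum_add_distrib,
      ContinuousLinearMap.mul_def, Finset.smul_sum, sub_eq_add_neg]

theorem diracSchwartz_mul_self (Ω : ℝ) (j : Fin 2) :
    diracSchwartz d Ω j * diracSchwartz d Ω j = ∑ μ, aStar Ω μ * aAnn Ω μ +
      (2 * Ω : ℂ) • ∑ μ, onFock (raising j μ) * onFock (lowering j μ) := by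
  have : IsAddTorsionFree (𝓢(Space d, Fock d) →L[ℂ] 𝓢(Space d, Fock d)) := .of_isTorsionFree ℂ _
  rw [diracSchwartz_eq]
  refine supercharge_mul_self (phase_mul_conj j) (fun _ _ => commute_aAnn_onFock _ _ _)
    (fun _ _ => commute_aAnn_onFock _ _ _) (fun _ _ => commute_aStar_onFock _ _ _)
    (fun _ _ => commute_aStar_onFock _ _ _) (commute_aAnn Ω) (commute_aStar Ω)
    (lie_aAnn_aStar Ω) (fun μ ν => ?_) (fun μ ν => ?_) fun μ ν => ?_ <;> ext ψ x : 2
  · exact raising_raising j μ ν (ψ x)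
  · exact lowering_lowering j μ ν (ψ x)
  · refine (raising_lowering j μ ν (ψ x)).trans ?_
    split_ifs <;> rfl

end Dirac

/-! ### Symmetry of the Dirac operators -/

section Symmetry

variable {d : ℕ}

theorem inner_embed (ψ φ : 𝓢(Space d, Fock d)) :
    ⟪embed d ψ, embed d φ⟫_ℂ = ∫ x, ⟪ψ x, φ x⟫_ℂ :=
  inner_toL2_toL2_eq ψ φ volume

theorem inner_embed_partialDeriv (μ : Fin d) (ψ φ : 𝓢(Space d, Fock d)) :
    ⟪embed d (partialDeriv μ ψ), embed d φ⟫_ℂ = -⟪embed d ψ, embed d (partialDeriv μ φ)⟫_ℂ := by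
  rw [inner_embed, inner_embed, eq_neg_iff_add_eq_zero, add_comm, ← eq_neg_iff_add_eq_zero]
  exact integral_bilinear_lineDerivOp_right_eq_neg_left ψ φ
    (isBoundedBilinearMap_inner (𝕜 := ℂ) (E := Fock d)).toContinuousLinearMap
    (EuclideanSpace.single μ 1)

theorem inner_embed_mulCoord (Ω : ℝ) (μ : Fin d) (ψ φ : 𝓢(Space d, Fock d)) :
    ⟪embed d (mulCoord Ω μ ψ), embed d φ⟫_ℂ = ⟪embed d ψ, embed d (mulCoord Ω μ φ)⟫_ℂ := by
  rw [inner_embed, inner_embed]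
  congr 1
  funext x
  rw [mulCoord_apply, mulCoord_apply, inner_smul_left, inner_smul_right, Complex.conj_ofReal]

theorem inner_embed_aAnn (Ω : ℝ) (μ : Fin d) (ψ φ : 𝓢(Space d, Fock d)) :
    ⟪embed d (aAnn Ω μ ψ), embed d φ⟫_ℂ = ⟪embed d ψ, embed d (aStar Ω μ φ)⟫_ℂ := by
  rw [aAnn_eq, aStar_eq]
  simp only [_root_.add_apply, _root_.neg_apply, map_add, map_neg, inner_add_left, inner_add_right,
    inner_neg_right, inner_embed_partialDeriv, inner_embed_mulCoord]

theorem inner_embed_aStar (Ω : ℝ) (μ : Fin d) (ψ φ : 𝓢(Space d, Fock d)) :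
    ⟪embed d (aStar Ω μ ψ), embed d φ⟫_ℂ = ⟪embed d ψ, embed d (aAnn Ω μ φ)⟫_ℂ := by
  rw [← inner_conj_symm, ← inner_embed_aAnn, inner_conj_symm]

theorem inner_embed_onFock (b : Fock d →L[ℂ] Fock d) (ψ φ : 𝓢(Space d, Fock d)) :
    ⟪embed d (onFock b ψ), embed d φ⟫_ℂ =
      ⟪embed d ψ, embed d (onFock (ContinuousLinearMap.adjoint b) φ)⟫_ℂ := by
  rw [inner_embed, inner_embed]
  congr 1
  funext x
  rw [onFock_apply, onFock_apply, ContinuousLinearMap.adjoint_inner_right]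

theorem inner_embed_dirac (Ω : ℝ) (j : Fin 2) (ψ φ : 𝓢(Space d, Fock d)) :
    ⟪embed d (diracSchwartz d Ω j ψ), embed d φ⟫_ℂ =
      ⟪embed d ψ, embed d (diracSchwartz d Ω j φ)⟫_ℂ := by
  have inner_raising (μ : Fin d) : ⟪embed d ((aAnn Ω μ * onFock (raising j μ)) ψ), embed d φ⟫_ℂ =
      ⟪embed d ψ, embed d ((aStar Ω μ * onFock (lowering j μ)) φ)⟫_ℂ := by
    rw [(commute_aStar_onFock Ω μ (lowering j μ)).eq, mul_apply_eq_comp, mul_apply_eq_comp,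
      inner_embed_aAnn, inner_embed_onFock, adjoint_raising]
  have inner_lowering (μ : Fin d) : ⟪embed d ((aStar Ω μ * onFock (lowering j μ)) ψ), embed d φ⟫_ℂ =
      ⟪embed d ψ, embed d ((aAnn Ω μ * onFock (raising j μ)) φ)⟫_ℂ := by
    rw [(commute_aAnn_onFock Ω μ (raising j μ)).eq, mul_apply_eq_comp, mul_apply_eq_comp,
      inner_embed_aStar, inner_embed_onFock, adjoint_lowering]
  simp only [diracSchwartz_eq, _root_.sum_apply, map_sum, sum_inner, inner_sum, _root_.add_apply,
    _root_.smul_apply, map_add, map_smul, inner_add_left, inner_add_right, inner_smul_left,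
    inner_smul_right, Complex.conj_conj, inner_raising, inner_lowering]
  exact Finset.sum_congr rfl fun μ _ => add_comm _ _

end Symmetry

/-! ### Coherent states -/

section GaussianSchwartz

variable {E : Type*} [NormedAddCommGroup E]

theorem one_add_pow_mul_exp_neg_mul_sq_le {c : ℝ} (hc : 0 < c) (n : ℕ) {s : ℝ} (hs : 0 ≤ s) :
    (1 + s) ^ n * Real.exp (-(c * s ^ 2)) ≤ 2 ^ n * (n.factorial / c ^ n) * Real.exp c := by
  have pow_le : (1 + s) ^ n ≤ 2 ^ n * (1 + s ^ 2) ^ n := by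
    rw [← mul_pow]
    gcongr
    nlinarith [sq_nonneg (1 - s)]
  have pow_le_exp : (1 + s ^ 2) ^ n ≤ n.factorial / c ^ n * Real.exp (c * (1 + s ^ 2)) := by
    have := Real.pow_div_factorial_le_exp (x := c * (1 + s ^ 2)) (by positivity) n
    rw [div_le_iff₀ (by positivity), mul_pow] at this
    rw [div_mul_eq_mul_div, le_div_iff₀ (by positivity)]
    linarith
  calc (1 + s) ^ n * Real.exp (-(c * s ^ 2))
      ≤ 2 ^ n * (n.factorial / c ^ n * Real.exp (c * (1 + s ^ 2))) * Real.exp (-(c * s ^ 2)) := by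
        gcongr
        exact pow_le.trans (by gcongr)
    _ = 2 ^ n * (n.factorial / c ^ n) *
          (Real.exp (c * (1 + s ^ 2)) * Real.exp (-(c * s ^ 2))) := by ring
    _ = 2 ^ n * (n.factorial / c ^ n) * Real.exp c := by
        rw [← Real.exp_add]
        ring_nf

theorem exists_norm_iteratedFDeriv_exp_comp_le [NormedSpace ℝ E] {f : E → ℝ}
    (hf : f.HasTemperateGrowth) (n : ℕ) :
    ∃ (k : ℕ) (C : ℝ), 0 ≤ C ∧ ∀ x, ‖iteratedFDeriv ℝ n (fun x => Real.exp (f x)) x‖ ≤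
      C * (1 + ‖x‖) ^ k * Real.exp (f x) := by
  obtain ⟨l, C, hC, hfC⟩ := hf.norm_iteratedFDeriv_le_uniform n
  refine ⟨l * n, n.factorial * (1 + C) ^ n, by positivity, fun x => ?_⟩
  have one_le : 1 ≤ (1 + C) * (1 + ‖x‖) ^ l :=
    one_le_mul_of_one_le_of_one_le (by linarith) (one_le_pow₀ (by linarith [norm_nonneg x]))
  calc ‖iteratedFDeriv ℝ n (fun x => Real.exp (f x)) x‖
      ≤ n.factorial * Real.exp (f x) * ((1 + C) * (1 + ‖x‖) ^ l) ^ n := by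
        refine norm_iteratedFDeriv_comp_le Real.contDiff_exp hf.1 (mod_cast le_top) x
          (fun i _ => ?_) fun i hi hin => ?_
        · rw [norm_iteratedFDeriv_eq_norm_iteratedDeriv, iteratedDeriv_eq_iterate,
            Real.iter_deriv_exp, Real.norm_of_nonneg (Real.exp_nonneg _)]
        · refine (hfC i hin x).trans (le_trans ?_ (le_self_pow₀ one_le (by lia)))
          gcongr
          linarith
    _ = n.factorial * (1 + C) ^ n * (1 + ‖x‖) ^ (l * n) * Real.exp (f x) := by
        rw [mul_pow, ← pow_mul]
        ring

variable [InnerProductSpace ℝ E]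

theorem hasTemperateGrowth_neg_mul_norm_sq (c : ℝ) :
    Function.HasTemperateGrowth fun x : E => -(c * ‖x‖ ^ 2) := by
  have := Function.hasTemperateGrowth_norm_sq (H := E)
  fun_prop

theorem exists_norm_pow_mul_norm_iteratedFDeriv_gaussian_le {c : ℝ} (hc : 0 < c) (k n : ℕ) :
    ∃ C : ℝ, ∀ x : E,
      ‖x‖ ^ k * ‖iteratedFDeriv ℝ n (fun x => Real.exp (-(c * ‖x‖ ^ 2))) x‖ ≤ C := by
  obtain ⟨l, C, hC, hle⟩ :=
    exists_norm_iteratedFDeriv_exp_comp_le (hasTemperateGrowth_neg_mul_norm_sq (E := E) c) n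
  refine ⟨C * (2 ^ (k + l) * ((k + l).factorial / c ^ (k + l)) * Real.exp c), fun x => ?_⟩
  calc ‖x‖ ^ k * ‖iteratedFDeriv ℝ n (fun x => Real.exp (-(c * ‖x‖ ^ 2))) x‖
      ≤ (1 + ‖x‖) ^ k * (C * (1 + ‖x‖) ^ l * Real.exp (-(c * ‖x‖ ^ 2))) := by
        gcongr
        · linarith
        · exact hle x
    _ = C * ((1 + ‖x‖) ^ (k + l) * Real.exp (-(c * ‖x‖ ^ 2))) := by
        rw [pow_add]
        ring
    _ ≤ _ := mul_le_mul_of_nonneg_left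
        (one_add_pow_mul_exp_neg_mul_sq_le hc _ (norm_nonneg x)) hC

/-- The Gaussian `exp (-c ‖x‖²)`, `c > 0`, as a Schwartz function. -/
def gaussian (E : Type*) [NormedAddCommGroup E] [InnerProductSpace ℝ E] {c : ℝ} (hc : 0 < c) :
    𝓢(E, ℝ) where
  toFun x := Real.exp (-(c * ‖x‖ ^ 2))
  smooth' := Real.contDiff_exp.comp (hasTemperateGrowth_neg_mul_norm_sq c).1
  decay' := exists_norm_pow_mul_norm_iteratedFDeriv_gaussian_le hc

theorem gaussian_apply {c : ℝ} (hc : 0 < c) (x : E) :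
    gaussian E hc x = Real.exp (-(c * ‖x‖ ^ 2)) := rfl

theorem iteratedDeriv_cexp_I_mul (n : ℕ) :
    iteratedDeriv n (fun s : ℝ => Complex.exp (Complex.I * s)) =
      fun s : ℝ => Complex.I ^ n * Complex.exp (Complex.I * s) := by
  induction n with
  | zero => simp
  | succ n ih =>
    ext s
    have hderiv : HasDerivAt (fun s : ℝ => Complex.I ^ n * Complex.exp (Complex.I * s))
        (Complex.I ^ n * (Complex.exp (Complex.I * s) * (Complex.I * 1))) s :=
      (((Complex.ofRealCLM.hasDerivAt (x := s)).const_mul Complex.I).cexp).const_mul _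
    rw [iteratedDeriv_succ, ih, hderiv.deriv, pow_succ]
    ring

theorem hasTemperateGrowth_cexp_I_mul :
    Function.HasTemperateGrowth fun s : ℝ => Complex.exp (Complex.I * s) := by
  refine ⟨Complex.contDiff_exp.comp (contDiff_const.mul Complex.ofRealCLM.contDiff),
    fun n => ⟨0, 1, fun s => ?_⟩⟩
  rw [norm_iteratedFDeriv_eq_norm_iteratedDeriv, iteratedDeriv_cexp_I_mul, norm_mul, norm_pow,
    Complex.norm_I, mul_comm Complex.I, Complex.norm_exp_ofReal_mul_I]
  simp

theorem hasTemperateGrowth_cexp_I_mul_inner (p : E) :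
    Function.HasTemperateGrowth fun x : E => Complex.exp (Complex.I * (⟪p, x⟫_ℝ : ℝ)) :=
  hasTemperateGrowth_cexp_I_mul.comp (Function.hasTemperateGrowth_inner_right p)

end GaussianSchwartz

section Coherent

/-- The scalar coherent state `exp (i ⟨p, x⟩) exp (-Ω ‖x - q‖² / 2)` (not normalized), a joint
eigenfunction of the annihilation operators. -/
def coherentFun {E : Type*} [NormedAddCommGroup E] [InnerProductSpace ℝ E] (Ω : ℝ) (q p x : E) :
    ℂ :=
  Complex.exp (Complex.I * (⟪p, x⟫_ℝ : ℝ) - (Ω / 2 * ‖x - q‖ ^ 2 : ℝ))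

/-- The inner product of the scalar coherent states at `(q, p)` and `(q', p')`. -/
def overlap {d : ℕ} (Ω : ℝ) (q p q' p' : Space d) : ℂ :=
  (((Real.pi / Ω) ^ ((d : ℝ) / 2) : ℝ) : ℂ) *
    Complex.exp (-(Ω / 4 * ‖q - q'‖ ^ 2 + ‖p' - p‖ ^ 2 / (4 * Ω) : ℝ) +
      Complex.I * (⟪p' - p, (1 / 2 : ℝ) • (q + q')⟫_ℝ : ℝ))

section

variable {E : Type*} [NormedAddCommGroup E] [InnerProductSpace ℝ E]

theorem hasFDerivAt_coherentFun (Ω : ℝ) (q p x : E) :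
    HasFDerivAt (coherentFun Ω q p)
      (coherentFun Ω q p x • (Complex.I • (Complex.ofRealCLM ∘L innerSL ℝ p) -
        (Ω : ℂ) • (Complex.ofRealCLM ∘L innerSL ℝ (x - q)))) x := by
  have hinner : HasFDerivAt (fun x : E => ((⟪p, x⟫_ℝ : ℝ) : ℂ))
      (Complex.ofRealCLM ∘L innerSL ℝ p) x :=
    (Complex.ofRealCLM ∘L innerSL ℝ p).hasFDerivAt
  have hsq : HasFDerivAt (fun x : E => Ω / 2 * ‖x - q‖ ^ 2) (Ω • innerSL ℝ (x - q)) x := by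
    refine (((hasFDerivAt_id x).sub_const q).norm_sq.const_mul (Ω / 2)).congr_fderiv ?_
    ext v
    simp
    ring
  refine ((hinner.const_mul Complex.I).sub
    (Complex.ofRealCLM.hasFDerivAt.comp x hsq)).cexp.congr_fderiv ?_
  ext v
  simp [coherentFun]

theorem norm_add_sub_sq_add_norm_add_sub_sq (q q' y : E) :
    ‖y + (1 / 2 : ℝ) • (q + q') - q‖ ^ 2 + ‖y + (1 / 2 : ℝ) • (q + q') - q'‖ ^ 2 =
      2 * ‖y‖ ^ 2 + 1 / 2 * ‖q - q'‖ ^ 2 := by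
  rw [show y + (1 / 2 : ℝ) • (q + q') - q = y - (1 / 2 : ℝ) • (q - q') by module,
    show y + (1 / 2 : ℝ) • (q + q') - q' = y + (1 / 2 : ℝ) • (q - q') by module,
    norm_sub_sq_real, norm_add_sq_real, norm_smul]
  norm_num
  ring

theorem conj_coherentFun_mul_coherentFun (Ω : ℝ) (q p q' p' y : E) :
    (starRingEnd ℂ) (coherentFun Ω q p (y + (1 / 2 : ℝ) • (q + q'))) *
        coherentFun Ω q' p' (y + (1 / 2 : ℝ) • (q + q')) =
      Complex.exp (-(Ω / 4 * ‖q - q'‖ ^ 2 : ℝ) +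
        Complex.I * (⟪p' - p, (1 / 2 : ℝ) • (q + q')⟫_ℝ : ℝ)) *
      Complex.exp (-(Ω : ℂ) * ‖y‖ ^ 2 + Complex.I * (⟪p' - p, y⟫_ℝ : ℝ)) := by
  rw [coherentFun, coherentFun, ← Complex.exp_conj, ← Complex.exp_add, ← Complex.exp_add]
  congr 1
  simp only [map_sub, map_mul, Complex.conj_I, Complex.conj_ofReal, inner_sub_left,
    inner_add_right]
  have hnorm := congrArg (fun r : ℝ => (r : ℂ)) (norm_add_sub_sq_add_norm_add_sub_sq q q' y)
  push_cast at hnorm ⊢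
  linear_combination (-(Ω : ℂ) / 2) * hnorm

end

variable {d : ℕ}

theorem integral_gaussian_cexp {b : ℝ} (hb : 0 < b) (c : ℂ) (w : Space d) :
    ∫ v : Space d, Complex.exp (-(b : ℂ) * ‖v‖ ^ 2 + c * (⟪w, v⟫_ℝ : ℝ)) =
      (((Real.pi / b) ^ ((d : ℝ) / 2) : ℝ) : ℂ) * Complex.exp (c ^ 2 * ‖w‖ ^ 2 / (4 * b)) := by
  rw [GaussianFourier.integral_cexp_neg_mul_sq_norm_add (by simpa using hb),
    Complex.ofReal_cpow (by positivity), finrank_euclideanSpace_fin]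
  push_cast
  rfl

theorem integral_conj_coherentFun_mul_coherentFun {Ω : ℝ} (hΩ : 0 < Ω) (q p q' p' : Space d) :
    ∫ x, (starRingEnd ℂ) (coherentFun Ω q p x) * coherentFun Ω q' p' x = overlap Ω q p q' p' := by
  rw [← integral_add_right_eq_self _ ((1 / 2 : ℝ) • (q + q'))]
  simp only [conj_coherentFun_mul_coherentFun]
  rw [integral_const_mul, integral_gaussian_cexp hΩ, overlap, mul_left_comm, ← Complex.exp_add]
  congr 2
  rw [Complex.I_sq]
  push_cast
  ring

/-- The coherent state `coherentFun Ω q p • e_S` as a Schwartz function. -/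
def coherent {Ω : ℝ} (hΩ : 0 < Ω) (q p : Space d) (S : Finset (Fin d)) : 𝓢(Space d, Fock d) :=
  smulLeftCLM (Fock d) (fun x : Space d => Complex.exp (Complex.I * (⟪p, x⟫_ℝ : ℝ)))
    (compSubConstCLM ℝ q (postcompCLM
      (ContinuousLinearMap.toSpanSingleton ℝ (EuclideanSpace.single S (1 : ℂ)))
      (gaussian (Space d) (half_pos hΩ))))

theorem coherent_apply {Ω : ℝ} (hΩ : 0 < Ω) (q p : Space d) (S : Finset (Fin d)) (x : Space d) :
    coherent hΩ q p S x = coherentFun Ω q p x • EuclideanSpace.single S (1 : ℂ) := by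
  rw [coherent, smulLeftCLM_apply_apply (hasTemperateGrowth_cexp_I_mul_inner p),
    compSubConstCLM_apply, postcompCLM_apply, gaussian_apply,
    ContinuousLinearMap.toSpanSingleton_apply, coherentFun, sub_eq_add_neg (_ * _), Complex.exp_add,
    mul_smul, ← Complex.ofReal_neg, ← Complex.ofReal_exp, Complex.coe_smul]

theorem aAnn_coherent {Ω : ℝ} (hΩ : 0 < Ω) (μ : Fin d) (q p : Space d) (S : Finset (Fin d)) :
    aAnn Ω μ (coherent hΩ q p S) = (Complex.I * p μ + Ω * q μ : ℂ) • coherent hΩ q p S := by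
  ext x : 1
  have hderiv : HasFDerivAt (coherent hΩ q p S) _ x :=
    ((hasFDerivAt_coherentFun Ω q p x).smul_const
      (EuclideanSpace.single S (1 : ℂ))).congr_of_eventuallyEq
        (.of_forall (coherent_apply hΩ q p S))
  rw [aAnn_apply, hderiv.fderiv, _root_.smul_apply, coherent_apply,
    ContinuousLinearMap.smulRight_apply, smul_smul, smul_smul, ← add_smul]
  congr 1
  simp [PiLp.inner_apply]
  ring

theorem inner_coherent {Ω : ℝ} (hΩ : 0 < Ω) (q p q' p' : Space d) (S S' : Finset (Fin d)) :
    ⟪embed d (coherent hΩ q p S), embed d (coherent hΩ q' p' S')⟫_ℂ =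
      if S = S' then overlap Ω q p q' p' else 0 := by
  simp only [inner_embed, coherent_apply, inner_smul_left, inner_smul_right,
    EuclideanSpace.inner_single_left, PiLp.single_apply]
  split_ifs
  · rw [← integral_conj_coherentFun_mul_coherentFun hΩ]
    simp only [map_one, one_mul, mul_one, mul_comm]
  · simp only [mul_zero, integral_zero]

theorem overlap_self (Ω : ℝ) (q p : Space d) :
    overlap Ω q p q p = (((Real.pi / Ω) ^ ((d : ℝ) / 2) : ℝ) : ℂ) := by
  simp [overlap]

theorem continuous_overlap (Ω : ℝ) (q p : Space d) :
    Continuous fun z : Space d × Space d => overlap Ω q p z.1 z.2 := by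
  unfold overlap
  fun_prop

theorem norm_sq_embed_coherent {Ω : ℝ} (hΩ : 0 < Ω) (q p : Space d) (S : Finset (Fin d)) :
    ‖embed d (coherent hΩ q p S)‖ ^ 2 = (Real.pi / Ω) ^ ((d : ℝ) / 2) := by
  have hself := inner_coherent hΩ q p q p S S
  rw [if_pos rfl, overlap_self, inner_self_eq_norm_sq_to_K, ← RCLike.ofReal_pow] at hself
  exact Complex.ofReal_injective hself

theorem norm_sq_embed_coherent_sub {Ω : ℝ} (hΩ : 0 < Ω) (q p q' p' : Space d)
    (S : Finset (Fin d)) :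
    ‖embed d (coherent hΩ q p S) - embed d (coherent hΩ q' p' S)‖ ^ 2 =
      2 * ((Real.pi / Ω) ^ ((d : ℝ) / 2) - (overlap Ω q p q' p').re) := by
  rw [@norm_sub_sq ℂ, inner_coherent, if_pos rfl, norm_sq_embed_coherent, norm_sq_embed_coherent,
    RCLike.re_to_complex]
  ring

theorem continuous_coherent {Ω : ℝ} (hΩ : 0 < Ω) (S : Finset (Fin d)) :
    Continuous fun z : Space d × Space d => embed d (coherent hΩ z.1 z.2 S) := by
  refine continuous_iff_continuousAt.2 fun z₀ => tendsto_iff_norm_sub_tendsto_zero.2 ?_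
  have norm_sub_eq (z : Space d × Space d) :
      ‖embed d (coherent hΩ z.1 z.2 S) - embed d (coherent hΩ z₀.1 z₀.2 S)‖ =
        √(2 * ((Real.pi / Ω) ^ ((d : ℝ) / 2) - (overlap Ω z₀.1 z₀.2 z.1 z.2).re)) := by
    rw [norm_sub_rev, ← norm_sq_embed_coherent_sub hΩ, Real.sqrt_sq (norm_nonneg _)]
  simp only [norm_sub_eq]
  refine Continuous.tendsto' (((continuous_const.sub (Complex.continuous_re.comp
    (continuous_overlap Ω z₀.1 z₀.2))).const_mul 2).sqrt) _ _ ?_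
  change √(2 * ((Real.pi / Ω) ^ ((d : ℝ) / 2) - (overlap Ω z₀.1 z₀.2 z₀.1 z₀.2).re)) = 0
  rw [overlap_self, Complex.ofReal_re, sub_self, mul_zero, Real.sqrt_zero]

end Coherent

/-! ### Hermite functions -/

section Hermite

variable {d : ℕ} {Ω : ℝ}

/-- The Hermite functions `a*_{μ₁} ⋯ a*_{μₙ} exp (-Ω ‖x‖² / 2) e_S` (not normalized). -/
def hermite (hΩ : 0 < Ω) (S : Finset (Fin d)) : List (Fin d) → 𝓢(Space d, Fock d)
  | [] => coherent hΩ 0 0 S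
  | μ :: l => aStar Ω μ (hermite hΩ S l)

theorem hermite_cons (hΩ : 0 < Ω) (S : Finset (Fin d)) (μ : Fin d) (l : List (Fin d)) :
    hermite hΩ S (μ :: l) = aStar Ω μ (hermite hΩ S l) := rfl

theorem aAnn_hermite_nil (hΩ : 0 < Ω) (S : Finset (Fin d)) (μ : Fin d) :
    aAnn Ω μ (hermite hΩ S []) = 0 := by
  rw [hermite, aAnn_coherent]
  simp

theorem aAnn_aStar_apply (Ω : ℝ) (μ ν : Fin d) (ψ : 𝓢(Space d, Fock d)) :
    aAnn Ω μ (aStar Ω ν ψ) =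
      aStar Ω ν (aAnn Ω μ ψ) + if μ = ν then (2 * Ω : ℂ) • ψ else 0 := by
  have hlie := DFunLike.congr_fun (lie_aAnn_aStar (d := d) Ω μ ν) ψ
  rw [Ring.lie_def, _root_.sub_apply, mul_apply_eq_comp, mul_apply_eq_comp,
    sub_eq_iff_eq_add'] at hlie
  rw [hlie, add_right_inj]
  split_ifs
  · rw [Algebra.algebraMap_eq_smul_one]
    rfl
  · rfl

theorem sum_aStar_aAnn_hermite (hΩ : 0 < Ω) (S : Finset (Fin d)) (l : List (Fin d)) :
    ∑ μ, aStar Ω μ (aAnn Ω μ (hermite hΩ S l)) = (2 * Ω * l.length : ℂ) • hermite hΩ S l := by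
  induction l with
  | nil => simp [aAnn_hermite_nil]
  | cons ν l ih =>
    have aStar_aAnn_cons (μ : Fin d) : aStar Ω μ (aAnn Ω μ (hermite hΩ S (ν :: l))) =
        aStar Ω ν (aStar Ω μ (aAnn Ω μ (hermite hΩ S l))) +
          if μ = ν then (2 * Ω : ℂ) • hermite hΩ S (ν :: l) else 0 := by
      rw [hermite_cons, aAnn_aStar_apply, map_add,
        show aStar Ω μ (aStar Ω ν _) = aStar Ω ν (aStar Ω μ _) from
          DFunLike.congr_fun (commute_aStar Ω μ ν).eq _, apply_ite (aStar Ω μ), map_smul, map_zero]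
      split_ifs with hμν
      · rw [hμν]
      · rfl
    simp only [aStar_aAnn_cons, Finset.sum_add_distrib, ← map_sum, ih, Finset.sum_ite_eq',
      Finset.mem_univ, if_true, map_smul, ← hermite_cons, ← add_smul, List.length_cons]
    congr 1
    push_cast
    ring

/-- The contribution of the fermions to the eigenvalue of a Dirac operator squared on `e_S`: the
number of fermions for `D₁` and of holes for `D₂`. -/
def fermionNumber (j : Fin 2) (S : Finset (Fin d)) : ℕ :=
  (Finset.univ.filter fun μ => (μ ∈ S ↔ j = 0)).card

theorem raising_lowering_single (j : Fin 2) (μ : Fin d) (S : Finset (Fin d)) :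
    raising j μ (lowering j μ (EuclideanSpace.single S (1 : ℂ))) =
      (if (μ ∈ S ↔ j = 0) then 1 else 0 : ℂ) • EuclideanSpace.single S (1 : ℂ) := by
  ext T
  rw [PiLp.smul_apply, smul_eq_mul, raising, lowering]
  rcases eq_or_ne T S with rfl | hT <;> rcases eq_or_ne j 0 with hj | hj
  · simp [hj, bStar_bAnn_self]
  · simp [hj, bAnn_bStar_self, ite_not]
  · simp [hj, bStar_bAnn_self, hT]
  · simp [hj, bAnn_bStar_self, hT]

theorem onFock_hermite (hΩ : 0 < Ω) (b : Fock d →L[ℂ] Fock d) (S : Finset (Fin d)) {c : ℂ}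
    (hb : b (EuclideanSpace.single S (1 : ℂ)) = c • EuclideanSpace.single S (1 : ℂ))
    (l : List (Fin d)) : onFock b (hermite hΩ S l) = c • hermite hΩ S l := by
  induction l with
  | nil =>
    ext x : 1
    rw [onFock_apply, hermite, coherent_apply, map_smul, hb, _root_.smul_apply, coherent_apply,
      smul_comm]
  | cons μ l ih =>
    rw [hermite_cons, ← map_smul, ← ih]
    exact (DFunLike.congr_fun (commute_aStar_onFock Ω μ b).eq (hermite hΩ S l)).symm

theorem diracSchwartz_diracSchwartz_hermite (hΩ : 0 < Ω) (j : Fin 2) (S : Finset (Fin d))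
    (l : List (Fin d)) :
    diracSchwartz d Ω j (diracSchwartz d Ω j (hermite hΩ S l)) =
      ((2 * Ω * (l.length + fermionNumber j S : ℕ) : ℝ) : ℂ) • hermite hΩ S l := by
  have raising_lowering_hermite (μ : Fin d) :
      (onFock (raising j μ) * onFock (lowering j μ)) (hermite hΩ S l) =
        (if (μ ∈ S ↔ j = 0) then 1 else 0 : ℂ) • hermite hΩ S l :=
    onFock_hermite hΩ (raising j μ * lowering j μ) S (raising_lowering_single j μ S) l
  rw [← mul_apply_eq_comp, diracSchwartz_mul_self]
  simp only [_root_.add_apply, _root_.sum_apply, _root_.smul_apply, mul_apply_eq_comp,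
    sum_aStar_aAnn_hermite]
  simp only [← mul_apply_eq_comp, raising_lowering_hermite, ← Finset.sum_smul, smul_smul,
    ← add_smul, Finset.sum_boole, fermionNumber]
  congr 1
  push_cast
  ring

theorem inner_hermite_coherent (hΩ : 0 < Ω) (S S' : Finset (Fin d)) (l : List (Fin d))
    (q p : Space d) :
    ⟪embed d (hermite hΩ S l), embed d (coherent hΩ q p S')⟫_ℂ =
      (l.map fun μ => Complex.I * p μ + Ω * q μ : List ℂ).prod *
        if S = S' then overlap Ω 0 0 q p else 0 := by
  induction l with
  | nil => simp [hermite, inner_coherent]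
  | cons μ l ih =>
    rw [hermite_cons, inner_embed_aStar, aAnn_coherent, map_smul, inner_smul_right, ih,
      List.map_cons, List.prod_cons, mul_assoc]

/-- The linear span of the Hermite functions, that is, the polynomials times the Gaussian
`exp (-Ω ‖x‖² / 2) e_S`. -/
def hermiteSpan (hΩ : 0 < Ω) (S : Finset (Fin d)) : Submodule ℂ 𝓢(Space d, Fock d) :=
  Submodule.span ℂ (Set.range (hermite hΩ S))

theorem hermite_mem_hermiteSpan (hΩ : 0 < Ω) (S : Finset (Fin d)) (l : List (Fin d)) :
    hermite hΩ S l ∈ hermiteSpan hΩ S :=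
  Submodule.subset_span ⟨l, rfl⟩

theorem map_mem_hermiteSpan (hΩ : 0 < Ω) (S : Finset (Fin d))
    {A : 𝓢(Space d, Fock d) →L[ℂ] 𝓢(Space d, Fock d)}
    (hA : ∀ l, A (hermite hΩ S l) ∈ hermiteSpan hΩ S) {ψ : 𝓢(Space d, Fock d)}
    (hψ : ψ ∈ hermiteSpan hΩ S) : A ψ ∈ hermiteSpan hΩ S := by
  have hle : hermiteSpan hΩ S ≤ (hermiteSpan hΩ S).comap A.toLinearMap := by
    refine Submodule.span_le.2 ?_
    rintro _ ⟨l, rfl⟩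
    exact hA l
  exact hle hψ

theorem aStar_mem_hermiteSpan (hΩ : 0 < Ω) (S : Finset (Fin d)) (μ : Fin d)
    {ψ : 𝓢(Space d, Fock d)} (hψ : ψ ∈ hermiteSpan hΩ S) : aStar Ω μ ψ ∈ hermiteSpan hΩ S :=
  map_mem_hermiteSpan hΩ S (fun l => hermite_mem_hermiteSpan hΩ S (μ :: l)) hψ

theorem aAnn_mem_hermiteSpan (hΩ : 0 < Ω) (S : Finset (Fin d)) (μ : Fin d)
    {ψ : 𝓢(Space d, Fock d)} (hψ : ψ ∈ hermiteSpan hΩ S) : aAnn Ω μ ψ ∈ hermiteSpan hΩ S := by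
  refine map_mem_hermiteSpan hΩ S (fun l => ?_) hψ
  induction l with
  | nil =>
    rw [aAnn_hermite_nil]
    exact Submodule.zero_mem _
  | cons ν l ih =>
    rw [hermite_cons, aAnn_aStar_apply]
    refine Submodule.add_mem _ (aStar_mem_hermiteSpan hΩ S ν ih) ?_
    split_ifs
    · exact Submodule.smul_mem _ _ (hermite_mem_hermiteSpan hΩ S l)
    · exact Submodule.zero_mem _

theorem mulCoord_mem_hermiteSpan (hΩ : 0 < Ω) (S : Finset (Fin d)) (μ : Fin d)
    {ψ : 𝓢(Space d, Fock d)} (hψ : ψ ∈ hermiteSpan hΩ S) : mulCoord Ω μ ψ ∈ hermiteSpan hΩ S := by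
  have hmul : mulCoord Ω μ ψ = (1 / 2 : ℂ) • (aAnn Ω μ ψ + aStar Ω μ ψ) := by
    rw [aAnn_eq, aStar_eq, _root_.add_apply, _root_.add_apply, _root_.neg_apply]
    module
  rw [hmul]
  exact Submodule.smul_mem _ _ (Submodule.add_mem _ (aAnn_mem_hermiteSpan hΩ S μ hψ)
    (aStar_mem_hermiteSpan hΩ S μ hψ))

theorem exists_mem_hermiteSpan_eq_inner_pow_smul (hΩ : 0 < Ω) (S : Finset (Fin d)) (k : Space d)
    (n : ℕ) :
    ∃ ψ ∈ hermiteSpan hΩ S, ∀ x, ψ x = ((⟪k, x⟫_ℝ : ℝ) : ℂ) ^ n • coherent hΩ 0 0 S x := by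
  induction n with
  | zero => exact ⟨_, hermite_mem_hermiteSpan hΩ S [], fun x => by simp [hermite]⟩
  | succ n ih =>
    obtain ⟨ψ, hψ, ψ_apply⟩ := ih
    refine ⟨∑ μ, ((k μ / Ω : ℝ) : ℂ) • mulCoord Ω μ ψ, Submodule.sum_mem _ fun μ _ =>
      Submodule.smul_mem _ _ (mulCoord_mem_hermiteSpan hΩ S μ hψ), fun x => ?_⟩
    have inner_eq_sum :
        ((⟪k, x⟫_ℝ : ℝ) : ℂ) = ∑ μ, ((k μ / Ω : ℝ) : ℂ) * ((Ω * x μ : ℝ) : ℂ) := by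
      rw [PiLp.inner_apply, Complex.ofReal_sum]
      refine Finset.sum_congr rfl fun μ _ => ?_
      rw [← Complex.ofReal_mul, div_mul_eq_mul_div, mul_left_comm, mul_div_cancel_left₀ _ hΩ.ne']
      exact congrArg _ (mul_comm _ _)
    simp only [_root_.sum_apply, _root_.smul_apply, mulCoord_apply, ψ_apply, smul_smul,
      ← Finset.sum_smul]
    rw [pow_succ', inner_eq_sum, Finset.sum_mul]
    simp only [mul_assoc]

end Hermite

/-! ### Totality of the Hermite functions and of the coherent states -/

section FourierUniqueness

theorem hasSum_integral_cexp_I_mul {α : Type*} [MeasurableSpace α] {ν : Measure α} {h : α → ℝ}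
    {g : α → ℂ} (hh : AEStronglyMeasurable h ν) (hg : AEStronglyMeasurable g ν)
    (hint : Integrable (fun x => Real.exp |h x| * ‖g x‖) ν) :
    HasSum (fun n : ℕ => ∫ x, (Complex.I * h x) ^ n / n.factorial * g x ∂ν)
      (∫ x, Complex.exp (Complex.I * h x) * g x ∂ν) := by
  have hasSum_exp (x : α) :
      HasSum (fun n : ℕ => |h x| ^ n / n.factorial * ‖g x‖) (Real.exp |h x| * ‖g x‖) := by
    rw [Real.exp_eq_exp_ℝ]
    exact (NormedSpace.expSeries_div_hasSum_exp (𝔸 := ℝ) |h x|).mul_right _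
  have hh' : AEStronglyMeasurable (fun x => (h x : ℂ)) ν :=
    Complex.continuous_ofReal.comp_aestronglyMeasurable hh
  refine hasSum_integral_of_dominated_convergence
    (bound := fun n x => |h x| ^ n / n.factorial * ‖g x‖) (fun n => ?_)
    (fun n => .of_forall fun x => ?_) (.of_forall fun x => (hasSum_exp x).summable) ?_
    (.of_forall fun x => ?_)
  · simp only [div_eq_mul_inv]
    exact (((hh'.const_mul _).pow n).mul_const _).mul hg
  · rw [norm_mul, norm_div, norm_pow, norm_mul, Complex.norm_I, one_mul, Complex.norm_real,
      Complex.norm_natCast, Real.norm_eq_abs]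
  · simpa only [(hasSum_exp _).tsum_eq] using hint
  · have hasSum_cexp := NormedSpace.expSeries_div_hasSum_exp (𝔸 := ℂ) (Complex.I * h x)
    rw [← Complex.exp_eq_exp_ℂ] at hasSum_cexp
    exact hasSum_cexp.mul_right _

theorem integral_cexp_I_mul_eq_zero {α : Type*} [MeasurableSpace α] {ν : Measure α} {h : α → ℝ}
    {g : α → ℂ} (hh : AEStronglyMeasurable h ν) (hg : AEStronglyMeasurable g ν)
    (hint : Integrable (fun x => Real.exp |h x| * ‖g x‖) ν)
    (hmoment : ∀ n : ℕ, ∫ x, (h x : ℂ) ^ n * g x ∂ν = 0) :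
    ∫ x, Complex.exp (Complex.I * h x) * g x ∂ν = 0 := by
  refine (hasSum_integral_cexp_I_mul hh hg hint).unique ?_
  simp only [mul_pow, mul_div_right_comm, mul_assoc, integral_const_mul, hmoment, mul_zero]
  exact hasSum_zero

variable {V : Type*} [NormedAddCommGroup V] [InnerProductSpace ℝ V] [FiniteDimensional ℝ V]
  [MeasurableSpace V] [BorelSpace V]

theorem ae_eq_zero_of_integral_cexp_I_mul_inner {g : V → ℂ} (hg : Integrable g)
    (h : ∀ k : V, ∫ x, Complex.exp (Complex.I * (⟪k, x⟫_ℝ : ℝ)) * g x = 0) : g =ᵐ[volume] 0 := by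
  have fourier_eq_zero (w : V) : FourierTransform.fourier g w = 0 := by
    rw [Real.fourier_eq', ← h (-(2 * Real.pi) • w)]
    congr 1
    funext x
    rw [smul_eq_mul, inner_smul_left, real_inner_comm x w]
    congr 2
    simp
    ring
  refine ae_eq_zero_of_integral_contDiff_smul_eq_zero hg.locallyIntegrable fun u hu hcu => ?_
  let φ : 𝓢(V, ℂ) := (hcu.comp_left Complex.ofReal_zero).toSchwartzMap
    (Complex.ofRealCLM.contDiff.comp hu)
  let ψ : 𝓢(V, ℂ) := FourierTransformInv.fourierInv φ
  have fourier_ψ : FourierTransform.fourier (ψ : V → ℂ) = φ := by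
    rw [← fourier_coe]
    simp [ψ]
  have parseval : ∫ ξ, FourierTransform.fourier (ψ : V → ℂ) ξ • g ξ =
      ∫ x, ψ x • FourierTransform.fourier g x := by
    have hflip := VectorFourier.integral_fourierIntegral_smul_eq_flip (L := innerₗ V)
      Real.continuous_fourierChar continuous_inner (ψ.integrable (μ := volume)) hg
    rwa [flip_innerₗ] at hflip
  calc ∫ x, u x • g x = ∫ ξ, FourierTransform.fourier (ψ : V → ℂ) ξ • g ξ := by
        rw [fourier_ψ]
        rfl
    _ = 0 := by simp only [parseval, fourier_eq_zero, smul_zero, integral_zero]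

theorem memLp_two_gaussian {c : ℝ} (hc : 0 < c) :
    MemLp (fun x : V => Real.exp (-(c * ‖x‖ ^ 2))) 2 := by
  simpa only [← gaussian_apply hc] using (gaussian V hc).memLp 2 volume

theorem integrable_exp_abs_inner_mul_norm_gaussian_mul {c : ℝ} (hc : 0 < c) (k : V) {g : V → ℂ}
    (hg : MemLp g 2) :
    Integrable fun x => Real.exp |⟪k, x⟫_ℝ| * ‖(Real.exp (-(c * ‖x‖ ^ 2)) : ℂ) * g x‖ := by
  refine (((memLp_two_gaussian (half_pos hc)).integrable_mul hg.norm).const_mul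
    (Real.exp (‖k‖ ^ 2 / (2 * c)))).mono' ?_ (.of_forall fun x => ?_)
  · exact .mul (Continuous.aestronglyMeasurable (by fun_prop))
      (.norm (.mul (Continuous.aestronglyMeasurable (by fun_prop)) hg.1))
  · have hexponent : |⟪k, x⟫_ℝ| + -(c * ‖x‖ ^ 2) ≤ ‖k‖ ^ 2 / (2 * c) + -(c / 2 * ‖x‖ ^ 2) := by
      have hcs := abs_real_inner_le_norm k x
      have hamgm : ‖k‖ * ‖x‖ ≤ ‖k‖ ^ 2 / (2 * c) + c / 2 * ‖x‖ ^ 2 := by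
        rw [← sub_nonneg, show ‖k‖ ^ 2 / (2 * c) + c / 2 * ‖x‖ ^ 2 - ‖k‖ * ‖x‖ =
          (‖k‖ - c * ‖x‖) ^ 2 / (2 * c) by field_simp; ring]
        positivity
      linarith
    rw [Real.norm_of_nonneg (by positivity), norm_mul, Complex.norm_real,
      Real.norm_of_nonneg (Real.exp_nonneg _), ← mul_assoc, Pi.mul_apply, ← mul_assoc,
      ← Real.exp_add, ← Real.exp_add]
    gcongr

end FourierUniqueness

section Total

variable {d : ℕ} {Ω : ℝ}

theorem inner_embed_eq_integral (ψ : 𝓢(Space d, Fock d)) (f : Hilb d) :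
    ⟪embed d ψ, f⟫_ℂ = ∫ x, ⟪ψ x, f x⟫_ℂ := by
  rw [L2.inner_def]
  refine integral_congr_ae ?_
  filter_upwards [ψ.coeFn_toLp 2 (volume : Measure (Space d))] with x hx
  exact congrArg (⟪·, f x⟫_ℂ) hx

theorem memLp_component (f : Hilb d) (S : Finset (Fin d)) :
    MemLp (fun x => f x S) 2 (volume : Measure (Space d)) :=
  (Lp.memLp f).continuousLinearMap_comp (EuclideanSpace.proj (𝕜 := ℂ) S)

theorem inner_coherent_zero_apply (hΩ : 0 < Ω) (k : Space d) (S : Finset (Fin d)) (x : Space d)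
    (v : Fock d) :
    ⟪coherent hΩ 0 k S x, v⟫_ℂ = Complex.exp (Complex.I * (⟪-k, x⟫_ℝ : ℝ)) *
      ((Real.exp (-(Ω / 2 * ‖x‖ ^ 2)) : ℂ) * v S) := by
  rw [coherent_apply, inner_smul_left, EuclideanSpace.inner_single_left, map_one, one_mul,
    coherentFun, ← Complex.exp_conj, ← mul_assoc, Complex.ofReal_exp, ← Complex.exp_add, sub_zero,
    map_sub, map_mul, Complex.conj_I, Complex.conj_ofReal, Complex.conj_ofReal, inner_neg_left,
    Complex.ofReal_neg, Complex.ofReal_neg, mul_neg, neg_mul, sub_eq_add_neg]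

theorem inner_embed_coherent_zero (hΩ : 0 < Ω) (k : Space d) (S : Finset (Fin d)) (f : Hilb d) :
    ⟪embed d (coherent hΩ 0 k S), f⟫_ℂ = ∫ x, Complex.exp (Complex.I * (⟪-k, x⟫_ℝ : ℝ)) *
      ((Real.exp (-(Ω / 2 * ‖x‖ ^ 2)) : ℂ) * f x S) := by
  simp only [inner_embed_eq_integral, inner_coherent_zero_apply]

theorem inner_embed_eq_zero_of_mem_hermiteSpan (hΩ : 0 < Ω) (S : Finset (Fin d)) {f : Hilb d}
    (h : ∀ l, ⟪embed d (hermite hΩ S l), f⟫_ℂ = 0) {ψ : 𝓢(Space d, Fock d)}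
    (hψ : ψ ∈ hermiteSpan hΩ S) : ⟪embed d ψ, f⟫_ℂ = 0 := by
  induction hψ using Submodule.span_induction with
  | mem _ hl =>
    obtain ⟨l, rfl⟩ := hl
    exact h l
  | zero => rw [map_zero, inner_zero_left]
  | add _ _ _ _ hψ hφ => rw [map_add, inner_add_left, hψ, hφ, add_zero]
  | smul _ _ _ hψ => rw [map_smul, inner_smul_left, hψ, mul_zero]

theorem inner_coherent_eq_zero_of_inner_hermite (hΩ : 0 < Ω) (S : Finset (Fin d)) {f : Hilb d}
    (h : ∀ l, ⟪embed d (hermite hΩ S l), f⟫_ℂ = 0) (k : Space d) :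
    ⟪embed d (coherent hΩ 0 k S), f⟫_ℂ = 0 := by
  rw [inner_embed_coherent_zero]
  refine integral_cexp_I_mul_eq_zero (Continuous.aestronglyMeasurable (by fun_prop))
    (.mul (Continuous.aestronglyMeasurable (by fun_prop)) (memLp_component f S).1)
    (integrable_exp_abs_inner_mul_norm_gaussian_mul (half_pos hΩ) (-k) (memLp_component f S))
    fun n => ?_
  obtain ⟨ψ, hψ, ψ_apply⟩ := exists_mem_hermiteSpan_eq_inner_pow_smul hΩ S (-k) n
  rw [← inner_embed_eq_zero_of_mem_hermiteSpan hΩ S h hψ, inner_embed_eq_integral]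
  simp only [ψ_apply, inner_smul_left, inner_coherent_zero_apply, map_pow, Complex.conj_ofReal,
    neg_zero, inner_zero_left, Complex.ofReal_zero, mul_zero, Complex.exp_zero, one_mul]

theorem eq_zero_of_inner_coherent (hΩ : 0 < Ω) {f : Hilb d}
    (h : ∀ (S : Finset (Fin d)) (k : Space d), ⟪embed d (coherent hΩ 0 k S), f⟫_ℂ = 0) :
    f = 0 := by
  have component_eq_zero (S : Finset (Fin d)) : ∀ᵐ x ∂volume, f x S = 0 := by
    have hint : Integrable fun x : Space d => (Real.exp (-(Ω / 2 * ‖x‖ ^ 2)) : ℂ) * f x S :=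
      (memLp_two_gaussian (half_pos hΩ)).ofReal.integrable_mul (memLp_component f S)
    have hzero := ae_eq_zero_of_integral_cexp_I_mul_inner hint fun k => by
      rw [← h S (-k), inner_embed_coherent_zero, neg_neg]
    filter_upwards [hzero] with x hx
    exact (mul_eq_zero.1 hx).resolve_left (Complex.ofReal_ne_zero.2 (Real.exp_ne_zero _))
  rw [Lp.eq_zero_iff_ae_eq_zero]
  filter_upwards [ae_all_iff.2 component_eq_zero] with x hx
  ext S
  exact hx S

theorem eq_zero_of_inner_hermite (hΩ : 0 < Ω) {f : Hilb d}
    (h : ∀ (S : Finset (Fin d)) (l : List (Fin d)), ⟪embed d (hermite hΩ S l), f⟫_ℂ = 0) : f = 0 :=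
  eq_zero_of_inner_coherent hΩ fun S => inner_coherent_eq_zero_of_inner_hermite hΩ S (h S)

end Total

/-! ### The Dirac operators and their heat operators -/

section HeatCoherent

variable {d : ℕ} {Ω t : ℝ}

theorem diracCore_embed (Ω : ℝ) (j : Fin 2) (ψ : 𝓢(Space d, Fock d))
    (h : embed d ψ ∈ (diracCore d Ω j).domain) :
    diracCore d Ω j ⟨embed d ψ, h⟩ = embed d (diracSchwartz d Ω j ψ) := by
  change embed d (diracSchwartz d Ω j
    ((LinearEquiv.ofInjective (embed d) (embed_injective d)).symm ⟨embed d ψ, h⟩)) = _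
  congr 2
  rw [LinearEquiv.symm_apply_eq]
  rfl

theorem isFormalAdjoint_diracCore (Ω : ℝ) (j : Fin 2) :
    (diracCore d Ω j).IsFormalAdjoint (diracCore d Ω j) := by
  rintro ⟨_, ψ, rfl⟩ ⟨_, φ, rfl⟩
  have symm := inner_embed_dirac Ω j ψ φ
  rwa [← diracCore_embed Ω j ψ ⟨ψ, rfl⟩, ← diracCore_embed Ω j φ ⟨φ, rfl⟩] at symm

theorem isSqEigenvector_hermite (hΩ : 0 < Ω) (j : Fin 2) (S : Finset (Fin d))
    (l : List (Fin d)) :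
    IsSqEigenvector (diracCore d Ω j) (2 * Ω * (l.length + fermionNumber j S : ℕ))
      (embed d (hermite hΩ S l)) := by
  have hmem (ψ : 𝓢(Space d, Fock d)) : embed d ψ ∈ (diracCore d Ω j).domain := ⟨ψ, rfl⟩
  refine ⟨hmem _, (diracCore_embed Ω j _ (hmem _)).symm ▸ hmem _, ?_⟩
  simp only [diracCore_embed, diracSchwartz_diracSchwartz_hermite, map_smul]

theorem isSelfAdjoint_dirac (hΩ : 0 < Ω) (j : Fin 2) : IsSelfAdjoint (dirac d Ω j) := by
  refine isSelfAdjoint_closure_of_dense_sqEigenvectors (isFormalAdjoint_diracCore Ω j) ?_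
  rw [Submodule.dense_iff_topologicalClosure_eq_top, Submodule.topologicalClosure_eq_top_iff,
    Submodule.eq_bot_iff]
  exact fun f hf => eq_zero_of_inner_hermite hΩ fun S l => (Submodule.mem_orthogonal _ _).1 hf _
    (Submodule.subset_span ⟨_, by positivity, isSqEigenvector_hermite hΩ j S l⟩)

theorem heat_hermite (hΩ : 0 < Ω) (ht : 0 < t) (j : Fin 2) (S : Finset (Fin d))
    (l : List (Fin d)) :
    heat (dirac d Ω j) t (embed d (hermite hΩ S l)) =
      (Real.exp (-t * (2 * Ω * (l.length + fermionNumber j S : ℕ))) : ℂ) •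
        embed d (hermite hΩ S l) :=
  heat_apply_of_isSqEigenvector (isSelfAdjoint_dirac hΩ j) ht (by positivity)
    ((isSqEigenvector_hermite hΩ j S l).mono (LinearPMap.le_closure _))

theorem exp_mul_overlap_zero_smul (Ω r : ℝ) (k k' : Space d) :
    (Real.exp (-((1 - r ^ 2) * ‖k‖ ^ 2 / (4 * Ω))) : ℂ) * overlap Ω 0 k' 0 (r • k) =
      (((Real.pi / Ω) ^ ((d : ℝ) / 2) : ℝ) : ℂ) *
        Complex.exp ((r * ⟪k, k'⟫_ℝ / (2 * Ω) - (‖k‖ ^ 2 + ‖k'‖ ^ 2) / (4 * Ω) : ℝ)) := by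
  rw [overlap, mul_left_comm, Complex.ofReal_exp, ← Complex.exp_add,
    norm_sub_sq_real (r • k) k', norm_smul, real_inner_smul_left, Real.norm_eq_abs, mul_pow, sq_abs]
  simp only [sub_zero, add_zero, smul_zero, inner_zero_right, norm_zero]
  congr 2
  push_cast
  ring

theorem inner_hermite_coherent_zero_smul (hΩ : 0 < Ω) (r : ℝ) (S S' : Finset (Fin d))
    (l : List (Fin d)) (k : Space d) :
    (Real.exp (-((1 - r ^ 2) * ‖k‖ ^ 2 / (4 * Ω))) : ℂ) *
        ⟪embed d (hermite hΩ S l), embed d (coherent hΩ 0 (r • k) S')⟫_ℂ =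
      (r : ℂ) ^ l.length * ⟪embed d (hermite hΩ S l), embed d (coherent hΩ 0 k S')⟫_ℂ := by
  have overlap_eq : overlap Ω 0 0 0 k =
      (Real.exp (-((1 - r ^ 2) * ‖k‖ ^ 2 / (4 * Ω))) : ℂ) * overlap Ω 0 0 0 (r • k) := by
    rw [exp_mul_overlap_zero_smul, overlap]
    simp only [sub_zero, add_zero, smul_zero, inner_zero_right, norm_zero]
    congr 2
    push_cast
    ring
  have factor_smul (μ : Fin d) : Complex.I * ((r • k) μ : ℝ) + Ω * ((0 : Space d) μ : ℝ) =
      (r : ℂ) * (Complex.I * (k μ : ℝ) + Ω * ((0 : Space d) μ : ℝ)) := by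
    simp [mul_left_comm]
  rw [inner_hermite_coherent, inner_hermite_coherent]
  simp only [factor_smul, List.prod_map_mul, List.map_const', List.prod_replicate]
  split_ifs
  · rw [overlap_eq]
    ring
  · simp only [mul_zero]

theorem heat_coherent (hΩ : 0 < Ω) (ht : 0 < t) (j : Fin 2) (S : Finset (Fin d)) (k : Space d) :
    heat (dirac d Ω j) t (embed d (coherent hΩ 0 k S)) =
      ((Real.exp (-t * (2 * Ω * fermionNumber j S)) : ℂ) *
        (Real.exp (-((1 - Real.exp (-(2 * Ω * t)) ^ 2) * ‖k‖ ^ 2 / (4 * Ω))) : ℂ)) •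
        embed d (coherent hΩ 0 (Real.exp (-(2 * Ω * t)) • k) S) := by
  rw [← sub_eq_zero]
  refine eq_zero_of_inner_hermite hΩ fun S' l => ?_
  have heat_symm := (isSelfAdjoint_heat (dirac d Ω j) t).isSymmetric (embed d (hermite hΩ S' l))
    (embed d (coherent hΩ 0 k S))
  have exp_eq : (Real.exp (-t * (2 * Ω * (l.length + fermionNumber j S' : ℕ))) : ℂ) =
      (Real.exp (-t * (2 * Ω * fermionNumber j S')) : ℂ) *
        (Real.exp (-(2 * Ω * t)) : ℂ) ^ l.length := by
    rw [← Complex.ofReal_pow, ← Complex.ofReal_mul, ← Real.exp_nat_mul, ← Real.exp_add]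
    congr 2
    push_cast
    ring
  rw [inner_sub_right, ← ContinuousLinearMap.coe_coe, ← heat_symm, ContinuousLinearMap.coe_coe,
    heat_hermite hΩ ht, inner_smul_left, inner_smul_right, Complex.conj_ofReal, exp_eq,
    mul_assoc (Real.exp _ : ℂ), mul_assoc (Real.exp _ : ℂ), inner_hermite_coherent_zero_smul,
    inner_hermite_coherent]
  split_ifs with hS
  · rw [hS, sub_self]
  · simp only [mul_zero, sub_self]

end HeatCoherent

/-! ### The heat operators as integrals of projections onto coherent states -/

section HeatWeight

variable {d : ℕ} {Ω t : ℝ}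

/-- The normalization of `heatWeight`, read off from the Gaussian integrals in
`integral_overlap_mul_heatWeight_mul_overlap`. -/
def heatConst (d : ℕ) (Ω t : ℝ) : ℝ :=
  ((Real.pi / Ω) ^ ((d : ℝ) / 2) * (Real.pi / (Real.exp (2 * Ω * t) * Ω / 2)) ^ ((d : ℝ) / 2) *
    (Real.pi / (Real.exp (2 * Ω * t) / (2 * Ω))) ^ ((d : ℝ) / 2))⁻¹

theorem heatConst_pos (d : ℕ) (hΩ : 0 < Ω) (t : ℝ) : 0 < heatConst d Ω t := by
  unfold heatConst
  positivity

/-- The phase space weight of the heat operator (its Glauber–Sudarshan symbol): the heat operator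
is the superposition of the projections onto the coherent states at `z = (q, p)` with the weight
`heatWeight Ω t z`. -/
def heatWeight (Ω t : ℝ) (z : Space d × Space d) : ℝ :=
  heatConst d Ω t * (Real.exp (-((Real.exp (2 * Ω * t) - 1) * Ω / 2 * ‖z.1‖ ^ 2)) *
    Real.exp (-((Real.exp (2 * Ω * t) - 1) / (2 * Ω) * ‖z.2‖ ^ 2)))

theorem heatWeight_nonneg (hΩ : 0 < Ω) (t : ℝ) (z : Space d × Space d) : 0 ≤ heatWeight Ω t z :=
  mul_nonneg (heatConst_pos d hΩ t).le (by positivity)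

theorem continuous_heatWeight (Ω t : ℝ) : Continuous (heatWeight (d := d) Ω t) := by
  unfold heatWeight
  fun_prop

theorem exp_two_mul_mul_sub_one_pos (hΩ : 0 < Ω) (ht : 0 < t) : 0 < Real.exp (2 * Ω * t) - 1 :=
  sub_pos.2 (Real.one_lt_exp_iff.2 (by positivity))

theorem integrable_heatWeight (hΩ : 0 < Ω) (ht : 0 < t) :
    Integrable (heatWeight (d := d) Ω t) := by
  have hexp := exp_two_mul_mul_sub_one_pos hΩ ht
  have integrable_gaussian {c : ℝ} (hc : 0 < c) :
      Integrable fun x : Space d => Real.exp (-(c * ‖x‖ ^ 2)) := by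
    simpa only [← gaussian_apply hc] using (gaussian (Space d) hc).integrable
  exact ((integrable_gaussian (by positivity)).mul_prod
    (integrable_gaussian (by positivity))).const_mul _

theorem continuous_rankOne {𝕜 E F Z : Type*} [RCLike 𝕜] [NormedAddCommGroup E]
    [InnerProductSpace 𝕜 E] [NormedAddCommGroup F] [InnerProductSpace 𝕜 F] [TopologicalSpace Z]
    {u : Z → E} {v : Z → F} (hu : Continuous u) (hv : Continuous v) :
    Continuous fun z => InnerProductSpace.rankOne 𝕜 (u z) (v z) :=
  (ContinuousLinearMap.smulRightL 𝕜 F E).continuous₂.comp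
    (((innerSL 𝕜).continuous.comp hv).prodMk hu)

theorem integrable_heatWeight_smul_rankOne_coherent (hΩ : 0 < Ω) (ht : 0 < t)
    (S : Finset (Fin d)) :
    Integrable fun z : Space d × Space d => InnerProductSpace.rankOne ℂ
      ((heatWeight Ω t z : ℂ) • embed d (coherent hΩ z.1 z.2 S))
      (embed d (coherent hΩ z.1 z.2 S)) := by
  have hcoherent := continuous_coherent hΩ S
  refine ((integrable_heatWeight hΩ ht).mul_const ((Real.pi / Ω) ^ ((d : ℝ) / 2))).mono'
    (continuous_rankOne ((Complex.continuous_ofReal.comp (continuous_heatWeight Ω t)).smul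
      hcoherent) hcoherent).aestronglyMeasurable (.of_forall fun z => le_of_eq ?_)
  rw [InnerProductSpace.norm_rankOne, norm_smul, Complex.norm_real,
    Real.norm_of_nonneg (heatWeight_nonneg hΩ t z), mul_assoc, ← sq, norm_sq_embed_coherent]

theorem overlap_zero_mul_zero_overlap (hΩ : Ω ≠ 0) (q p k k' : Space d) :
    overlap Ω q p 0 k * overlap Ω 0 k' q p =
      (((Real.pi / Ω) ^ ((d : ℝ) / 2) : ℝ) : ℂ) ^ 2 *
        Complex.exp (-((‖k‖ ^ 2 + ‖k'‖ ^ 2) / (4 * Ω) : ℝ)) *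
        (Complex.exp (-((Ω / 2 : ℝ) : ℂ) * ‖q‖ ^ 2 + Complex.I / 2 * (⟪k - k', q⟫_ℝ : ℝ)) *
          Complex.exp (-((1 / (2 * Ω) : ℝ) : ℂ) * ‖p‖ ^ 2 +
            ((1 / (2 * Ω) : ℝ) : ℂ) * (⟪k + k', p⟫_ℝ : ℝ))) := by
  rw [overlap, overlap, mul_mul_mul_comm, ← sq, mul_assoc, ← Complex.exp_add, ← Complex.exp_add,
    ← Complex.exp_add]
  congr 2
  simp only [sub_zero, zero_sub, norm_neg, add_zero, zero_add, real_inner_smul_right,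
    inner_sub_left, inner_add_left, norm_sub_sq_real, real_inner_comm p k']
  have hΩ' : (Ω : ℂ) ≠ 0 := Complex.ofReal_ne_zero.2 hΩ
  push_cast
  field_simp
  ring

theorem overlap_mul_heatWeight_mul_overlap (hΩ : Ω ≠ 0) (t : ℝ) (z : Space d × Space d)
    (k k' : Space d) :
    overlap Ω z.1 z.2 0 k * (heatWeight Ω t z * overlap Ω 0 k' z.1 z.2) =
      (((Real.pi / Ω) ^ ((d : ℝ) / 2) : ℝ) : ℂ) ^ 2 * heatConst d Ω t *
        Complex.exp (-((‖k‖ ^ 2 + ‖k'‖ ^ 2) / (4 * Ω) : ℝ)) *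
        (Complex.exp (-((Real.exp (2 * Ω * t) * Ω / 2 : ℝ) : ℂ) * ‖z.1‖ ^ 2 +
            Complex.I / 2 * (⟪k - k', z.1⟫_ℝ : ℝ)) *
          Complex.exp (-((Real.exp (2 * Ω * t) / (2 * Ω) : ℝ) : ℂ) * ‖z.2‖ ^ 2 +
            ((1 / (2 * Ω) : ℝ) : ℂ) * (⟪k + k', z.2⟫_ℝ : ℝ))) := by
  have exp_position : Complex.exp (-((Real.exp (2 * Ω * t) * Ω / 2 : ℝ) : ℂ) * ‖z.1‖ ^ 2 +
        Complex.I / 2 * (⟪k - k', z.1⟫_ℝ : ℝ)) =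
      (Real.exp (-((Real.exp (2 * Ω * t) - 1) * Ω / 2 * ‖z.1‖ ^ 2)) : ℂ) *
        Complex.exp (-((Ω / 2 : ℝ) : ℂ) * ‖z.1‖ ^ 2 + Complex.I / 2 * (⟪k - k', z.1⟫_ℝ : ℝ)) := by
    rw [Complex.ofReal_exp, ← Complex.exp_add]
    congr 1
    push_cast
    ring
  have exp_momentum : Complex.exp (-((Real.exp (2 * Ω * t) / (2 * Ω) : ℝ) : ℂ) * ‖z.2‖ ^ 2 +
        ((1 / (2 * Ω) : ℝ) : ℂ) * (⟪k + k', z.2⟫_ℝ : ℝ)) =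
      (Real.exp (-((Real.exp (2 * Ω * t) - 1) / (2 * Ω) * ‖z.2‖ ^ 2)) : ℂ) *
        Complex.exp (-((1 / (2 * Ω) : ℝ) : ℂ) * ‖z.2‖ ^ 2 +
          ((1 / (2 * Ω) : ℝ) : ℂ) * (⟪k + k', z.2⟫_ℝ : ℝ)) := by
    rw [Complex.ofReal_exp, ← Complex.exp_add]
    congr 1
    push_cast
    ring
  rw [mul_left_comm, overlap_zero_mul_zero_overlap hΩ, exp_position, exp_momentum, heatWeight,
    Complex.ofReal_mul, Complex.ofReal_mul]
  ring

theorem sq_mul_heatConst_mul (hΩ : 0 < Ω) (t : ℝ) :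
    ((Real.pi / Ω) ^ ((d : ℝ) / 2)) ^ 2 * heatConst d Ω t *
      ((Real.pi / (Real.exp (2 * Ω * t) * Ω / 2)) ^ ((d : ℝ) / 2) *
        (Real.pi / (Real.exp (2 * Ω * t) / (2 * Ω))) ^ ((d : ℝ) / 2)) =
      (Real.pi / Ω) ^ ((d : ℝ) / 2) := by
  have hdenom : 0 < (Real.pi / Ω) ^ ((d : ℝ) / 2) *
      (Real.pi / (Real.exp (2 * Ω * t) * Ω / 2)) ^ ((d : ℝ) / 2) *
      (Real.pi / (Real.exp (2 * Ω * t) / (2 * Ω))) ^ ((d : ℝ) / 2) := by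
    positivity
  rw [heatConst, sq, mul_right_comm, mul_assoc _ _ (_ * _), ← mul_assoc _ _ (_ ^ _), mul_assoc,
    mul_inv_cancel₀ hdenom.ne', mul_one]

theorem gaussian_exponents_add (hΩ : Ω ≠ 0) (t : ℝ) (k k' : Space d) :
    -(((‖k‖ ^ 2 + ‖k'‖ ^ 2) / (4 * Ω) : ℝ) : ℂ) +
        ((Complex.I / 2) ^ 2 * (‖k - k'‖ : ℂ) ^ 2 /
            (4 * ((Real.exp (2 * Ω * t) * Ω / 2 : ℝ) : ℂ)) +
          ((1 / (2 * Ω) : ℝ) : ℂ) ^ 2 * (‖k + k'‖ : ℂ) ^ 2 /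
            (4 * ((Real.exp (2 * Ω * t) / (2 * Ω) : ℝ) : ℂ))) =
      ((Real.exp (-(2 * Ω * t)) * ⟪k, k'⟫_ℝ / (2 * Ω) -
        (‖k‖ ^ 2 + ‖k'‖ ^ 2) / (4 * Ω) : ℝ) : ℂ) := by
  have hΩ' : (Ω : ℂ) ≠ 0 := Complex.ofReal_ne_zero.2 hΩ
  have hexp : (Real.exp (2 * Ω * t) : ℂ) ≠ 0 := Complex.ofReal_ne_zero.2 (Real.exp_ne_zero _)
  rw [← Complex.ofReal_pow ‖k - k'‖, ← Complex.ofReal_pow ‖k + k'‖, norm_sub_sq_real,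
    norm_add_sq_real, div_pow, Complex.I_sq, Real.exp_neg]
  generalize Real.exp (2 * Ω * t) = E at hexp ⊢
  push_cast
  field_simp
  ring

theorem integral_overlap_mul_heatWeight_mul_overlap (hΩ : 0 < Ω) (t : ℝ) (k k' : Space d) :
    ∫ z : Space d × Space d, overlap Ω z.1 z.2 0 k * (heatWeight Ω t z * overlap Ω 0 k' z.1 z.2) =
      (Real.exp (-((1 - Real.exp (-(2 * Ω * t)) ^ 2) * ‖k‖ ^ 2 / (4 * Ω))) : ℂ) *
        overlap Ω 0 k' 0 (Real.exp (-(2 * Ω * t)) • k) := by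
  simp only [overlap_mul_heatWeight_mul_overlap hΩ.ne']
  rw [integral_const_mul, Measure.volume_eq_prod, integral_prod_mul
      (fun q : Space d => Complex.exp (-((Real.exp (2 * Ω * t) * Ω / 2 : ℝ) : ℂ) * ‖q‖ ^ 2 +
        Complex.I / 2 * (⟪k - k', q⟫_ℝ : ℝ)))
      (fun p : Space d => Complex.exp (-((Real.exp (2 * Ω * t) / (2 * Ω) : ℝ) : ℂ) * ‖p‖ ^ 2 +
        ((1 / (2 * Ω) : ℝ) : ℂ) * (⟪k + k', p⟫_ℝ : ℝ))),
    integral_gaussian_cexp (by positivity), integral_gaussian_cexp (by positivity),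
    mul_mul_mul_comm (Complex.ofReal _) (Complex.exp _), ← Complex.exp_add, mul_mul_mul_comm,
    ← Complex.exp_add, gaussian_exponents_add hΩ.ne', exp_mul_overlap_zero_smul]
  simp only [← Complex.ofReal_pow, ← Complex.ofReal_mul, sq_mul_heatConst_mul hΩ]

theorem ext_inner_coherent (hΩ : 0 < Ω) {X Y : Hilb d →L[ℂ] Hilb d}
    (h : ∀ (S S' : Finset (Fin d)) (k k' : Space d),
      ⟪embed d (coherent hΩ 0 k' S'), X (embed d (coherent hΩ 0 k S))⟫_ℂ =
        ⟪embed d (coherent hΩ 0 k' S'), Y (embed d (coherent hΩ 0 k S))⟫_ℂ) : X = Y := by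
  have sub_coherent (S : Finset (Fin d)) (k : Space d) :
      (X - Y) (embed d (coherent hΩ 0 k S)) = 0 :=
    eq_zero_of_inner_coherent hΩ fun S' k' => by
      rw [_root_.sub_apply, inner_sub_right, h, sub_self]
  have adjoint_sub : ContinuousLinearMap.adjoint (X - Y) = 0 := by
    ext1 f
    refine eq_zero_of_inner_coherent hΩ fun S k => ?_
    rw [ContinuousLinearMap.adjoint_inner_right, sub_coherent, inner_zero_left]
  rwa [map_eq_zero_iff _ (LinearIsometryEquiv.injective _), sub_eq_zero] at adjoint_sub

theorem inner_coherent_integral_rankOne_coherent (hΩ : 0 < Ω) (ht : 0 < t)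
    (T S S' : Finset (Fin d)) (k k' : Space d) :
    ⟪embed d (coherent hΩ 0 k' S'), (∫ z : Space d × Space d, InnerProductSpace.rankOne ℂ
        ((heatWeight Ω t z : ℂ) • embed d (coherent hΩ z.1 z.2 T))
        (embed d (coherent hΩ z.1 z.2 T))) (embed d (coherent hΩ 0 k S))⟫_ℂ =
      if S' = T then if T = S then
        (Real.exp (-((1 - Real.exp (-(2 * Ω * t)) ^ 2) * ‖k‖ ^ 2 / (4 * Ω))) : ℂ) *
          overlap Ω 0 k' 0 (Real.exp (-(2 * Ω * t)) • k) else 0 else 0 := by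
  have hinner := inner_integral_rankOne (integrable_heatWeight_smul_rankOne_coherent hΩ ht T) 1
    (embed d (coherent hΩ 0 k S)) (embed d (coherent hΩ 0 k' S'))
  simp only [one_apply_eq_self, inner_smul_right, inner_coherent] at hinner
  refine hinner.trans ?_
  split_ifs
  · exact integral_overlap_mul_heatWeight_mul_overlap hΩ t k k'
  all_goals simp only [mul_zero, zero_mul, integral_zero]

theorem heat_eq_sum_integral_rankOne_coherent (hΩ : 0 < Ω) (ht : 0 < t) (j : Fin 2) :
    heat (dirac d Ω j) t = ∑ S : Finset (Fin d),
      (Real.exp (-t * (2 * Ω * fermionNumber j S)) : ℂ) •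
        ∫ z : Space d × Space d, InnerProductSpace.rankOne ℂ
          ((heatWeight Ω t z : ℂ) • embed d (coherent hΩ z.1 z.2 S))
          (embed d (coherent hΩ z.1 z.2 S)) := by
  refine ext_inner_coherent hΩ fun S S' k k' => ?_
  rw [heat_coherent hΩ ht, inner_smul_right, inner_coherent, _root_.sum_apply, inner_sum]
  simp only [_root_.smul_apply, inner_smul_right, inner_coherent_integral_rankOne_coherent hΩ ht,
    mul_ite, mul_zero, Finset.sum_ite_eq, Finset.mem_univ, if_true]
  split_ifs with hS
  · rw [hS, mul_assoc]
  · rfl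

end HeatWeight

/-! ### Decay of Moyal products with coherent states -/

section WindowedFourier

theorem one_add_norm_add_le_mul {E : Type*} [SeminormedAddGroup E] (x y : E) :
    1 + ‖x + y‖ ≤ (1 + ‖x‖) * (1 + ‖y‖) := by
  nlinarith [norm_add_le x y, mul_nonneg (norm_nonneg x) (norm_nonneg y)]

theorem exists_one_add_norm_pow_mul_norm_le {E F : Type*} [NormedAddCommGroup E] [NormedSpace ℝ E]
    [NormedAddCommGroup F] [NormedSpace ℝ F] (f : 𝓢(E, F)) (n : ℕ) :
    ∃ C, 0 ≤ C ∧ ∀ x, (1 + ‖x‖) ^ n * ‖f x‖ ≤ C := by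
  have decay x := one_add_le_sup_seminorm_apply (𝕜 := ℝ) (m := (n, 0)) le_rfl le_rfl f x
  simp only [norm_iteratedFDeriv_zero] at decay
  exact ⟨_, (by positivity : 0 ≤ (1 + ‖(0 : E)‖) ^ n * ‖f 0‖).trans (decay 0), decay⟩

theorem lineDerivOp_compSubConstCLM {𝕜 E F : Type*} [RCLike 𝕜] [NormedAddCommGroup E]
    [NormedSpace ℝ E] [NormedAddCommGroup F] [NormedSpace ℝ F] [NormedSpace 𝕜 F]
    (a v : E) (f : 𝓢(E, F)) :
    ∂_{v} (compSubConstCLM 𝕜 a f) = compSubConstCLM 𝕜 a (∂_{v} f) := by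
  ext x
  have hfun : (compSubConstCLM 𝕜 a f : E → F) = fun y => f (y - a) :=
    funext fun y => compSubConstCLM_apply f a y
  rw [compSubConstCLM_apply, lineDerivOp_apply_eq_fderiv, lineDerivOp_apply_eq_fderiv, hfun,
    fderiv_comp_sub]

variable {E F : Type*} [NormedAddCommGroup E] [InnerProductSpace ℝ E] [NormedAddCommGroup F]
  [NormedSpace ℂ F]

theorem norm_le_sum_abs_inner {ι : Type*} [Fintype ι] (b : OrthonormalBasis ι ℝ E) (ξ : E) :
    ‖ξ‖ ≤ ∑ i, |⟪ξ, b i⟫_ℝ| := by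
  conv_lhs => rw [← b.sum_repr' ξ]
  refine (norm_sum_le _ _).trans_eq (Finset.sum_congr rfl fun i _ => ?_)
  rw [norm_smul, b.norm_eq_one, mul_one, Real.norm_eq_abs, real_inner_comm]

theorem lineDerivOp_smulLeftCLM_cexp (ξ v : E) (G : 𝓢(E, F)) :
    ∂_{v} (smulLeftCLM F (fun y : E => Complex.exp (Complex.I * (⟪ξ, y⟫_ℝ : ℝ))) G) =
      smulLeftCLM F (fun y : E => Complex.exp (Complex.I * (⟪ξ, y⟫_ℝ : ℝ))) (∂_{v} G) +
        (Complex.I * (⟪ξ, v⟫_ℝ : ℝ)) •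
          smulLeftCLM F (fun y : E => Complex.exp (Complex.I * (⟪ξ, y⟫_ℝ : ℝ))) G := by
  ext x
  have hderiv := (((Complex.ofRealCLM ∘L innerSL ℝ ξ).hasFDerivAt (x := x)).const_mul
    Complex.I).cexp.smul (G.differentiableAt (x := x)).hasFDerivAt
  have hfun : (smulLeftCLM F (fun y : E => Complex.exp (Complex.I * (⟪ξ, y⟫_ℝ : ℝ))) G : E → F) =
      fun y => Complex.exp (Complex.I * (⟪ξ, y⟫_ℝ : ℝ)) • G y :=
    funext fun y => smulLeftCLM_apply_apply (hasTemperateGrowth_cexp_I_mul_inner ξ) G y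
  rw [lineDerivOp_apply_eq_fderiv, add_apply, smul_apply,
    smulLeftCLM_apply_apply (hasTemperateGrowth_cexp_I_mul_inner ξ), hfun,
    lineDerivOp_apply_eq_fderiv]
  refine (congrArg (· v) hderiv.fderiv).trans ?_
  simp only [ContinuousLinearMap.comp_apply, coe_innerSL_apply, Complex.ofRealCLM_apply, add_apply,
    smul_apply, ContinuousLinearMap.smulRight_apply, smul_eq_mul, add_right_inj]
  rw [mul_comm, mul_smul]

variable [MeasurableSpace E] [BorelSpace E]

theorem integrable_smul_schwartzMap [FiniteDimensional ℝ E] (g : 𝓢(E, ℝ)) (G : 𝓢(E, F)) :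
    Integrable fun y => g y • G y := by
  exact (smulLeftCLM F g G).integrable.congr
    (.of_forall fun y => smulLeftCLM_apply_apply g.hasTemperateGrowth G y)

variable [FiniteDimensional ℝ E]

theorem integrable_inv_one_add_norm_pow {n : ℕ} (hn : Module.finrank ℝ E < n) :
    Integrable fun y : E => ((1 + ‖y‖) ^ n)⁻¹ := by
  refine (integrable_one_add_norm (μ := volume) (Nat.cast_lt.2 hn)).congr (.of_forall fun y => ?_)
  simp only [Real.rpow_neg (by positivity : 0 ≤ 1 + ‖y‖), Real.rpow_natCast]

/-- The windowed Fourier transform `∫ exp (i ⟨ξ, y⟩) g (y + r) G (y) dy` of `G` with the window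
`g`, in the sign conventions in which it gives the Moyal products with coherent states. -/
def windowedFourier (g : 𝓢(E, ℝ)) (G : 𝓢(E, F)) (r ξ : E) : F :=
  ∫ y, Complex.exp (Complex.I * (⟪ξ, y⟫_ℝ : ℝ)) • g (y + r) • G y

theorem windowedFourier_eq (g : 𝓢(E, ℝ)) (G : 𝓢(E, F)) (r ξ : E) :
    windowedFourier g G r ξ = ∫ y, compSubConstCLM ℝ (-r) g y •
      smulLeftCLM F (fun y : E => Complex.exp (Complex.I * (⟪ξ, y⟫_ℝ : ℝ))) G y := by
  simp only [windowedFourier, compSubConstCLM_apply, sub_neg_eq_add,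
    smulLeftCLM_apply_apply (hasTemperateGrowth_cexp_I_mul_inner ξ), smul_comm (g _)]

theorem inner_smul_windowedFourier (g : 𝓢(E, ℝ)) (G : 𝓢(E, F)) (r ξ v : E) :
    (Complex.I * (⟪ξ, v⟫_ℝ : ℝ)) • windowedFourier g G r ξ =
      -(windowedFourier (∂_{v} g) G r ξ + windowedFourier g (∂_{v} G) r ξ) := by
  have by_parts := integral_smul_lineDerivOp_right_eq_neg_left (μ := volume)
    (compSubConstCLM ℝ (-r) g)
    (smulLeftCLM F (fun y : E => Complex.exp (Complex.I * (⟪ξ, y⟫_ℝ : ℝ))) G) v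
  simp only [lineDerivOp_compSubConstCLM, lineDerivOp_smulLeftCLM_cexp, add_apply, smul_apply,
    smul_add, smul_comm _ (Complex.I * _ : ℂ)] at by_parts
  rw [integral_add (integrable_smul_schwartzMap _ _)
      ((integrable_smul_schwartzMap _ _).fun_smul (Complex.I * _ : ℂ)), integral_smul,
    ← windowedFourier_eq, ← windowedFourier_eq, ← windowedFourier_eq] at by_parts
  rw [neg_add, ← by_parts, add_neg_cancel_comm]

theorem exists_one_add_norm_pow_mul_norm_windowedFourier_le (N : ℕ) (g : 𝓢(E, ℝ)) (G : 𝓢(E, F)) :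
    ∃ C, 0 ≤ C ∧ ∀ r ξ, (1 + ‖r‖) ^ N * ‖windowedFourier g G r ξ‖ ≤ C := by
  obtain ⟨C₁, hC₁, g_le⟩ := exists_one_add_norm_pow_mul_norm_le g N
  obtain ⟨C₂, hC₂, G_le⟩ :=
    exists_one_add_norm_pow_mul_norm_le G (N + (Module.finrank ℝ E + 1))
  refine ⟨C₁ * C₂ * ∫ y : E, ((1 + ‖y‖) ^ (Module.finrank ℝ E + 1))⁻¹, by positivity,
    fun r ξ => ?_⟩
  rw [← le_div_iff₀' (by positivity), mul_div_right_comm, ← integral_const_mul]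
  refine norm_integral_le_of_norm_le ((integrable_inv_one_add_norm_pow (by simp)).const_mul _)
    (.of_forall fun y => ?_)
  have peetre : 1 + ‖r‖ ≤ (1 + ‖y‖) * (1 + ‖y + r‖) := by
    simpa only [neg_add_cancel_left, norm_neg] using one_add_norm_add_le_mul (-y) (y + r)
  rw [norm_smul, norm_smul, mul_comm Complex.I, Complex.norm_exp_ofReal_mul_I, one_mul,
    ← div_eq_mul_inv, div_div, le_div_iff₀ (by positivity)]
  calc ‖g (y + r)‖ * ‖G y‖ * ((1 + ‖r‖) ^ N * (1 + ‖y‖) ^ (Module.finrank ℝ E + 1))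
      ≤ ‖g (y + r)‖ * ‖G y‖ *
          (((1 + ‖y‖) * (1 + ‖y + r‖)) ^ N * (1 + ‖y‖) ^ (Module.finrank ℝ E + 1)) := by
        gcongr
    _ = (1 + ‖y + r‖) ^ N * ‖g (y + r)‖ *
          ((1 + ‖y‖) ^ (N + (Module.finrank ℝ E + 1)) * ‖G y‖) := by
        rw [mul_pow, pow_add]
        ring
    _ ≤ C₁ * C₂ := mul_le_mul (g_le _) (G_le y) (by positivity) hC₁

theorem exists_pow_mul_pow_mul_norm_windowedFourier_le (M N : ℕ) (g : 𝓢(E, ℝ)) (G : 𝓢(E, F)) :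
    ∃ C, 0 ≤ C ∧ ∀ r ξ, (1 + ‖r‖) ^ N * (1 + ‖ξ‖) ^ M * ‖windowedFourier g G r ξ‖ ≤ C := by
  induction M generalizing g G with
  | zero => simpa using exists_one_add_norm_pow_mul_norm_windowedFourier_le N g G
  | succ M ih =>
    let b := stdOrthonormalBasis ℝ E
    obtain ⟨C, hC, hle⟩ := ih g G
    choose C₁ hC₁ hle₁ using fun i => ih (∂_{b i} g) G
    choose C₂ hC₂ hle₂ using fun i => ih g (∂_{b i} G)
    refine ⟨C + ∑ i, (C₁ i + C₂ i), add_nonneg hC (Finset.sum_nonneg fun i _ =>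
      add_nonneg (hC₁ i) (hC₂ i)), fun r ξ => ?_⟩
    set weight := (1 + ‖r‖) ^ N * (1 + ‖ξ‖) ^ M with hweight
    have inner_mul_le i : weight * (|⟪ξ, b i⟫_ℝ| * ‖windowedFourier g G r ξ‖) ≤ C₁ i + C₂ i := by
      have norm_eq := congrArg norm (inner_smul_windowedFourier g G r ξ (b i))
      rw [norm_smul, norm_mul, Complex.norm_I, one_mul, Complex.norm_real, Real.norm_eq_abs,
        norm_neg] at norm_eq
      calc weight * (|⟪ξ, b i⟫_ℝ| * ‖windowedFourier g G r ξ‖)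
          ≤ weight * (‖windowedFourier (∂_{b i} g) G r ξ‖ +
              ‖windowedFourier g (∂_{b i} G) r ξ‖) := by
            rw [norm_eq]
            gcongr
            exact norm_add_le _ _
        _ ≤ C₁ i + C₂ i := by
            rw [mul_add]
            exact add_le_add (hle₁ i r ξ) (hle₂ i r ξ)
    calc (1 + ‖r‖) ^ N * (1 + ‖ξ‖) ^ (M + 1) * ‖windowedFourier g G r ξ‖
        = weight * ((1 + ‖ξ‖) * ‖windowedFourier g G r ξ‖) := by
          rw [hweight, pow_succ]
          ring
      _ ≤ weight * ((1 + ∑ i, |⟪ξ, b i⟫_ℝ|) * ‖windowedFourier g G r ξ‖) := by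
          gcongr
          exact norm_le_sum_abs_inner b ξ
      _ = weight * ‖windowedFourier g G r ξ‖ +
            ∑ i, weight * (|⟪ξ, b i⟫_ℝ| * ‖windowedFourier g G r ξ‖) := by
          rw [← Finset.mul_sum, ← Finset.sum_mul]
          ring
      _ ≤ C + ∑ i, (C₁ i + C₂ i) :=
          add_le_add (hle r ξ) (Finset.sum_le_sum fun i _ => inner_mul_le i)

theorem exists_norm_windowedFourier_sub_le (M N : ℕ) (g : 𝓢(E, ℝ)) (G : 𝓢(E, F)) (B : E →L[ℝ] E) :
    ∃ C, 0 ≤ C ∧ ∀ q p x, ‖windowedFourier g G (x - q) (p - B x)‖ ≤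
      C * ((1 + ‖p - B q‖) ^ M)⁻¹ * ((1 + ‖x - q‖) ^ N)⁻¹ := by
  obtain ⟨C, hC, hle⟩ := exists_pow_mul_pow_mul_norm_windowedFourier_le M (M + N) g G
  refine ⟨(1 + ‖B‖) ^ M * C, by positivity, fun q p x => ?_⟩
  have peetre : 1 + ‖p - B q‖ ≤ (1 + ‖p - B x‖) * ((1 + ‖B‖) * (1 + ‖x - q‖)) := calc
    1 + ‖p - B q‖ ≤ (1 + ‖p - B x‖) * (1 + ‖B (x - q)‖) := by
      simpa only [map_sub, sub_add_sub_cancel] using one_add_norm_add_le_mul (p - B x) (B (x - q))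
    _ ≤ (1 + ‖p - B x‖) * (1 + ‖B‖ * ‖x - q‖) := by
      gcongr
      exact B.le_opNorm _
    _ ≤ (1 + ‖p - B x‖) * ((1 + ‖B‖) * (1 + ‖x - q‖)) := by
      gcongr
      nlinarith [norm_nonneg B, norm_nonneg (x - q)]
  rw [← div_eq_mul_inv, ← div_eq_mul_inv, div_div, le_div_iff₀' (by positivity)]
  calc (1 + ‖p - B q‖) ^ M * (1 + ‖x - q‖) ^ N * ‖windowedFourier g G (x - q) (p - B x)‖
      ≤ ((1 + ‖p - B x‖) * ((1 + ‖B‖) * (1 + ‖x - q‖))) ^ M * (1 + ‖x - q‖) ^ N *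
          ‖windowedFourier g G (x - q) (p - B x)‖ := by gcongr
    _ = (1 + ‖B‖) ^ M * ((1 + ‖x - q‖) ^ (M + N) * (1 + ‖p - B x‖) ^ M *
          ‖windowedFourier g G (x - q) (p - B x)‖) := by
        rw [mul_pow, mul_pow, pow_add]
        ring
    _ ≤ (1 + ‖B‖) ^ M * C := mul_le_mul_of_nonneg_left (hle _ _) (by positivity)

theorem norm_lp_le_mul_of_ae_norm_le_comp_sub {F : Type*} [NormedAddCommGroup F] {h : E → ℝ}
    {p : ℝ≥0∞} (hh : MemLp h p)
    {f : Lp F p (volume : Measure E)} {c : ℝ} (q : E) (hf : ∀ᵐ x, ‖f x‖ ≤ c * ‖h (x - q)‖) :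
    ‖f‖ ≤ c * (eLpNorm h p).toReal := by
  have hq := measurePreserving_sub_right (volume : Measure E) q
  rw [← Lp.norm_toLp h hh, ← Lp.norm_compMeasurePreserving (hh.toLp h) hq]
  refine Lp.norm_le_mul_norm_of_ae_le_mul ?_
  filter_upwards [hf, Lp.coeFn_compMeasurePreserving (hh.toLp h) hq,
    hq.quasiMeasurePreserving.ae hh.coeFn_toLp] with x hfx hcomp htoLp
  rwa [hcomp, Function.comp_apply, htoLp]

theorem memLp_two_inv_one_add_norm_pow {n : ℕ} (hn : Module.finrank ℝ E < n) :
    MemLp (fun y : E => ((1 + ‖y‖) ^ n)⁻¹) 2 := by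
  have hcont : Continuous fun y : E => ((1 + ‖y‖) ^ n)⁻¹ :=
    Continuous.inv₀ (by fun_prop) fun y => by positivity
  rw [memLp_two_iff_integrable_sq hcont.aestronglyMeasurable]
  simpa only [inv_pow, ← pow_mul] using
    integrable_inv_one_add_norm_pow (E := E) (n := n * 2) (by lia)

end WindowedFourier

section LeftMoyal

variable {d : ℕ} {Ω : ℝ} {Θ : Matrix (Fin d) (Fin d) ℝ}

theorem isLeftMoyal_leftMoyal (hΘ : IsUnit Θ.det) (f : 𝓢(Space d, ℂ)) :
    IsLeftMoyal Θ f (leftMoyal Θ f) := by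
  rw [leftMoyal, dif_pos (exists_isLeftMoyal hΘ f)]
  exact (exists_isLeftMoyal hΘ f).choose_spec

theorem norm_integral_smul_coherent (hΩ : 0 < Ω) (G : 𝓢(Space d, ℂ)) (x ξ q p : Space d)
    (S : Finset (Fin d)) :
    ‖∫ y, (Complex.exp (-(Complex.I * (⟪ξ, y⟫_ℝ : ℝ))) * G y) • coherent hΩ q p S (x + y)‖ =
      ‖windowedFourier (gaussian (Space d) (half_pos hΩ)) G (x - q) (p - ξ)‖ := by
  have integrand_eq (y : Space d) :
      (Complex.exp (-(Complex.I * (⟪ξ, y⟫_ℝ : ℝ))) * G y) • coherent hΩ q p S (x + y) =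
        (Complex.exp ((⟪p, x⟫_ℝ : ℝ) * Complex.I) *
          (Complex.exp (Complex.I * (⟪p - ξ, y⟫_ℝ : ℝ)) •
            gaussian (Space d) (half_pos hΩ) (y + (x - q)) • G y)) •
          EuclideanSpace.single S (1 : ℂ) := by
    rw [coherent_apply, smul_smul, coherentFun, gaussian_apply, smul_eq_mul, Complex.real_smul,
      Complex.ofReal_exp, ← mul_assoc, ← mul_assoc, mul_right_comm, ← Complex.exp_add,
      ← Complex.exp_add, ← Complex.exp_add, show y + (x - q) = x + y - q by abel, inner_sub_left,
      inner_add_right]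
    push_cast
    ring_nf
  simp only [integrand_eq]
  rw [integral_smul_const, norm_smul, integral_const_mul, norm_mul,
    Complex.norm_exp_ofReal_mul_I, one_mul, PiLp.norm_single, norm_one, mul_one,
    windowedFourier]

theorem exists_norm_leftMoyal_coherent_apply_eq (hΩ : 0 < Ω) (hΘ : IsUnit Θ.det)
    (f : 𝓢(Space d, ℂ)) :
    ∃ (G : 𝓢(Space d, ℂ)) (B : Space d →L[ℝ] Space d), ∀ q p S, ∀ᵐ x,
      ‖leftMoyal Θ f (embed d (coherent hΩ q p S)) x‖ =
        ‖windowedFourier (gaussian (Space d) (half_pos hΩ)) G (x - q) (p - B x)‖ := by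
  obtain ⟨G, B, moyal_eq_integral⟩ := moyal_eq hΘ f
  refine ⟨G, B, fun q p S => ?_⟩
  have embed_ae_eq : embed d (coherent hΩ q p S) =ᵐ[volume] coherent hΩ q p S :=
    coeFn_toLp _ 2 volume
  filter_upwards [isLeftMoyal_leftMoyal hΘ f (embed d (coherent hΩ q p S))] with x hx
  rw [hx, moyal_eq_integral, ← norm_integral_smul_coherent hΩ G x (B x) q p S]
  congr 1
  refine integral_congr_ae ?_
  filter_upwards [(measurePreserving_add_left volume x).quasiMeasurePreserving.ae embed_ae_eq]
    with y hy
  rw [hy]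

theorem exists_norm_leftMoyal_coherent_le (hΩ : 0 < Ω) (hΘ : IsUnit Θ.det) (f : 𝓢(Space d, ℂ))
    (M : ℕ) :
    ∃ (B : Space d →L[ℝ] Space d) (C : ℝ), 0 ≤ C ∧ ∀ q p S,
      ‖leftMoyal Θ f (embed d (coherent hΩ q p S))‖ ≤ C * ((1 + ‖p - B q‖) ^ M)⁻¹ := by
  obtain ⟨G, B, norm_eq⟩ := exists_norm_leftMoyal_coherent_apply_eq hΩ hΘ f
  obtain ⟨C, hC, hle⟩ := exists_norm_windowedFourier_sub_le M (d + 1)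
    (gaussian (Space d) (half_pos hΩ)) G B
  have hmemLp : MemLp (fun y : Space d => ((1 + ‖y‖) ^ (d + 1))⁻¹) 2 :=
    memLp_two_inv_one_add_norm_pow (by simp)
  refine ⟨B, C * (eLpNorm (fun y : Space d => ((1 + ‖y‖) ^ (d + 1))⁻¹) 2).toReal, by positivity,
    fun q p S => ?_⟩
  rw [mul_right_comm]
  refine norm_lp_le_mul_of_ae_norm_le_comp_sub hmemLp q ?_
  filter_upwards [norm_eq q p S] with x hx
  rw [hx, Real.norm_of_nonneg (by positivity)]
  exact hle q p x

end LeftMoyal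

/-! ### The trace norm estimate -/

section Shear

variable {α G : Type*} [MeasurableSpace α] [MeasurableSpace G] [AddGroup G] [MeasurableAdd₂ G]
  [MeasurableSub₂ G] {μ : Measure α} {ν : Measure G} [SFinite μ] [SFinite ν]
  [ν.IsAddRightInvariant] {B : α → G}

theorem measurePreserving_prodMk_sub (hB : Measurable B) :
    MeasurePreserving (fun z : α × G => (z.1, z.2 - B z.1)) (μ.prod ν) (μ.prod ν) :=
  (MeasurePreserving.id μ).skew_product (g := fun x y => y - B x)
    (measurable_snd.sub (hB.comp measurable_fst))
    (.of_forall fun x => (measurePreserving_sub_right ν (B x)).map_eq)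

theorem integrable_mul_comp_sub {g : α → ℝ} {h : G → ℝ} (hg : Integrable g μ) (hh : Integrable h ν)
    (hB : Measurable B) : Integrable (fun z : α × G => g z.1 * h (z.2 - B z.1)) (μ.prod ν) :=
  (measurePreserving_prodMk_sub hB).integrable_comp_of_integrable (hg.mul_prod hh)

theorem integral_mul_comp_sub {g : α → ℝ} {h : G → ℝ} (hg : Integrable g μ) (hh : Integrable h ν)
    (hB : Measurable B) :
    ∫ z : α × G, g z.1 * h (z.2 - B z.1) ∂μ.prod ν = (∫ x, g x ∂μ) * ∫ y, h y ∂ν := by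
  rw [integral_prod _ (integrable_mul_comp_sub hg hh hB)]
  simp only [integral_const_mul, integral_sub_right_eq_self h, integral_mul_const]

end Shear

section TraceEstimate

variable {d : ℕ} {Ω t : ℝ}

theorem norm_embed_coherent (hΩ : 0 < Ω) (q p : Space d) (S : Finset (Fin d)) :
    ‖embed d (coherent hΩ q p S)‖ = √((Real.pi / Ω) ^ ((d : ℝ) / 2)) := by
  rw [← norm_sq_embed_coherent hΩ q p S, Real.sqrt_sq (norm_nonneg _)]

theorem hasTraceBound_comp_integral_rankOne_coherent (hΩ : 0 < Ω) (ht : 0 < t)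
    {T : Hilb d →L[ℂ] Hilb d} {M : Space d × Space d → ℝ} {S : Finset (Fin d)}
    (hM : ∀ z, ‖T (embed d (coherent hΩ z.1 z.2 S))‖ ≤ M z)
    (hint : Integrable fun z => heatWeight Ω t z * M z) :
    HasTraceBound (T ∘L ∫ z : Space d × Space d, InnerProductSpace.rankOne ℂ
        ((heatWeight Ω t z : ℂ) • embed d (coherent hΩ z.1 z.2 S))
        (embed d (coherent hΩ z.1 z.2 S)))
      (√((Real.pi / Ω) ^ ((d : ℝ) / 2)) * ∫ z, heatWeight Ω t z * M z) := by
  rw [← integral_const_mul]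
  refine hasTraceBound_comp_integral_rankOne
    (integrable_heatWeight_smul_rankOne_coherent hΩ ht S) T (hint.const_mul _) fun z => ?_
  have weight_nonneg := heatWeight_nonneg hΩ t z
  rw [map_smul, norm_smul, Complex.norm_real, Real.norm_of_nonneg weight_nonneg,
    norm_embed_coherent]
  gcongr
  exact hM z

theorem traceNorm_comp_heat_le (hΩ : 0 < Ω) (ht : 0 < t) (j : Fin 2) {T : Hilb d →L[ℂ] Hilb d}
    {M : Space d × Space d → ℝ} (hM : ∀ z S, ‖T (embed d (coherent hΩ z.1 z.2 S))‖ ≤ M z)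
    (hint : Integrable fun z => heatWeight Ω t z * M z) :
    traceNorm (T ∘L heat (dirac d Ω j) t) ≤ ENNReal.ofReal
      (2 ^ d * (√((Real.pi / Ω) ^ ((d : ℝ) / 2)) * ∫ z, heatWeight Ω t z * M z)) := by
  have exp_le_one (S : Finset (Fin d)) :
      ‖(Real.exp (-t * (2 * Ω * fermionNumber j S)) : ℂ)‖ ≤ 1 := by
    rw [Complex.norm_real, Real.norm_of_nonneg (Real.exp_pos _).le, Real.exp_le_one_iff, neg_mul,
      neg_nonpos]
    positivity
  have hbound := HasTraceBound.sum Finset.univ fun S _ =>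
    (hasTraceBound_comp_integral_rankOne_coherent hΩ ht (fun z => hM z S) hint).smul
      (exp_le_one S)
  simp only [← ContinuousLinearMap.comp_smul, ← ContinuousLinearMap.comp_finsetSum,
    ← heat_eq_sum_integral_rankOne_coherent hΩ ht j, Finset.sum_const, Finset.card_univ,
    Fintype.card_finset, Fintype.card_fin, nsmul_eq_mul, Nat.cast_pow, Nat.cast_ofNat] at hbound
  exact hbound.traceNorm_le

theorem integral_gaussian_eq {c : ℝ} (hc : 0 < c) :
    ∫ x, gaussian (Space d) hc x = (Real.pi / c) ^ ((d : ℝ) / 2) := by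
  simp only [gaussian_apply, ← neg_mul]
  rw [GaussianFourier.integral_rexp_neg_mul_sq_norm hc, finrank_euclideanSpace_fin]

theorem integral_heatWeight (hΩ : 0 < Ω) (ht : 0 < t) :
    ∫ z : Space d × Space d, heatWeight Ω t z =
      ((Real.pi / Ω) ^ ((d : ℝ) / 2))⁻¹ *
        (Real.exp (2 * Ω * t) / (Real.exp (2 * Ω * t) - 1)) ^ d := by
  have hexp := exp_two_mul_mul_sub_one_pos hΩ ht
  have rescale {c : ℝ} (hc : 0 < c) : (Real.pi / ((Real.exp (2 * Ω * t) - 1) * c)) ^ ((d : ℝ) / 2) =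
      (Real.exp (2 * Ω * t) / (Real.exp (2 * Ω * t) - 1)) ^ ((d : ℝ) / 2) *
        (Real.pi / (Real.exp (2 * Ω * t) * c)) ^ ((d : ℝ) / 2) := by
    rw [← Real.mul_rpow (by positivity) (by positivity)]
    congr 1
    field_simp
  have weight_eq (z : Space d × Space d) : heatWeight Ω t z = heatConst d Ω t *
      (gaussian (Space d) (by positivity : 0 < (Real.exp (2 * Ω * t) - 1) * Ω / 2) z.1 *
        gaussian (Space d) (by positivity : 0 < (Real.exp (2 * Ω * t) - 1) / (2 * Ω)) z.2) := by
    simp only [heatWeight, gaussian_apply]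
  simp only [weight_eq]
  rw [integral_const_mul, Measure.volume_eq_prod, integral_prod_mul, integral_gaussian_eq,
    integral_gaussian_eq, mul_div_assoc, div_eq_mul_inv _ (2 * Ω), rescale (by positivity),
    rescale (by positivity), heatConst, mul_div_assoc, div_eq_mul_inv _ (2 * Ω),
    mul_mul_mul_comm, ← sq, ← Real.rpow_mul_natCast (by positivity)]
  field_simp
  simp

theorem integral_heatWeight_anti (hΩ : 0 < Ω) {s : ℝ} (hs : 0 < s) (hst : s ≤ t) :
    ∫ z : Space d × Space d, heatWeight Ω t z ≤ ∫ z : Space d × Space d, heatWeight Ω s z := by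
  have hexp_s := exp_two_mul_mul_sub_one_pos hΩ hs
  have hexp_t := exp_two_mul_mul_sub_one_pos hΩ (hs.trans_le hst)
  have exp_mono : Real.exp (2 * Ω * s) ≤ Real.exp (2 * Ω * t) := by gcongr
  rw [integral_heatWeight hΩ hs, integral_heatWeight hΩ (hs.trans_le hst)]
  gcongr ?_ * ?_ ^ d
  rw [div_le_div_iff₀ hexp_t hexp_s]
  linarith

theorem heatConst_mono (hΩ : 0 < Ω) : Monotone (heatConst d Ω) := fun s t hst => by
  have exp_mono : Real.exp (2 * Ω * s) ≤ Real.exp (2 * Ω * t) := by gcongr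
  unfold heatConst
  gcongr

theorem heatWeight_le (hΩ : 0 < Ω) (ht : 0 < t) (z : Space d × Space d) :
    heatWeight Ω t z ≤
      heatConst d Ω t * Real.exp (-((Real.exp (2 * Ω * t) - 1) * Ω / 2 * ‖z.1‖ ^ 2)) := by
  have hexp := exp_two_mul_mul_sub_one_pos hΩ ht
  have hconst := heatConst_pos d hΩ t
  rw [heatWeight]
  gcongr
  refine mul_le_of_le_one_right (Real.exp_pos _).le (Real.exp_le_one_iff.2 ?_)
  rw [neg_nonpos]
  positivity

theorem integrable_heatWeight_mul_comp_sub (hΩ : 0 < Ω) (ht : 0 < t) {B : Space d → Space d}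
    (hB : Measurable B) {h : Space d → ℝ} (hh : Integrable h) :
    Integrable fun z : Space d × Space d => heatWeight Ω t z * h (z.2 - B z.1) := by
  have hexp := exp_two_mul_mul_sub_one_pos hΩ ht
  have momentum_le_one (p : Space d) :
      ‖gaussian (Space d) (by positivity : 0 < (Real.exp (2 * Ω * t) - 1) / (2 * Ω)) p‖ ≤ 1 := by
    rw [gaussian_apply, Real.norm_of_nonneg (Real.exp_pos _).le, Real.exp_le_one_iff, neg_nonpos]
    positivity
  have hshear := integrable_mul_comp_sub (gaussian (Space d)
    (by positivity : 0 < (Real.exp (2 * Ω * t) - 1) * Ω / 2)).integrable (μ := volume) hh hB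
  refine ((hshear.bdd_mul (((SchwartzMap.continuous _).comp continuous_snd).aestronglyMeasurable)
    (.of_forall fun z => momentum_le_one z.2)).const_mul (heatConst d Ω t)).congr
      (.of_forall fun z => ?_)
  simp only [heatWeight, gaussian_apply, Function.comp_apply]
  ring

theorem pi_div_rpow_le (hΩ : 0 < Ω) (ht : 0 < t) {s : ℝ} (hs : 0 ≤ s) :
    (Real.pi / ((Real.exp (2 * Ω * t) - 1) * Ω / 2)) ^ s ≤
      (Real.pi / Ω ^ 2) ^ s * t ^ (-s) := by
  have hexp := Real.add_one_le_exp (2 * Ω * t)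
  rw [Real.rpow_neg ht.le, ← Real.inv_rpow ht.le, ← Real.mul_rpow (by positivity) (by positivity),
    ← div_eq_mul_inv, div_div]
  gcongr
  · have := exp_two_mul_mul_sub_one_pos hΩ ht
    positivity
  · nlinarith

theorem integral_heatWeight_mul_comp_sub_le (hΩ : 0 < Ω) (ht : 0 < t) (ht1 : t ≤ 1)
    {B : Space d → Space d} (hB : Measurable B) {h : Space d → ℝ} (hh : Integrable h)
    (h_nonneg : 0 ≤ h) :
    ∫ z : Space d × Space d, heatWeight Ω t z * h (z.2 - B z.1) ≤
      heatConst d Ω 1 * ((Real.pi / Ω ^ 2) ^ ((d : ℝ) / 2) * t ^ (-((d : ℝ) / 2)) * ∫ p, h p) := by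
  have hexp := exp_two_mul_mul_sub_one_pos hΩ ht
  have hconst := heatConst_pos d hΩ 1
  set g := gaussian (Space d) (by positivity : 0 < (Real.exp (2 * Ω * t) - 1) * Ω / 2) with hg
  calc ∫ z : Space d × Space d, heatWeight Ω t z * h (z.2 - B z.1)
      ≤ ∫ z : Space d × Space d, heatConst d Ω 1 * (g z.1 * h (z.2 - B z.1)) := by
        refine integral_mono (integrable_heatWeight_mul_comp_sub hΩ ht hB hh)
          ((integrable_mul_comp_sub g.integrable hh hB).const_mul _) fun z => ?_
        dsimp only
        rw [← mul_assoc, hg, gaussian_apply]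
        refine mul_le_mul_of_nonneg_right ((heatWeight_le hΩ ht z).trans ?_) (h_nonneg _)
        gcongr
        exact heatConst_mono hΩ ht1
    _ = heatConst d Ω 1 *
          ((Real.pi / ((Real.exp (2 * Ω * t) - 1) * Ω / 2)) ^ ((d : ℝ) / 2) * ∫ p, h p) := by
        rw [integral_const_mul, Measure.volume_eq_prod, integral_mul_comp_sub g.integrable hh hB,
          integral_gaussian_eq]
    _ ≤ _ := by
        gcongr
        · exact integral_nonneg h_nonneg
        · exact pi_div_rpow_le hΩ ht (by positivity)

theorem exists_traceNorm_leftMoyal_comp_heat_le_of_le_one (hΩ : 0 < Ω)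
    {Θ : Matrix (Fin d) (Fin d) ℝ} (hΘ : IsUnit Θ.det) (f : 𝓢(Space d, ℂ)) :
    ∃ C, 0 ≤ C ∧ ∀ (j : Fin 2) (t : ℝ), 0 < t → t ≤ 1 →
      traceNorm (leftMoyal Θ f ∘L heat (dirac d Ω j) t) ≤
        ENNReal.ofReal (C * t ^ (-(d : ℝ) / 2)) := by
  obtain ⟨B, C, hC, decay⟩ := exists_norm_leftMoyal_coherent_le hΩ hΘ f (d + 1)
  let h (p : Space d) : ℝ := C * ((1 + ‖p‖) ^ (d + 1))⁻¹
  have h_integrable : Integrable h := (integrable_inv_one_add_norm_pow (by simp)).const_mul C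
  have h_nonneg : 0 ≤ h := fun p => by positivity
  have hconst := heatConst_pos d hΩ 1
  refine ⟨2 ^ d * (√((Real.pi / Ω) ^ ((d : ℝ) / 2)) *
    (heatConst d Ω 1 * ((Real.pi / Ω ^ 2) ^ ((d : ℝ) / 2) * ∫ p, h p))), by positivity,
    fun j t ht ht1 => ?_⟩
  have B_measurable := B.continuous.measurable
  refine (traceNorm_comp_heat_le hΩ ht j (M := fun z => h (z.2 - B z.1))
    (fun z S => decay z.1 z.2 S)
    (integrable_heatWeight_mul_comp_sub hΩ ht B_measurable h_integrable)).trans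
    (ENNReal.ofReal_le_ofReal ?_)
  rw [neg_div, mul_assoc, mul_assoc, mul_assoc, mul_right_comm]
  gcongr
  exact integral_heatWeight_mul_comp_sub_le hΩ ht ht1 B_measurable h_integrable h_nonneg

theorem exists_traceNorm_comp_heat_le_of_one_le (hΩ : 0 < Ω) (T : Hilb d →L[ℂ] Hilb d) :
    ∃ C, 0 ≤ C ∧ ∀ (j : Fin 2) (t : ℝ), 1 ≤ t →
      traceNorm (T ∘L heat (dirac d Ω j) t) ≤ ENNReal.ofReal C := by
  set N := √((Real.pi / Ω) ^ ((d : ℝ) / 2)) with hN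
  have hintegral : 0 ≤ ∫ z : Space d × Space d, heatWeight Ω 1 z :=
    integral_nonneg fun z => heatWeight_nonneg hΩ 1 z
  refine ⟨2 ^ d * (N * ((∫ z : Space d × Space d, heatWeight Ω 1 z) * (‖T‖ * N))),
    by positivity, fun j t ht => ?_⟩
  refine (traceNorm_comp_heat_le hΩ (one_pos.trans_le ht) j (T := T) (M := fun _ => ‖T‖ * N)
    (fun z S => ?_) ((integrable_heatWeight hΩ (one_pos.trans_le ht)).mul_const _)).trans
    (ENNReal.ofReal_le_ofReal ?_)
  · rw [hN, ← norm_embed_coherent hΩ z.1 z.2 S]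
    exact T.le_opNorm _
  · rw [integral_mul_const]
    gcongr 2 ^ d * (N * (?_ * (‖T‖ * N)))
    exact integral_heatWeight_anti hΩ one_pos ht

theorem exists_traceNorm_leftMoyal_comp_heat_le (hΩ : 0 < Ω) {Θ : Matrix (Fin d) (Fin d) ℝ}
    (hΘ : IsUnit Θ.det) (f : 𝓢(Space d, ℂ)) :
    ∃ C : ℝ, ∀ (j : Fin 2) (t : ℝ), 0 < t →
      traceNorm (leftMoyal Θ f ∘L heat (dirac d Ω j) t) ≤
        ENNReal.ofReal (C * max (t ^ (-(d : ℝ) / 2)) (t ^ ((d : ℝ) / 2))) := by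
  obtain ⟨C₁, hC₁, small⟩ := exists_traceNorm_leftMoyal_comp_heat_le_of_le_one hΩ hΘ f
  obtain ⟨C₂, hC₂, large⟩ := exists_traceNorm_comp_heat_le_of_one_le hΩ (leftMoyal Θ f)
  refine ⟨C₁ + C₂, fun j t ht => ?_⟩
  rcases le_total t 1 with ht1 | ht1
  · refine (small j t ht ht1).trans (ENNReal.ofReal_le_ofReal ?_)
    gcongr
    · exact le_add_of_nonneg_right hC₂
    · exact le_max_left _ _
  · refine (large j t ht1).trans (ENNReal.ofReal_le_ofReal ?_)
    have one_le_max : 1 ≤ max (t ^ (-(d : ℝ) / 2)) (t ^ ((d : ℝ) / 2)) :=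
      (Real.one_le_rpow ht1 (by positivity)).trans (le_max_right _ _)
    exact (le_add_of_nonneg_left hC₁).trans (le_mul_of_one_le_right (by positivity) one_le_max)

end TraceEstimate

end MoyalOscillator

end

theorem mainTheorem8_general (d : ℕ) (Ω : ℝ) (hΩ : 0 < Ω)
    (Θ : Matrix (Fin d) (Fin d) ℝ) (hΘ_inv : IsUnit Θ.det) :
    (∀ j : Fin 2, IsSelfAdjoint (MoyalOscillator.dirac d Ω j)) ∧
    ∀ f : 𝓢(EuclideanSpace ℝ (Fin d), ℂ), ∃ C : ℝ, ∀ j : Fin 2, ∀ t : ℝ, 0 < t →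
      MoyalOscillator.traceNorm
          (MoyalOscillator.leftMoyal Θ f ∘L MoyalOscillator.heat (MoyalOscillator.dirac d Ω j) t) ≤
        ENNReal.ofReal (C * max (t ^ (-(d : ℝ) / 2)) (t ^ ((d : ℝ) / 2))) :=
  ⟨MoyalOscillator.isSelfAdjoint_dirac hΩ,
    MoyalOscillator.exists_traceNorm_leftMoyal_comp_heat_le hΩ hΘ_inv⟩

theorem mainTheorem8 (d : ℕ) (Ω : ℝ) (hΩ : 0 < Ω)
    (Θ : Matrix (Fin d) (Fin d) ℝ) (hΘ_skew : Θ.transpose = -Θ) (hΘ_inv : IsUnit Θ.det) :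
    (∀ j : Fin 2, IsSelfAdjoint (MoyalOscillator.dirac d Ω j)) ∧
    ∀ f : 𝓢(EuclideanSpace ℝ (Fin d), ℂ), ∃ C : ℝ, ∀ j : Fin 2, ∀ t : ℝ, 0 < t →
      MoyalOscillator.traceNorm
          (MoyalOscillator.leftMoyal Θ f ∘L MoyalOscillator.heat (MoyalOscillator.dirac d Ω j) t) ≤
        ENNReal.ofReal (C * max (t ^ (-(d : ℝ) / 2)) (t ^ ((d : ℝ) / 2))) :=
  mainTheorem8_general d Ω hΩ Θ hΘ_inv
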